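/- Let $L\ge 2$, let $\mathbb T_L=\mathbb Z/L\mathbb Z$, and fix $\alpha>3$. Put $a(0)=1$, $a(n)=n^\alpha$ for $n\ge1$, $g(0)=0$ and $g(n)=a(n)/a(n-1)$ for $n\ge 1$. For $N\ge1$ let $E_N=\{\eta\in\mathbb N^{\mathbb T_L}:\sum_z\eta_z=N\}$, and let $\sigma^{z,w}\eta$ be $\eta$ with one particle moved from $z$ to $w$. The totally asymmetric zero range process on $E_N$ is the continuous-time Markov chain with generator $$(\mathcal L F)(\eta)=\sum_{z\in\mathbb T_L}g(\eta_z)\,\{F(\sigma^{z,z+1}\eta)-F(\eta)\}.$$ Its stationary probability measure is $\mu_N(\eta)=\dfrac{N^\alpha}{Z_N}\prod_{z}\dfrac1{a(\eta_z)}$, with $Z_N$ the normalizing constant. Let $\langle\cdot,\cdot\rangle$ be the scalar product of $L^2(\mu_N)$, let $(\mathcal L^* F)(\eta)=\sum_{z}g(\eta_z)\{F(\sigma^{z,z-1}\eta)-F(\eta)\}$ be the adjoint of $\mathcal L$, and let $\mathcal S=\frac12(\mathcal L+\mathcal L^*)$. Let $(\ell_N)_{N\ge1}$ be real numbers with $\ell_N\to\infty$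 and $\ell_N/N\to0$, and let $\mathcal E^z_N=\{\eta\in E_N:\eta_z\ge N-\ell_N\}$ for $z\in\mathbb T_L$. Fix $x\ne y$ in $\mathbb T_L$. For $f:E_N\to\mathbb R$ let $$\mathbb G^{x,y}(f)=\sup_h\big\{2\langle f,\mathcal L h\rangle-\langle h,(-\mathcal S)h\rangle\big\},$$ where the supremum is over all $h:E_N\to\mathbb R$ that are constant on $\mathcal E^x_N$, constant on $\mathcal E^y_N$, and equal to $0$ on $\bigcup_{z\ne x,y}\mathcal E^z_N$. Put $$\Gamma(\alpha)=\sum_{j\ge0}\frac1{a(j)},\qquad I_\alpha=\int_0^1u^\alpha(1-u)^\alpha\,du .$$ Then $$\lim_{N\to\infty}N^{1+\alpha}\inf_f\mathbb G^{x,y}(f)=\frac1{\Gamma(\alpha)\,I_\alpha}\,\frac{L-2}{L-1},$$ where the infimum is over all $f:E_N\to\mathbb R$ that are equal to $1$ on $\mathcal E^x_N$, equal to $0$ on $\bigcup_{z\ne x,y}\mathcal E^z_N$, and constant on $\mathcal E^y_N$. Moreover, let $\mathcal E_N=\bigcup_z\mathcal E^z_N$, and let $R^{\mathcal E}_N(\eta,\xi)=\lambda(\eta)\,\mathbf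 P_\eta[H^+_{\mathcal E_N}=H^+_{\xi}]$, for $\eta\neq\xi$ in $\mathcal E_N$, be the jump rates of the trace of the process on $\mathcal E_N$. Here $\lambda(\eta)=\sum_zg(\eta_z)$ is the total jump rate at $\eta$, $\mathbf P_\eta$ is the law of the process started from $\eta$, and $H^+_{\mathcal A}$ is the first return time to $\mathcal A$ (with $H^+_\xi=H^+_{\{\xi\}}$). With the mean jump rates $$r_N(\mathcal E^y_N,\mathcal E^x_N)=\frac1{\mu_N(\mathcal E^y_N)}\sum_{\eta\in\mathcal E^y_N}\sum_{\xi\in\mathcal E^x_N}\mu_N(\eta)\,R^{\mathcal E}_N(\eta,\xi)$$ one has $$\lim_{N\to\infty}N^{1+\alpha}\,r_N(\mathcal E^y_N,\mathcal E^x_N)=\frac1{\Gamma(\alpha)\,I_\alpha}.$$ -/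

import Mathlib

noncomputable section

namespace ZeroRange

open MeasureTheory ProbabilityTheory

/-- Configurations of particles on the discrete torus with `L` sites. -/
abbrev Config (L : ℕ) : Type := ZMod L → ℕ

/-- `a(n) = n ^ α` for `n ≥ 1`, and `a(0) = 1`. -/
def a (α : ℝ) (n : ℕ) : ℝ := if n = 0 then 1 else (n : ℝ) ^ α

/-- The jump rate: `g(0) = 0` and `g(n) = a(n) / a(n - 1)` for `n ≥ 1`. -/
def g (α : ℝ) (n : ℕ) : ℝ := if n = 0 then 0 else a α n / a α (n - 1)

/-- `σ^{x,y} η`: one particle is moved from `x` to `y`. It is only used with `η x > 0`, or with a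
vanishing factor `g (η x)` in front. -/
def move {L : ℕ} (x y : ZMod L) (η : Config L) : Config L :=
  fun z => if z = x then η x - 1 else if z = y then η y + 1 else η z

section Torus

variable {L : ℕ} [NeZero L]

/-- The generator of the totally asymmetric zero range process. -/
def gen (α : ℝ) (F : Config L → ℝ) (η : Config L) : ℝ :=
  ∑ x : ZMod L, g α (η x) * (F (move x (x + 1) η) - F η)

/-- The generator of the time-reversed process (particles jump to the left). -/
def genAdj (α : ℝ) (F : Config L → ℝ) (η : Config L) : ℝ :=
  ∑ x : ZMod L, g α (η x) * (F (move x (x - 1) η) - F η)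

/-- The symmetric part `S = (1/2) (𝓛 + 𝓛*)` of the generator. -/
def genSym (α : ℝ) (F : Config L → ℝ) (η : Config L) : ℝ :=
  (1 / 2) * (gen α F η + genAdj α F η)

/-- `E_N`: the configurations with `N` particles. -/
def confs (L : ℕ) [NeZero L] (N : ℕ) : Finset (Config L) :=
  Finset.piAntidiag Finset.univ N

/-- `1 / a(η) = ∏_x 1 / a(η_x)`. -/
def weight (α : ℝ) (η : Config L) : ℝ := ∏ x : ZMod L, 1 / a α (η x)

/-- The normalizing constant `Z_N = N ^ α ∑_{ζ ∈ E_N} 1 / a(ζ)`. -/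
def Z (L : ℕ) [NeZero L] (α : ℝ) (N : ℕ) : ℝ := (N : ℝ) ^ α * ∑ ζ ∈ confs L N, weight α ζ

/-- The stationary measure `μ_N` on `E_N`, given by its mass function (`N ≥ 1`). -/
def mu (α : ℝ) (N : ℕ) (η : Config L) : ℝ := (N : ℝ) ^ α / Z L α N * weight α η

/-- The scalar product of `L²(μ_N)`. It only sees the values of `F` and `G` on `E_N`, so that
functions on `E_N` may be represented by functions on all configurations. -/
def inner (α : ℝ) (N : ℕ) (F G : Config L → ℝ) : ℝ :=
  ∑ η ∈ confs L N, mu α N η * (F η * G η)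

/-- The well `𝓔^x_N`: configurations of `E_N` with `η_x ≥ N - ℓ_N` (here `l = ℓ_N`). -/
def well (N : ℕ) (l : ℝ) (x : ZMod L) : Finset (Config L) :=
  (confs L N).filter fun η => (N : ℝ) - l ≤ (η x : ℝ)

/-- `𝓔_N(A) = ⋃_{z ∈ A} 𝓔^z_N`. -/
def wells (N : ℕ) (l : ℝ) (A : Finset (ZMod L)) : Finset (Config L) :=
  A.biUnion (well N l)

/-- `F` is constant on `A`. -/
def ConstOn (A : Finset (Config L)) (F : Config L → ℝ) : Prop := ∃ c : ℝ, ∀ η ∈ A, F η = c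

/-- `sup_h {2 ⟨f, 𝓛 h⟩ - ⟨h, (-S) h⟩}` over the functions `h` which are constant on `A₁`, constant
on `A₂` and equal to `0` on `A₃`, as an extended real number. -/
def supFunctional (α : ℝ) (N : ℕ) (A₁ A₂ A₃ : Finset (Config L)) (f : Config L → ℝ) : EReal :=
  ⨆ h ∈ {h : Config L → ℝ | ConstOn A₁ h ∧ ConstOn A₂ h ∧ ∀ η ∈ A₃, h η = 0},
    ((2 * inner α N f (gen α h) - inner α N h (fun η => - genSym α h η) : ℝ) : EReal)

/-- The functional `𝔾^{x,y}`. -/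
def G (α : ℝ) (N : ℕ) (l : ℝ) (x y : ZMod L) (f : Config L → ℝ) : EReal :=
  supFunctional α N (well N l x) (well N l y)
    (wells N l (Finset.univ.filter fun z => z ≠ x ∧ z ≠ y)) f

/-- The infimum of `𝔾^{x,y}(f)` over the functions `f` which are equal to `1` on `𝓔^x_N`, equal
to `0` on `𝓔^z_N` for `z ≠ x, y`, and constant on `𝓔^y_N`. -/
def infG (α : ℝ) (N : ℕ) (l : ℝ) (x y : ZMod L) : EReal :=
  ⨅ f ∈ {f : Config L → ℝ | (∀ η ∈ well N l x, f η = 1) ∧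
      (∀ η ∈ wells N l (Finset.univ.filter fun z => z ≠ x ∧ z ≠ y), f η = 0) ∧
      ConstOn (well N l y) f},
    G α N l x y f

/-- The total jump rate (inverse mean holding time) of the process at `η`. -/
def totalRate (α : ℝ) (η : Config L) : ℝ := ∑ x : ZMod L, g α (η x)

/-- The law of the configuration after the first jump from `η`; the empty configuration, which
never jumps, stays put. -/
def jumpLaw (α : ℝ) (η : Config L) : Measure (Config L) :=
  if totalRate α η = 0 then Measure.dirac η
  else ∑ x : ZMod L,
    ENNReal.ofReal (g α (η x) / totalRate α η) • Measure.dirac (move x (x + 1) η)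

theorem a_pos (α : ℝ) (n : ℕ) : 0 < a α n := by
  unfold a
  split_ifs with h
  · exact one_pos
  · exact Real.rpow_pos_of_pos (by exact_mod_cast Nat.pos_of_ne_zero h) α

theorem g_nonneg (α : ℝ) (n : ℕ) : 0 ≤ g α n := by
  unfold g
  split_ifs with h
  · exact le_rfl
  · exact (div_pos (a_pos α n) (a_pos α (n - 1))).le

instance jumpLaw_isProbability (α : ℝ) (η : Config L) : IsProbabilityMeasure (jumpLaw α η) := by
  unfold jumpLaw
  split_ifs with h
  · infer_instance
  · have h0 : 0 ≤ totalRate α η := Finset.sum_nonneg fun x _ => g_nonneg α (η x)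
    constructor
    simp only [Measure.coe_finsetSum, Finset.sum_apply, Measure.smul_apply, measure_univ,
      smul_eq_mul, mul_one]
    rw [← ENNReal.ofReal_sum_of_nonneg fun x _ => div_nonneg (g_nonneg α (η x)) h0,
      ← Finset.sum_div]
    change ENNReal.ofReal (totalRate α η / totalRate α η) = 1
    rw [div_self h, ENNReal.ofReal_one]

/-- The transition kernel of the embedded jump chain. -/
def jumpKernel (L : ℕ) [NeZero L] (α : ℝ) : Kernel (Config L) (Config L) :=
  Kernel.ofFunOfCountable (jumpLaw α)

instance jumpKernel_isMarkov (α : ℝ) : IsMarkovKernel (jumpKernel L α) :=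
  ⟨fun η => jumpLaw_isProbability α η⟩

/-- The jump chain as a function of its past: only the present configuration matters. -/
def stepKernel (L : ℕ) [NeZero L] (α : ℝ) (n : ℕ) :
    Kernel ((i : Finset.Iic n) → Config L) (Config L) :=
  (jumpKernel L α).comap (fun p => p ⟨n, Finset.mem_Iic.2 le_rfl⟩) (measurable_pi_apply _)

instance stepKernel_isMarkov (α : ℝ) (n : ℕ) : IsMarkovKernel (stepKernel L α n) := by
  unfold stepKernel
  infer_instance

/-- The law, on the space of sequences of configurations, of the successive configurations visited
by the zero range process started from `η`. -/
def chainLaw (α : ℝ) (η : Config L) : Measure (ℕ → Config L) :=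
  Kernel.traj (X := fun _ => Config L) (stepKernel L α) 0 (fun _ => η)

/-- The event that the first return to `A` takes place at `ξ`, i.e. `H⁺_A = H⁺_ξ < ∞` for
`ξ ∈ A`. -/
def returnAt (A : Finset (Config L)) (ξ : Config L) : Set (ℕ → Config L) :=
  {ω | ∃ n, 1 ≤ n ∧ ω n = ξ ∧ ∀ m, 1 ≤ m → m < n → ω m ∉ A}

/-- The jump rates `R^A(η, ξ) = λ(η) P_η[H⁺_A = H⁺_ξ]`, `η ≠ ξ` in `A`, of the trace on `A` of
the zero range process: in the time spent in `A`, the trace leaves `η` at rate `λ(η)`, and it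
continues from the configuration at which the process first returns to `A`. -/
def traceRate (α : ℝ) (A : Finset (Config L)) (η ξ : Config L) : ℝ :=
  totalRate α η * (chainLaw α η).real (returnAt A ξ)

/-- The mean rate `r_N(𝓔^x_N, 𝓔^y_N)` at which the trace of the process on the union of all the
wells jumps from `𝓔^x_N` to `𝓔^y_N`. -/
def meanRate (α : ℝ) (N : ℕ) (l : ℝ) (x y : ZMod L) : ℝ :=
  1 / (∑ η ∈ well N l x, mu α N η) *
    ∑ η ∈ well N l x, ∑ ξ ∈ well N l y,
      mu α N η * traceRate α (wells N l Finset.univ) η ξ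

end Torus

/-- `Γ(α) = ∑_{j ≥ 0} 1 / a(j)`. -/
def Gam (α : ℝ) : ℝ := ∑' j : ℕ, 1 / a α j

/-- `I_α = ∫₀¹ u ^ α (1 - u) ^ α du`. -/
def I (α : ℝ) : ℝ := ∫ u in (0 : ℝ)..1, u ^ α * (1 - u) ^ α

end ZeroRange

end

/-
Adding a particle to a configuration `ξ` with `N - 1` particles gives `L` configurations `ξ ^ z`,
and `⟨u, 𝓛 h⟩` is, up to a factor, the sum over `ξ` of
`weight ξ * ∑ z, u (ξ ^ z) * (h (ξ ^ (z + 1)) - h (ξ ^ z))`, in which only the differences of `u`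
along the cycles `ξ ^ z` matter. Let `h_w` be the probability that the wells are first visited at
the well of `w`. It is harmonic off the wells, so for `u` constant on each well `⟨u, 𝓛 h_w⟩`
depends only on these constants, and both limits reduce to those of the entries
`⟨1_{𝓔^x}, 𝓛 h_w⟩` of the capacity matrix.

In such an entry `1_{𝓔^x}` may be replaced by an explicit test function: in the tube of the
configurations with almost all particles on `x` and `w`, the primitive of `u ^ α (1 - u) ^ α`
evaluated at the proportion of particles on one of the sites. Its gradient is a flow from `x` to
`w`, whose strength cancels the weights of `x` and `w` and against which `h_w` telescopes, and an
error which the Cauchy–Schwarz inequality and a bound on the energy of `h_w` make negligible. The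
square of the error is quadratic in the numbers `j` of particles on the other sites, against which
the weights `1 / j ^ α` are summable. Hence `N ^ (1 + α)` times the entry tends to `1 / (L Γ I)`
for `x ≠ w`, and, as the entries with the same `w` sum to `0`, to `-(L - 1) / (L Γ I)` for
`x = w`.

The mean rate is an entry divided by the measure of a well, which tends to `1 / L`. For the
infimum, let `p` be the combination of `h_x` and `h_y` which is `1` at `x`, `0` at the other wells
than `y`, and for which `⟨1_{𝓔^y}, 𝓛 p⟩ = 0`; let `q` be its analogue for the adjoint process,
which is conjugate to the process by a reflection of the torus. Then `f = (p + q) / 2` attains the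
infimum, `h = -p` shows its minimality, and the value is the Schur complement `⟨p, (-𝓛) p⟩` of the
capacity matrix.
-/

noncomputable section

namespace ZeroRange

open MeasureTheory ProbabilityTheory Filter Topology
open scoped ENNReal

/-! ### First returns of a Markov chain -/

section MarkovChain

variable {S : Type*}

/-- The trajectories which avoid `A` at the times `1, …, n`. -/
def avoids (A : Set S) (n : ℕ) : Set (ℕ → S) := {ω | ∀ m, 1 ≤ m → m ≤ n → ω m ∉ A}

/-- The event that the first return to `A` takes place at `ξ`, for `ξ ∈ A`. -/
def firstReturnAt (A : Set S) (ξ : S) : Set (ℕ → S) :=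
  {ω | ∃ n, 1 ≤ n ∧ ω n = ξ ∧ ∀ m, 1 ≤ m → m < n → ω m ∉ A}

theorem avoids_zero (A : Set S) : avoids A 0 = Set.univ :=
  Set.eq_univ_of_forall fun _ m h h' => by omega

theorem avoids_succ (A : Set S) (n : ℕ) :
    avoids A (n + 1) = avoids A n ∩ (fun ω => ω (n + 1)) ⁻¹' Aᶜ := by
  ext ω
  refine ⟨fun h => ⟨fun m hm hm' => h m hm (by omega), h (n + 1) (by omega) le_rfl⟩, ?_⟩
  rintro ⟨h, h'⟩ m hm hm'
  rcases hm'.lt_or_eq with hlt | rfl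
  · exact h m hm (by omega)
  · exact h'

theorem firstReturnAt_eq_iUnion (A : Set S) (ξ : S) :
    firstReturnAt A ξ = ⋃ n, avoids A n ∩ (fun ω => ω (n + 1)) ⁻¹' {ξ} := by
  ext ω
  simp only [firstReturnAt, avoids, Set.mem_ofPred_eq, Set.mem_iUnion, Set.mem_inter_iff]
  constructor
  · rintro ⟨n, hn, hξ, hA⟩
    obtain ⟨k, rfl⟩ := Nat.exists_eq_add_of_le' hn
    exact ⟨k, fun m hm hm' => hA m hm (by omega), hξ⟩
  · rintro ⟨n, hA, hξ⟩
    exact ⟨n + 1, by omega, hξ, fun m hm hm' => hA m hm (by omega)⟩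

theorem pairwise_disjoint_avoids_inter {A : Set S} {ξ : S} (hξ : ξ ∈ A) :
    Pairwise (Function.onFun Disjoint
      fun n => avoids A n ∩ (fun ω : ℕ → S => ω (n + 1)) ⁻¹' {ξ}) := by
  intro i j hij
  wlog hlt : i < j generalizing i j
  · exact (this hij.symm (by omega)).symm
  refine Set.disjoint_left.2 fun ω hi hj => hj.1 (i + 1) (by omega) (by omega) ?_
  rwa [show ω (i + 1) = ξ from hi.2]

variable [MeasurableSpace S]

theorem exists_avoids_eq_preimage_frestrictLe {A : Set S} (hA : MeasurableSet A) (n : ℕ) :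
    ∃ T, MeasurableSet T ∧ avoids A n = Preorder.frestrictLe (π := fun _ => S) n ⁻¹' T := by
  refine ⟨⋂ m : Finset.Iic n, ⋂ _ : 1 ≤ (m : ℕ), (fun p => p m) ⁻¹' Aᶜ,
    .iInter fun m => .iInter fun _ => measurable_pi_apply m hA.compl, ?_⟩
  ext ω
  simp only [avoids, Set.mem_ofPred_eq, Set.mem_preimage, Set.mem_iInter, Set.mem_compl_iff,
    Preorder.frestrictLe_apply, Subtype.forall, Finset.mem_Iic]
  exact forall_congr' fun m => ⟨fun h hn hm => h hm hn, fun h hm hn => h hn hm⟩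

theorem measurableSet_avoids {A : Set S} (hA : MeasurableSet A) (n : ℕ) :
    MeasurableSet (avoids A n) := by
  obtain ⟨T, hT, h⟩ := exists_avoids_eq_preimage_frestrictLe hA n
  exact h ▸ Preorder.measurable_frestrictLe n hT

/-- The transition operator of the chain with kernel `κ` killed on `A`. -/
def killedOp (κ : Kernel S S) (A : Set S) (f : S → ℝ≥0∞) : S → ℝ≥0∞ :=
  Aᶜ.indicator fun t => ∫⁻ u, f u ∂κ t

theorem measurable_iterate_killedOp (κ : Kernel S S) {A : Set S} (hA : MeasurableSet A)
    {f : S → ℝ≥0∞} (hf : Measurable f) (n : ℕ) : Measurable ((killedOp κ A)^[n] f) := by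
  induction n generalizing f with
  | zero => exact hf
  | succ _ ih => exact ih (hf.lintegral_kernel.indicator hA.compl)

variable (κ : Kernel S S) [IsMarkovKernel κ] (s : S)

/-- The law of the Markov chain with transition kernel `κ` started from `s`. -/
def pathLaw : Measure (ℕ → S) :=
  Kernel.traj (X := fun _ => S)
    (fun n => κ.comap (fun p => p ⟨n, Finset.mem_Iic.2 le_rfl⟩) (measurable_pi_apply _)) 0
    (fun _ => s)

instance isProbabilityMeasure_pathLaw : IsProbabilityMeasure (pathLaw κ s) := by
  unfold pathLaw; infer_instance

theorem setLIntegral_pathLaw_succ {n : ℕ} {T : Set (Finset.Iic n → S)} (hT : MeasurableSet T)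
    {f : S → ℝ≥0∞} (hf : Measurable f) :
    ∫⁻ ω in Preorder.frestrictLe (π := fun _ => S) n ⁻¹' T, f (ω (n + 1)) ∂pathLaw κ s =
      ∫⁻ ω in Preorder.frestrictLe (π := fun _ => S) n ⁻¹' T, ∫⁻ t, f t ∂κ (ω n) ∂pathLaw κ s := by
  let κ' (n : ℕ) : Kernel (Finset.Iic n → S) S :=
    κ.comap (fun p => p ⟨n, Finset.mem_Iic.2 le_rfl⟩) (measurable_pi_apply _)
  have hpair : Kernel.partialTraj (X := fun _ => S) κ' 0 n (fun _ => s) ⊗ₘ κ' n =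
      (pathLaw κ s).map fun ω => (Preorder.frestrictLe (π := fun _ => S) n ω, ω (n + 1)) :=
    Kernel.partialTraj_compProd_eq_map_traj (Nat.zero_le n)
  have hpast : (pathLaw κ s).map (Preorder.frestrictLe (π := fun _ => S) n) =
      Kernel.partialTraj (X := fun _ => S) κ' 0 n (fun _ => s) :=
    Kernel.traj_map_frestrictLe_apply 0 n _
  have hsnd : Measurable fun q : (Finset.Iic n → S) × S => f q.2 := hf.comp measurable_snd
  calc ∫⁻ ω in Preorder.frestrictLe (π := fun _ => S) n ⁻¹' T, f (ω (n + 1)) ∂pathLaw κ s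
      = ∫⁻ q in T ×ˢ Set.univ, f q.2 ∂(pathLaw κ s).map fun ω =>
          (Preorder.frestrictLe (π := fun _ => S) n ω, ω (n + 1)) := by
        rw [setLIntegral_map (hT.prod .univ) hsnd (by fun_prop)]
        simp [Set.prod_univ, Set.preimage_preimage]
    _ = ∫⁻ p in T, ∫⁻ t, f t ∂κ' n p ∂(pathLaw κ s).map (Preorder.frestrictLe n) := by
        rw [← hpair, Measure.setLIntegral_compProd hsnd hT .univ, hpast]
        simp
    _ = _ := setLIntegral_map hT hf.lintegral_kernel (by fun_prop)

theorem lintegral_pathLaw_one {f : S → ℝ≥0∞} (hf : Measurable f) :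
    ∫⁻ ω, f (ω 1) ∂pathLaw κ s = ∫⁻ t, f t ∂κ s := by
  have h := congrArg (fun k => ∫⁻ t, f t ∂k fun _ => s)
    (Kernel.map_traj_succ_self (X := fun _ => S) (a := 0)
      (κ := fun n => κ.comap (fun p => p ⟨n, Finset.mem_Iic.2 le_rfl⟩) (measurable_pi_apply _)))
  rw [Kernel.map_apply _ (measurable_pi_apply _)] at h
  exact (lintegral_map hf (measurable_pi_apply (X := fun _ => S) 1)).symm.trans h

theorem setLIntegral_avoids_pathLaw {A : Set S} (hA : MeasurableSet A) (n : ℕ)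
    {f : S → ℝ≥0∞} (hf : Measurable f) :
    ∫⁻ ω in avoids A n, f (ω (n + 1)) ∂pathLaw κ s = ∫⁻ t, (killedOp κ A)^[n] f t ∂κ s := by
  induction n generalizing f with
  | zero => simpa [avoids_zero] using lintegral_pathLaw_one κ s hf
  | succ n ih =>
    obtain ⟨T, hT, havoids⟩ := exists_avoids_eq_preimage_frestrictLe hA (n + 1)
    rw [havoids, setLIntegral_pathLaw_succ κ s hT hf, ← havoids, avoids_succ, Set.inter_comm,
      ← Measure.restrict_restrict (measurable_pi_apply _ hA.compl),
      ← lintegral_indicator (measurable_pi_apply _ hA.compl)]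
    exact ih (hf.lintegral_kernel.indicator hA.compl)

variable [MeasurableSingletonClass S]

theorem pathLaw_firstReturnAt_eq_tsum {A : Set S} (hA : MeasurableSet A) {ξ : S} (hξ : ξ ∈ A) :
    pathLaw κ s (firstReturnAt A ξ) =
      ∑' n, ∫⁻ t, (killedOp κ A)^[n] (Set.indicator {ξ} 1) t ∂κ s := by
  have hat : ∀ n, MeasurableSet ((fun ω : ℕ → S => ω (n + 1)) ⁻¹' {ξ}) := fun n =>
    measurable_pi_apply _ (measurableSet_singleton ξ)
  rw [firstReturnAt_eq_iUnion, measure_iUnion (pairwise_disjoint_avoids_inter hξ)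
    fun n => (measurableSet_avoids hA n).inter (hat n)]
  refine tsum_congr fun n => ?_
  rw [← setLIntegral_avoids_pathLaw κ s hA n
      (measurable_one.indicator (measurableSet_singleton ξ)), Set.inter_comm,
    ← Measure.restrict_apply (hat n), ← lintegral_indicator_one (hat n)]
  rfl

theorem pathLaw_firstReturnAt_eq_lintegral {A : Set S} (hA : MeasurableSet A) {ξ : S} (hξ : ξ ∈ A) :
    pathLaw κ s (firstReturnAt A ξ) =
      ∫⁻ t, (Set.indicator {ξ} 1 t +
        Aᶜ.indicator (fun t => pathLaw κ t (firstReturnAt A ξ)) t) ∂κ s := by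
  have hind : Measurable (Set.indicator {ξ} 1 : S → ℝ≥0∞) :=
    measurable_one.indicator (measurableSet_singleton ξ)
  rw [pathLaw_firstReturnAt_eq_tsum κ s hA hξ, tsum_eq_zero_add' ENNReal.summable,
    lintegral_add_left hind, ← lintegral_tsum fun n =>
      (measurable_iterate_killedOp κ hA hind (n + 1)).aemeasurable]
  simp only [Function.iterate_zero, id_eq, Function.iterate_succ_apply']
  congr 1
  refine lintegral_congr fun t => ?_
  by_cases ht : t ∈ A
  · simp [killedOp, ht]
  · simp [killedOp, ht, pathLaw_firstReturnAt_eq_tsum κ t hA hξ]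

end MarkovChain

/-! ### Removing a particle -/

section AddParticle

variable {L : ℕ}

/-- `ξ` with one particle added at `z`. -/
def addAt (ξ : Config L) (z : ZMod L) : Config L := ξ + Pi.single z 1

theorem addAt_apply (ξ : Config L) (z v : ZMod L) :
    addAt ξ z v = ξ v + if v = z then 1 else 0 := by
  simp [addAt, Pi.single_apply]

@[simp] theorem addAt_same (ξ : Config L) (z : ZMod L) : addAt ξ z z = ξ z + 1 := by
  simp [addAt]

theorem addAt_of_ne (ξ : Config L) {z v : ZMod L} (h : v ≠ z) : addAt ξ z v = ξ v := by
  simp [addAt, h]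

theorem le_addAt (ξ : Config L) (z v : ZMod L) : ξ v ≤ addAt ξ z v := by
  rw [addAt_apply]; exact Nat.le_add_right _ _

theorem addAt_le (ξ : Config L) (z v : ZMod L) : addAt ξ z v ≤ ξ v + 1 := by
  rw [addAt_apply]; split_ifs <;> omega

theorem sum_addAt (ξ : Config L) (z : ZMod L) (s : Finset (ZMod L)) :
    ∑ v ∈ s, addAt ξ z v = ∑ v ∈ s, ξ v + if z ∈ s then 1 else 0 := by
  simp only [addAt_apply, Finset.sum_add_distrib, Finset.sum_ite_eq']

theorem move_addAt (ξ : Config L) {z w : ZMod L} (h : z ≠ w) :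
    move z w (addAt ξ z) = addAt ξ w := by
  funext v
  by_cases hz : v = z
  · subst hz; simp [move, addAt_of_ne _ h]
  · by_cases hw : v = w
    · subst hw; simp [move, hz, addAt_of_ne _ hz]
    · simp [move, hz, hw, addAt_of_ne]

theorem addAt_sub_single {η : Config L} {z : ZMod L} (h : η z ≠ 0) :
    addAt (η - Pi.single z 1) z = η := by
  funext v
  by_cases hv : v = z
  · subst hv
    simp only [addAt_same, Pi.sub_apply, Pi.single_eq_same]
    omega
  · simp [addAt_of_ne _ hv, hv]

end AddParticle

section Form

variable {L : ℕ} [NeZero L]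

theorem mem_confs {N : ℕ} {η : Config L} : η ∈ confs L N ↔ ∑ z, η z = N := by
  simp [confs]

theorem addAt_mem_confs_iff {n : ℕ} {ξ : Config L} {z : ZMod L} :
    addAt ξ z ∈ confs L (n + 1) ↔ ξ ∈ confs L n := by
  simp [mem_confs, sum_addAt]

theorem weight_pos (α : ℝ) (η : Config L) : 0 < weight α η :=
  Finset.prod_pos fun x _ => one_div_pos.2 (a_pos α (η x))

theorem weight_mul_g_addAt (α : ℝ) (ξ : Config L) (z : ZMod L) :
    weight α (addAt ξ z) * g α (addAt ξ z z) = weight α ξ := by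
  have hoff : ∀ v ∈ Finset.univ.erase z, 1 / a α (addAt ξ z v) = 1 / a α (ξ v) := fun v hv => by
    rw [addAt_of_ne _ (Finset.ne_of_mem_erase hv)]
  have hsucc_ne := (a_pos α (ξ z + 1)).ne'
  have ha_ne := (a_pos α (ξ z)).ne'
  unfold weight
  rw [← Finset.mul_prod_erase _ _ (Finset.mem_univ z),
    ← Finset.mul_prod_erase _ (fun x => 1 / a α (ξ x)) (Finset.mem_univ z),
    Finset.prod_congr rfl hoff, addAt_same]
  simp only [g, Nat.add_eq_zero_iff, one_ne_zero, and_false, if_false, Nat.add_sub_cancel]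
  field_simp

theorem sum_confs_filter_ne_zero (n : ℕ) (z : ZMod L) (Φ : Config L → ℝ) :
    ∑ η ∈ confs L (n + 1) with η z ≠ 0, Φ η = ∑ ξ ∈ confs L n, Φ (addAt ξ z) := by
  symm
  refine Finset.sum_bij (fun ξ _ => addAt ξ z) (fun ξ hξ => ?_)
    (fun ξ _ ξ' _ h => add_right_cancel h) (fun η hη => ?_) fun _ _ => rfl
  · simp [addAt_mem_confs_iff, hξ]
  · rw [Finset.mem_filter] at hη
    have hadd := addAt_sub_single hη.2
    exact ⟨η - Pi.single z 1, addAt_mem_confs_iff.1 (hadd.symm ▸ hη.1), hadd⟩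

theorem sum_confs_weight_mul_g (α : ℝ) (n : ℕ) (z : ZMod L) (Φ : Config L → ℝ) :
    ∑ η ∈ confs L (n + 1), weight α η * (g α (η z) * Φ η) =
      ∑ ξ ∈ confs L n, weight α ξ * Φ (addAt ξ z) := by
  have hsupp : ∀ η ∈ confs L (n + 1), weight α η * (g α (η z) * Φ η) ≠ 0 → η z ≠ 0 := by
    intro η _ h hz
    simp [hz, g] at h
  rw [← Finset.sum_filter_of_ne hsupp, sum_confs_filter_ne_zero]
  refine Finset.sum_congr rfl fun ξ _ => ?_
  rw [← mul_assoc, weight_mul_g_addAt]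

theorem sum_add_one (F : ZMod L → ℝ) : ∑ z, F (z + 1) = ∑ z, F z :=
  Fintype.sum_equiv (Equiv.addRight 1) _ _ fun _ => rfl

/-- The bilinear form `(u, h) ↦ ⟨u, 𝓛 h⟩` on functions on `E_{n+1}`, up to normalization, as a sum
over the configurations from which a particle has been removed: see `inner_gen`. -/
def genForm (α : ℝ) (n : ℕ) : (Config L → ℝ) →ₗ[ℝ] (Config L → ℝ) →ₗ[ℝ] ℝ :=
  LinearMap.mk₂ ℝ
    (fun u h => ∑ ξ ∈ confs L n, weight α ξ *
      ∑ z, u (addAt ξ z) * (h (addAt ξ (z + 1)) - h (addAt ξ z)))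
    (fun u v h => by simp only [Pi.add_apply, add_mul, mul_add, Finset.sum_add_distrib])
    (fun c u h => by
      simp only [Pi.smul_apply, smul_eq_mul, Finset.mul_sum]
      exact Finset.sum_congr rfl fun ξ _ => Finset.sum_congr rfl fun z _ => by ring)
    (fun u h k => by
      simp only [Pi.add_apply, Finset.mul_sum, ← Finset.sum_add_distrib]
      exact Finset.sum_congr rfl fun ξ _ => Finset.sum_congr rfl fun z _ => by ring)
    (fun c u h => by
      simp only [Pi.smul_apply, smul_eq_mul, Finset.mul_sum]
      exact Finset.sum_congr rfl fun ξ _ => Finset.sum_congr rfl fun z _ => by ring)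

theorem genForm_apply (α : ℝ) (n : ℕ) (u h : Config L → ℝ) :
    genForm α n u h = ∑ ξ ∈ confs L n, weight α ξ *
      ∑ z, u (addAt ξ z) * (h (addAt ξ (z + 1)) - h (addAt ξ z)) := rfl

theorem genForm_const_left (α : ℝ) (n : ℕ) (c : ℝ) (h : Config L → ℝ) :
    genForm α n (fun _ => c) h = 0 := by
  rw [genForm_apply]
  refine Finset.sum_eq_zero fun ξ _ => ?_
  rw [← Finset.mul_sum, Finset.sum_sub_distrib, sum_add_one fun z => h (addAt ξ z), sub_self,
    mul_zero, mul_zero]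

/-- Twice the Dirichlet form `⟨h, (-𝓢) h⟩` on functions on `E_{n+1}`, up to normalization. -/
def energy (α : ℝ) (n : ℕ) (h : Config L → ℝ) : ℝ :=
  ∑ ξ ∈ confs L n, weight α ξ * ∑ z, (h (addAt ξ (z + 1)) - h (addAt ξ z)) ^ 2

theorem energy_nonneg (α : ℝ) (n : ℕ) (h : Config L → ℝ) : 0 ≤ energy α n h :=
  Finset.sum_nonneg fun ξ _ => mul_nonneg (weight_pos α ξ).le
    (Finset.sum_nonneg fun _ _ => sq_nonneg _)

theorem genForm_self (α : ℝ) (n : ℕ) (h : Config L → ℝ) :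
    genForm α n h h = -(1 / 2) * energy α n h := by
  rw [genForm_apply, energy, Finset.mul_sum]
  refine Finset.sum_congr rfl fun ξ _ => ?_
  have hsq : ∑ z, (h (addAt ξ (z + 1)) - h (addAt ξ z)) ^ 2 =
      ∑ z, h (addAt ξ (z + 1)) ^ 2 - ∑ z, h (addAt ξ z) ^ 2
        - 2 * ∑ z, h (addAt ξ z) * (h (addAt ξ (z + 1)) - h (addAt ξ z)) := by
    rw [Finset.mul_sum, ← Finset.sum_sub_distrib, ← Finset.sum_sub_distrib]
    exact Finset.sum_congr rfl fun z _ => by ring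
  rw [hsq, sum_add_one fun z => h (addAt ξ z) ^ 2]
  ring

theorem genForm_self_nonpos (α : ℝ) (n : ℕ) (h : Config L → ℝ) : genForm α n h h ≤ 0 := by
  rw [genForm_self]
  linarith [energy_nonneg α n h]

/-- The density `N ^ α / Z_N` of `μ_N` with respect to the product weights. -/
def coefMu (L : ℕ) [NeZero L] (α : ℝ) (N : ℕ) : ℝ := (N : ℝ) ^ α / Z L α N

theorem inner_eq_coefMu_mul (α : ℝ) (N : ℕ) (F G : Config L → ℝ) :
    inner α N F G = coefMu L α N * ∑ η ∈ confs L N, weight α η * (F η * G η) := by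
  rw [inner, Finset.mul_sum]
  exact Finset.sum_congr rfl fun η _ => mul_assoc _ _ _

theorem sum_confs_weight_mul_jump (α : ℝ) (n : ℕ) (u h : Config L → ℝ) {τ : ZMod L → ZMod L}
    (hτ : ∀ z, z ≠ τ z) :
    ∑ η ∈ confs L (n + 1), weight α η * (u η * ∑ z, g α (η z) * (h (move z (τ z) η) - h η)) =
      ∑ ξ ∈ confs L n, weight α ξ *
        ∑ z, u (addAt ξ z) * (h (addAt ξ (τ z)) - h (addAt ξ z)) := by
  simp only [Finset.mul_sum]
  rw [Finset.sum_comm, Finset.sum_comm (s := confs L n)]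
  refine Finset.sum_congr rfl fun z _ => ?_
  have hz := sum_confs_weight_mul_g α n z fun η => u η * (h (move z (τ z) η) - h η)
  simp only [move_addAt _ (hτ z)] at hz
  rw [← hz]
  exact Finset.sum_congr rfl fun η _ => by ring

section TwoSites

variable (hL : 2 ≤ L)
include hL

omit [NeZero L] in
theorem one_ne_zero_of_two_le : (1 : ZMod L) ≠ 0 := by
  have : Fact (1 < L) := ⟨hL⟩
  exact one_ne_zero

theorem inner_gen (α : ℝ) (n : ℕ) (u h : Config L → ℝ) :
    inner α (n + 1) u (gen α h) = coefMu L α (n + 1) * genForm α n u h := by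
  rw [inner_eq_coefMu_mul]
  congr 1
  refine sum_confs_weight_mul_jump α n u h (τ := fun z => z + 1) fun z hz => ?_
  exact one_ne_zero_of_two_le hL (by simpa using hz)

theorem inner_genAdj (α : ℝ) (n : ℕ) (u h : Config L → ℝ) :
    inner α (n + 1) u (genAdj α h) = coefMu L α (n + 1) * genForm α n h u := by
  rw [inner_eq_coefMu_mul]
  congr 1
  refine (sum_confs_weight_mul_jump α n u h (τ := fun z => z - 1) fun z hz => ?_).trans ?_
  · exact one_ne_zero_of_two_le hL (sub_eq_self.1 hz.symm)
  · rw [genForm_apply]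
    refine Finset.sum_congr rfl fun ξ _ => congrArg _ ?_
    have hshift := sum_add_one fun z => u (addAt ξ z) * h (addAt ξ (z - 1))
    simp only [add_sub_cancel_right] at hshift
    simp only [mul_sub, Finset.sum_sub_distrib, ← hshift]
    congr 1 <;> exact Finset.sum_congr rfl fun z _ => mul_comm _ _

theorem inner_neg_genSym_self (α : ℝ) (n : ℕ) (h : Config L → ℝ) :
    inner α (n + 1) h (fun η => -genSym α h η) = -(coefMu L α (n + 1) * genForm α n h h) := by
  have hsum : inner α (n + 1) h (fun η => -genSym α h η) =
      -(1 / 2) * (inner α (n + 1) h (gen α h) + inner α (n + 1) h (genAdj α h)) := by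
    unfold inner genSym
    rw [← Finset.sum_add_distrib, Finset.mul_sum]
    exact Finset.sum_congr rfl fun η _ => by ring
  rw [hsum, inner_gen hL, inner_genAdj hL]
  ring

end TwoSites

end Form

/-! ### Equilibrium potentials -/

section Potential

variable {L : ℕ} [NeZero L]

theorem mem_well {N : ℕ} {l : ℝ} {z : ZMod L} {η : Config L} :
    η ∈ well N l z ↔ η ∈ confs L N ∧ (N : ℝ) - l ≤ η z := by
  simp [well]

theorem mem_wells {N : ℕ} {l : ℝ} {A : Finset (ZMod L)} {η : Config L} :
    η ∈ wells N l A ↔ ∃ z ∈ A, η ∈ well N l z := by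
  simp [wells]

theorem well_subset_wells {N : ℕ} {l : ℝ} {z : ZMod L} {η : Config L} (h : η ∈ well N l z) :
    η ∈ wells N l Finset.univ := mem_wells.2 ⟨z, Finset.mem_univ z, h⟩

theorem notMem_well_of_mem_well {N : ℕ} {l : ℝ} (hl : 2 * l < N) {z w : ZMod L} (hzw : z ≠ w)
    {η : Config L} (hz : η ∈ well N l z) : η ∉ well N l w := by
  intro hw
  rw [mem_well] at hz hw
  have hsum : η z + η w ≤ N := by
    rw [← mem_confs.1 hz.1, ← Finset.sum_pair hzw]
    exact Finset.sum_le_sum_of_subset (Finset.subset_univ _)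
  have hsum' : (η z : ℝ) + η w ≤ N := by exact_mod_cast hsum
  linarith [hz.2, hw.2]

theorem totalRate_mul_lintegral_jumpLaw (α : ℝ) {f : Config L → ℝ≥0∞} (hf : ∀ ζ, f ζ ≠ ∞)
    (η : Config L) :
    totalRate α η * (∫⁻ ζ, f ζ ∂jumpLaw α η).toReal =
      ∑ z, g α (η z) * (f (move z (z + 1) η)).toReal := by
  have hnonneg : ∀ z ∈ Finset.univ, 0 ≤ g α (η z) := fun z _ => g_nonneg α (η z)
  have hrate : 0 ≤ totalRate α η := Finset.sum_nonneg hnonneg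
  by_cases h : totalRate α η = 0
  · have hzero : ∀ z, g α (η z) = 0 := fun z =>
      (Finset.sum_eq_zero_iff_of_nonneg hnonneg).1 h z (Finset.mem_univ z)
    simp [h, hzero]
  · rw [jumpLaw, if_neg h, lintegral_finsetSum_measure, ENNReal.toReal_sum, Finset.mul_sum]
    · refine Finset.sum_congr rfl fun z hz => ?_
      rw [lintegral_smul_measure, lintegral_dirac, smul_eq_mul, ENNReal.toReal_mul,
        ENNReal.toReal_ofReal (div_nonneg (hnonneg z hz) hrate)]
      field_simp
    · intro z _
      rw [lintegral_smul_measure, lintegral_dirac, smul_eq_mul]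
      exact ENNReal.mul_ne_top ENNReal.ofReal_ne_top (hf _)

/-- The probability that the process started from `η` first visits `A` at `ξ ∈ A`, where, unlike in
`returnAt`, the time `0` counts. -/
def hitProb (α : ℝ) (A : Finset (Config L)) (ξ η : Config L) : ℝ≥0∞ :=
  Set.indicator {ξ} 1 η +
    (A : Set (Config L))ᶜ.indicator (fun ζ => chainLaw α ζ (returnAt A ξ)) η

instance isProbabilityMeasure_chainLaw (α : ℝ) (η : Config L) :
    IsProbabilityMeasure (chainLaw α η) :=
  isProbabilityMeasure_pathLaw (jumpKernel L α) η

theorem hitProb_ne_top (α : ℝ) (A : Finset (Config L)) (ξ η : Config L) :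
    hitProb α A ξ η ≠ ∞ := by
  refine ENNReal.add_ne_top.2 ⟨?_, ?_⟩ <;> rw [Set.indicator_apply] <;> split_ifs <;> simp

theorem hitProb_of_mem (α : ℝ) {A : Finset (Config L)} (ξ : Config L) {η : Config L}
    (hη : η ∈ A) : hitProb α A ξ η = if η = ξ then 1 else 0 := by
  simp [hitProb, hη, Set.indicator_apply]

theorem hitProb_of_notMem (α : ℝ) {A : Finset (Config L)} {ξ η : Config L} (hξ : ξ ∈ A)
    (hη : η ∉ A) : hitProb α A ξ η = chainLaw α η (returnAt A ξ) := by
  have hne : η ≠ ξ := fun h => hη (h ▸ hξ)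
  simp [hitProb, hη, hne]

theorem chainLaw_returnAt (α : ℝ) {A : Finset (Config L)} {ξ : Config L} (hξ : ξ ∈ A)
    (η : Config L) :
    chainLaw α η (returnAt A ξ) = ∫⁻ ζ, hitProb α A ξ ζ ∂jumpLaw α η :=
  pathLaw_firstReturnAt_eq_lintegral (jumpKernel L α) η A.finite_toSet.measurableSet hξ

theorem gen_hitProb (α : ℝ) {A : Finset (Config L)} {ξ : Config L} (hξ : ξ ∈ A) (η : Config L) :
    gen α (fun ζ => (hitProb α A ξ ζ).toReal) η =
      traceRate α A η ξ - totalRate α η * (hitProb α A ξ η).toReal := by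
  rw [traceRate, Measure.real, chainLaw_returnAt α hξ,
    totalRate_mul_lintegral_jumpLaw α (hitProb_ne_top α A ξ), totalRate, Finset.sum_mul,
    ← Finset.sum_sub_distrib]
  exact Finset.sum_congr rfl fun z _ => mul_sub _ _ _

theorem gen_hitProb_of_notMem (α : ℝ) {A : Finset (Config L)} {ξ η : Config L} (hξ : ξ ∈ A)
    (hη : η ∉ A) : gen α (fun ζ => (hitProb α A ξ ζ).toReal) η = 0 := by
  rw [gen_hitProb α hξ, hitProb_of_notMem α hξ hη, traceRate, Measure.real, sub_self]

/-- The equilibrium potentials: `h` is `1` on the well at `w`, `0` on the other wells, and harmonic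
elsewhere. -/
structure IsPotential (α : ℝ) (N : ℕ) (l : ℝ) (w : ZMod L) (h : Config L → ℝ) : Prop where
  one : ∀ η ∈ well N l w, h η = 1
  zero : ∀ z, z ≠ w → ∀ η ∈ well N l z, h η = 0
  harmonic : ∀ η ∈ confs L N, η ∉ wells N l Finset.univ → gen α h η = 0

/-- The probability that the wells are first visited at the well of `w`. -/
def potential (α : ℝ) (N : ℕ) (l : ℝ) (w : ZMod L) (η : Config L) : ℝ :=
  ∑ ξ ∈ well N l w, (hitProb α (wells N l Finset.univ) ξ η).toReal

theorem gen_potential (α : ℝ) (N : ℕ) (l : ℝ) (w : ZMod L) (η : Config L) :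
    gen α (potential α N l w) η =
      ∑ ξ ∈ well N l w, gen α (fun ζ => (hitProb α (wells N l Finset.univ) ξ ζ).toReal) η := by
  simp only [gen, potential]
  rw [Finset.sum_comm]
  simp only [← Finset.mul_sum, Finset.sum_sub_distrib]

theorem isPotential_potential (α : ℝ) {N : ℕ} {l : ℝ} (hl : 2 * l < N) (w : ZMod L) :
    IsPotential α N l w (potential α N l w) where
  one η hη := by simp [potential, hitProb_of_mem α _ (well_subset_wells hη), apply_ite, hη]
  zero z hz η hη := by
    simp [potential, hitProb_of_mem α _ (well_subset_wells hη), apply_ite,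
      notMem_well_of_mem_well hl hz hη]
  harmonic η _ hη := by
    rw [gen_potential]
    exact Finset.sum_eq_zero fun ξ hξ => gen_hitProb_of_notMem α (well_subset_wells hξ) hη

theorem gen_potential_of_mem_well (α : ℝ) {N : ℕ} {l : ℝ} (hl : 2 * l < N) {z w : ZMod L}
    (hzw : z ≠ w) {η : Config L} (hη : η ∈ well N l z) :
    gen α (potential α N l w) η =
      ∑ ξ ∈ well N l w, traceRate α (wells N l Finset.univ) η ξ := by
  rw [gen_potential]
  refine Finset.sum_congr rfl fun ξ hξ => ?_
  have hne : η ≠ ξ := fun h => notMem_well_of_mem_well hl hzw hη (h ▸ hξ)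
  rw [gen_hitProb α (well_subset_wells hξ), hitProb_of_mem α ξ (well_subset_wells hη), if_neg hne,
    ENNReal.toReal_zero, mul_zero, sub_zero]

theorem meanRate_eq (α : ℝ) {N : ℕ} {l : ℝ} (hl : 2 * l < N) {z w : ZMod L} (hzw : z ≠ w) :
    meanRate α N l z w = 1 / (∑ η ∈ well N l z, mu α N η) *
      ∑ η ∈ well N l z, mu α N η * gen α (potential α N l w) η := by
  rw [meanRate]
  refine congrArg _ (Finset.sum_congr rfl fun η hη => ?_)
  rw [gen_potential_of_mem_well α hl hzw hη, Finset.mul_sum]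

end Potential

/-! ### Sums of product weights -/

theorem tendsto_piFinset_const_atTop (ι β : Type*) [Fintype ι] [DecidableEq ι] :
    Tendsto (fun s : Finset β => Fintype.piFinset fun _ : ι => s) atTop atTop := by
  classical
  refine tendsto_atTop_finset_of_monotone (fun s t h => Fintype.piFinset_subset _ _ fun _ => h)
    fun ζ => ⟨Finset.univ.image ζ, ?_⟩
  simp [Fintype.mem_piFinset]

theorem hasSum_prod_of_nonneg {ι β : Type*} [Fintype ι] {f : ι → β → ℝ} (hf : ∀ i b, 0 ≤ f i b)
    (hs : ∀ i, Summable (f i)) :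
    HasSum (fun ζ : ι → β => ∏ i, f i (ζ i)) (∏ i, ∑' b, f i b) := by
  classical
  have hbox := tendsto_piFinset_const_atTop ι β
  have hbox_sum (s : Finset β) :
      ∑ ζ ∈ Fintype.piFinset (fun _ : ι => s), ∏ i, f i (ζ i) = ∏ i, ∑ b ∈ s, f i b :=
    (Finset.prod_univ_sum (fun _ => s) f).symm
  have hnonneg (ζ : ι → β) : 0 ≤ ∏ i, f i (ζ i) := Finset.prod_nonneg fun i _ => hf i _
  have hsum : Summable fun ζ : ι → β => ∏ i, f i (ζ i) := by
    refine summable_of_sum_le (c := ∏ i, ∑' b, f i b) hnonneg fun t => ?_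
    obtain ⟨s, hts⟩ := (hbox.eventually (eventually_ge_atTop t)).exists
    refine (Finset.sum_le_sum_of_subset_of_nonneg hts fun ζ _ _ => hnonneg ζ).trans ?_
    rw [hbox_sum]
    exact Finset.prod_le_prod (fun i _ => Finset.sum_nonneg fun b _ => hf i b)
      fun i _ => (hs i).sum_le_tsum _ fun b _ => hf i b
  have hlim : Tendsto (fun s : Finset β => ∏ i, ∑ b ∈ s, f i b) atTop (𝓝 (∏ i, ∑' b, f i b)) :=
    tendsto_finsetProd _ fun i _ => (hs i).hasSum
  have hprod := hsum.hasSum.comp hbox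
  simp only [Function.comp_def, hbox_sum] at hprod
  exact tendsto_nhds_unique hprod hlim ▸ hsum.hasSum

theorem one_add_sum_le_prod_one_add {ι : Type*} (s : Finset ι) {f : ι → ℝ} (hf : ∀ i, 0 ≤ f i) :
    1 + ∑ i ∈ s, f i ≤ ∏ i ∈ s, (1 + f i) := by
  classical
  induction s using Finset.induction_on with
  | empty => simp
  | insert i s hi ih =>
    rw [Finset.sum_insert hi, Finset.prod_insert hi]
    have hsum : 0 ≤ ∑ j ∈ s, f j := Finset.sum_nonneg fun j _ => hf j
    nlinarith [hf i]

theorem a_of_pos (α : ℝ) {n : ℕ} (h : 0 < n) : a α n = (n : ℝ) ^ α := by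
  simp [a, h.ne']

theorem one_div_a_nonneg (α : ℝ) (n : ℕ) : 0 ≤ 1 / a α n := (one_div_pos.2 (a_pos α n)).le

theorem summable_one_div_a {α : ℝ} (hα : 1 < α) : Summable fun n : ℕ => 1 / a α n := by
  rw [← summable_nat_add_iff 1]
  simp only [a_of_pos α (Nat.succ_pos _)]
  exact (summable_nat_add_iff 1).2 (Real.summable_one_div_nat_rpow.2 hα)

theorem summable_one_div_a_mul_sq {α : ℝ} (hα : 3 < α) :
    Summable fun n : ℕ => 1 / a α n * ((1 : ℝ) + n) ^ 2 := by
  rw [← summable_nat_add_iff 1]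
  have hsum : Summable fun n : ℕ => 4 * (1 / ((n + 1 : ℕ) : ℝ) ^ (α - 2)) :=
    ((summable_nat_add_iff (f := fun n : ℕ => 1 / (n : ℝ) ^ (α - 2)) 1).2
      (Real.summable_one_div_nat_rpow.2 (by linarith))).mul_left 4
  refine hsum.of_nonneg_of_le (fun n => mul_nonneg (one_div_a_nonneg α _) (sq_nonneg _))
    fun n => ?_
  have hpos : (0 : ℝ) < ((n + 1 : ℕ) : ℝ) := by positivity
  have hsq : (1 + ((n + 1 : ℕ) : ℝ)) ^ 2 ≤ 4 * ((n + 1 : ℕ) : ℝ) ^ 2 := by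
    push_cast
    nlinarith [Nat.cast_nonneg (α := ℝ) n]
  rw [a_of_pos α n.succ_pos, Real.rpow_sub hpos, Real.rpow_two, one_div_div, div_mul_eq_mul_div,
    one_mul, ← mul_div_assoc]
  gcongr

theorem Gam_pos {α : ℝ} (hα : 1 < α) : 0 < Gam α :=
  (summable_one_div_a hα).tsum_pos (one_div_a_nonneg α) 0 (one_div_pos.2 (a_pos α 0))

section Background

variable {L : ℕ}

/-- The weight of `n` particles at site `v` in a configuration of the sites outside `A`. -/
def siteWeight (α : ℝ) (A : Finset (ZMod L)) (v : ZMod L) (n : ℕ) : ℝ :=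
  if v ∈ A then (if n = 0 then 1 else 0) else 1 / a α n

/-- The configuration outside `A`, extended by `0` to `A`. -/
def clear (A : Finset (ZMod L)) (ξ : Config L) : Config L := fun v => if v ∈ A then 0 else ξ v

theorem siteWeight_nonneg (α : ℝ) (A : Finset (ZMod L)) (v : ZMod L) (n : ℕ) :
    0 ≤ siteWeight α A v n := by
  unfold siteWeight
  split_ifs
  exacts [zero_le_one, le_rfl, one_div_a_nonneg α n]

theorem clear_add_single {A : Finset (ZMod L)} {w : ZMod L} (hw : w ∈ A) {ζ : Config L}
    (hζ : ∀ v ∈ A, ζ v = 0) (k : ℕ) : clear A (ζ + Pi.single w k) = ζ := by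
  funext v
  by_cases hv : v ∈ A
  · simp [clear, hv, hζ v hv]
  · have hne : v ≠ w := fun h => hv (h ▸ hw)
    simp [clear, hv, hne]

theorem summable_siteWeight_mul {α : ℝ} (A : Finset (ZMod L)) (v : ZMod L) {f : ℕ → ℝ}
    (hf : Summable fun n => 1 / a α n * f n) :
    Summable fun n : ℕ => siteWeight α A v n * f n := by
  unfold siteWeight
  split_ifs
  · exact summable_of_ne_finset_zero (s := {0}) fun n hn => by
      rw [if_neg (Finset.notMem_singleton.1 hn), zero_mul]
  · exact hf

theorem tsum_siteWeight (α : ℝ) (A : Finset (ZMod L)) (v : ZMod L) :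
    ∑' n, siteWeight α A v n = if v ∈ A then 1 else Gam α := by
  unfold siteWeight Gam
  split_ifs
  · exact tsum_ite_eq 0 fun _ => (1 : ℝ)
  · rfl

variable [NeZero L]

/-- The weight of a configuration of the sites outside `A`, extended by `0` to `A`. -/
def bgWeight (α : ℝ) (A : Finset (ZMod L)) (ζ : Config L) : ℝ :=
  ∏ v, siteWeight α A v (ζ v)

/-- The number of particles. -/
def size (ζ : Config L) : ℕ := ∑ v, ζ v

theorem bgWeight_nonneg (α : ℝ) (A : Finset (ZMod L)) (ζ : Config L) : 0 ≤ bgWeight α A ζ :=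
  Finset.prod_nonneg fun v _ => siteWeight_nonneg α A v _

theorem bgWeight_eq_zero (α : ℝ) {A : Finset (ZMod L)} {ζ : Config L} {v : ZMod L} (hv : v ∈ A)
    (h : ζ v ≠ 0) : bgWeight α A ζ = 0 :=
  Finset.prod_eq_zero (Finset.mem_univ v) (by simp [siteWeight, hv, h])

theorem weight_eq_mul_bgWeight (α : ℝ) (A : Finset (ZMod L)) (ξ : Config L) :
    weight α ξ = (∏ v ∈ A, 1 / a α (ξ v)) * bgWeight α A (clear A ξ) := by
  have hA : ∏ v ∈ A, siteWeight α A v (clear A ξ v) = 1 :=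
    Finset.prod_eq_one fun v hv => by simp [siteWeight, clear, hv]
  rw [weight, bgWeight, ← Finset.prod_mul_prod_compl A, ← Finset.prod_mul_prod_compl A
    fun v => siteWeight α A v (clear A ξ v), hA, one_mul]
  refine congrArg _ (Finset.prod_congr rfl fun v hv => ?_)
  simp [siteWeight, clear, Finset.mem_compl.1 hv]

theorem summable_bgWeight {α : ℝ} (hα : 1 < α) (A : Finset (ZMod L)) :
    Summable (bgWeight (L := L) α A) :=
  (hasSum_prod_of_nonneg (siteWeight_nonneg α A) fun v => by
    simpa using summable_siteWeight_mul A v (f := 1)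
      (by simpa using summable_one_div_a hα)).summable

theorem tsum_bgWeight {α : ℝ} (hα : 1 < α) (A : Finset (ZMod L)) :
    ∑' ζ : Config L, bgWeight α A ζ = Gam α ^ (L - A.card) := by
  have htsum := (hasSum_prod_of_nonneg (siteWeight_nonneg α A) fun v => by
    simpa using summable_siteWeight_mul A v (f := 1)
      (by simpa using summable_one_div_a hα)).tsum_eq
  simp only [bgWeight, htsum, tsum_siteWeight]
  rw [Finset.prod_ite, Finset.prod_const_one, one_mul, Finset.prod_const, Finset.filter_not,
    Finset.filter_mem_eq_inter, Finset.univ_inter, ← Finset.compl_eq_univ_sdiff,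
    Finset.card_compl, ZMod.card]

/-- The function `∏_v (1 + ζ_v) ^ 2`, which dominates the quadratic polynomials in the number of
particles. -/
def momentBound (ζ : Config L) : ℝ := (∏ v, ((1 : ℝ) + ζ v)) ^ 2

theorem one_add_size_le_prod (ζ : Config L) : (1 : ℝ) + size ζ ≤ ∏ v, ((1 : ℝ) + ζ v) := by
  rw [size, Nat.cast_sum]
  exact one_add_sum_le_prod_one_add Finset.univ fun v => Nat.cast_nonneg (ζ v)

theorem one_le_momentBound (ζ : Config L) : 1 ≤ momentBound ζ :=
  one_le_pow₀ (by linarith [one_add_size_le_prod ζ, (size ζ).cast_nonneg (α := ℝ)])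

theorem size_add_three_sq_le_momentBound (ζ : Config L) :
    ((size ζ : ℝ) + 3) ^ 2 ≤ 9 * momentBound ζ := by
  have hsize : (0 : ℝ) ≤ size ζ := Nat.cast_nonneg _
  have hsq : ((1 : ℝ) + size ζ) ^ 2 ≤ momentBound ζ :=
    pow_le_pow_left₀ (by linarith) (one_add_size_le_prod ζ) 2
  nlinarith [hsize, hsq]

theorem summable_bgWeight_mul_momentBound {α : ℝ} (hα : 3 < α) (A : Finset (ZMod L)) :
    Summable fun ζ : Config L => bgWeight α A ζ * momentBound ζ := by
  refine (hasSum_prod_of_nonneg (f := fun v n => siteWeight α A v n * ((1 : ℝ) + n) ^ 2)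
    (fun v n => mul_nonneg (siteWeight_nonneg α A v n) (sq_nonneg _)) fun v =>
      summable_siteWeight_mul A v (summable_one_div_a_mul_sq hα)).summable.congr fun ζ => ?_
  rw [bgWeight, momentBound, Finset.prod_mul_distrib, Finset.prod_pow]

theorem sum_bgWeight_eq_tsum (α : ℝ) (A : Finset (ZMod L)) (S : Finset (Config L))
    (q : Config L → ℝ) :
    ∑ ξ ∈ S, bgWeight α A (clear A ξ) * q ξ =
      ∑' ζ, bgWeight α A ζ * ∑ ξ ∈ S with clear A ξ = ζ, q ξ := by
  rw [tsum_eq_sum (s := S.image (clear A)), ← Finset.sum_fiberwise_of_maps_to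
    (g := clear A) (t := S.image (clear A)) fun ξ => Finset.mem_image_of_mem _]
  · refine Finset.sum_congr rfl fun ζ _ => ?_
    rw [Finset.mul_sum]
    exact Finset.sum_congr rfl fun ξ hξ => by rw [(Finset.mem_filter.1 hξ).2]
  · intro ζ hζ
    rw [Finset.filter_eq_empty_iff.2, Finset.sum_empty, mul_zero]
    exact fun ξ hξ h => hζ (h ▸ Finset.mem_image_of_mem _ hξ)

theorem tendsto_sum_bgWeight {α : ℝ} {A : Finset (ZMod L)} {S : ℕ → Finset (Config L)}
    {q : ℕ → Config L → ℝ} {B c : Config L → ℝ} (hB : Summable fun ζ => bgWeight α A ζ * B ζ)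
    (hbound : ∀ᶠ N in atTop, ∀ ζ, (∀ v ∈ A, ζ v = 0) →
      |∑ ξ ∈ S N with clear A ξ = ζ, q N ξ| ≤ B ζ)
    (hlim : ∀ ζ : Config L, (∀ v ∈ A, ζ v = 0) →
      Tendsto (fun N => ∑ ξ ∈ S N with clear A ξ = ζ, q N ξ) atTop (𝓝 (c ζ))) :
    Tendsto (fun N => ∑ ξ ∈ S N, bgWeight α A (clear A ξ) * q N ξ) atTop
      (𝓝 (∑' ζ, bgWeight α A ζ * c ζ)) := by
  have hzero : ∀ ζ : Config L, ¬ (∀ v ∈ A, ζ v = 0) → bgWeight α A ζ = 0 := by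
    intro ζ h
    push Not at h
    obtain ⟨v, hv, hne⟩ := h
    exact bgWeight_eq_zero α hv hne
  simp only [sum_bgWeight_eq_tsum]
  refine tendsto_tsum_of_dominated_convergence hB (fun ζ => ?_) ?_
  · by_cases h : ∀ v ∈ A, ζ v = 0
    · exact (hlim ζ h).const_mul _
    · simp [hzero ζ h]
  · filter_upwards [hbound] with N hN ζ
    by_cases h : ∀ v ∈ A, ζ v = 0
    · rw [Real.norm_eq_abs, abs_mul, abs_of_nonneg (bgWeight_nonneg α A ζ)]
      exact mul_le_mul_of_nonneg_left (hN ζ h) (bgWeight_nonneg α A ζ)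
    · simp [hzero ζ h]

theorem size_clear_add (A : Finset (ZMod L)) (ξ : Config L) :
    size (clear A ξ) + ∑ v ∈ A, ξ v = ∑ v, ξ v := by
  have hA : ∑ v ∈ A, clear A ξ v = 0 := Finset.sum_eq_zero fun v hv => by simp [clear, hv]
  have hAc : ∑ v ∈ Aᶜ, clear A ξ v = ∑ v ∈ Aᶜ, ξ v :=
    Finset.sum_congr rfl fun v hv => by simp [clear, Finset.mem_compl.1 hv]
  rw [size, ← Finset.sum_add_sum_compl A ξ, ← Finset.sum_add_sum_compl A (clear A ξ), hA, hAc]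
  ring

end Background

section OneSite

variable {L : ℕ} [NeZero L]

theorem sum_add_single (ζ : Config L) (w : ZMod L) (k : ℕ) :
    ∑ v, (ζ + Pi.single w k : Config L) v = size ζ + k := by
  simp [size, Finset.sum_add_distrib]

theorem eq_add_single_of_eq_zero {N : ℕ} {A : Finset (ZMod L)} {w : ZMod L} (hw : w ∈ A)
    {η : Config L} (hη : η ∈ confs L N) (hA : ∀ v ∈ A, v ≠ w → η v = 0) :
    η = clear A η + Pi.single w (N - size (clear A η)) := by
  have hsize := size_clear_add A η
  rw [mem_confs.1 hη, Finset.sum_eq_single_of_mem w hw hA] at hsize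
  funext v
  by_cases hv : v = w
  · subst hv
    simp only [Pi.add_apply, Pi.single_eq_same, clear, hw, if_true] at hsize ⊢
    omega
  · by_cases hvA : v ∈ A
    · simp [clear, hv, hvA, hA v hvA hv]
    · simp [clear, hv, hvA]

theorem sum_filter_clear_eq_ite {N : ℕ} {A : Finset (ZMod L)} {w : ZMod L} (hw : w ∈ A)
    {S : Finset (Config L)} (hS : ∀ η ∈ S, η ∈ confs L N ∧ ∀ v ∈ A, v ≠ w → η v = 0)
    (r : ℕ → ℝ) {ζ : Config L} (hζ : ∀ v ∈ A, ζ v = 0) :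
    ∑ η ∈ S with clear A η = ζ, r (η w) =
      if ζ + Pi.single w (N - size ζ) ∈ S then r (N - size ζ) else 0 := by
  have hfiber : ∀ η ∈ S, clear A η = ζ → η = ζ + Pi.single w (N - size ζ) := fun η hη h => by
    have heq := eq_add_single_of_eq_zero hw (hS η hη).1 (hS η hη).2
    rwa [h] at heq
  rw [Finset.sum_filter]
  split_ifs with h
  · rw [Finset.sum_eq_single_of_mem _ h fun η hη hne => if_neg (hne ∘ hfiber η hη),
      if_pos (clear_add_single hw hζ _)]
    simp [hζ w hw]
  · exact Finset.sum_eq_zero fun η hη => if_neg fun h' => h (hfiber η hη h' ▸ hη)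

theorem tendsto_sum_of_eq_zero {α : ℝ} (hα : 1 < α) {A : Finset (ZMod L)} {w : ZMod L} (hw : w ∈ A)
    {S : ℕ → Finset (Config L)} {r : ℕ → ℕ → ℝ} {C c : ℝ}
    (hS : ∀ N, ∀ η ∈ S N, η ∈ confs L N ∧ ∀ v ∈ A, v ≠ w → η v = 0)
    (hr : ∀ᶠ N in atTop, ∀ η ∈ S N, |r N (η w)| ≤ C)
    (hlim : ∀ ζ : Config L, (∀ v ∈ A, ζ v = 0) →
      Tendsto (fun N => if ζ + Pi.single w (N - size ζ) ∈ S N then r N (N - size ζ) else 0) atTop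
        (𝓝 c)) :
    Tendsto (fun N => ∑ η ∈ S N, bgWeight α A (clear A η) * r N (η w)) atTop
      (𝓝 (Gam α ^ (L - A.card) * c)) := by
  rw [← tsum_bgWeight hα A, ← tsum_mul_right]
  refine tendsto_sum_bgWeight (B := fun _ => |C|) ((summable_bgWeight hα A).mul_right _) ?_
    fun ζ hζ => by simpa only [sum_filter_clear_eq_ite hw (hS _) _ hζ] using hlim ζ hζ
  filter_upwards [hr] with N hN ζ hζ
  rw [sum_filter_clear_eq_ite hw (hS N) _ hζ]
  split_ifs with h
  · simpa [hζ w hw] using (hN _ h).trans (le_abs_self C)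
  · simp

/-- Configurations of `E_N` with no particle on `A` outside `w`, and at least `N - l` at `w`. -/
def condensed (N : ℕ) (l : ℝ) (A : Finset (ZMod L)) (w : ZMod L) : Finset (Config L) :=
  (well N l w).filter fun η => ∀ v ∈ A, v ≠ w → η v = 0

theorem mem_condensed {N : ℕ} {l : ℝ} {A : Finset (ZMod L)} {w : ZMod L} {η : Config L} :
    η ∈ condensed N l A w ↔
      (η ∈ confs L N ∧ (N : ℝ) - l ≤ η w) ∧ ∀ v ∈ A, v ≠ w → η v = 0 := by
  rw [condensed, Finset.mem_filter, mem_well]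

theorem add_single_mem_condensed {N : ℕ} {l : ℝ} {A : Finset (ZMod L)} {w : ZMod L} (hw : w ∈ A)
    {ζ : Config L} (hζ : ∀ v ∈ A, ζ v = 0) (hN : size ζ ≤ N) (hl : (size ζ : ℝ) ≤ l) :
    ζ + Pi.single w (N - size ζ) ∈ condensed N l A w := by
  rw [mem_condensed, mem_confs, sum_add_single]
  refine ⟨⟨by omega, ?_⟩, fun v hv hne => by simp [hne, hζ v hv]⟩
  simp only [Pi.add_apply, Pi.single_eq_same, hζ w hw, zero_add]
  rw [Nat.cast_sub hN]
  linarith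

theorem tendsto_sum_condensed {α : ℝ} (hα : 1 < α) {ℓ : ℕ → ℝ} (hℓ : Tendsto ℓ atTop atTop)
    {A : Finset (ZMod L)} {w : ZMod L} (hw : w ∈ A) {r : ℕ → ℕ → ℝ} {C : ℝ}
    (hr : ∀ᶠ N : ℕ in atTop, ∀ m : ℕ, (N : ℝ) - ℓ N ≤ m → m ≤ N → |r N m| ≤ C)
    (hlim : ∀ k : ℕ, Tendsto (fun N => r N (N - k)) atTop (𝓝 1)) :
    Tendsto (fun N => ∑ η ∈ condensed N (ℓ N) A w, bgWeight α A (clear A η) * r N (η w)) atTop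
      (𝓝 (Gam α ^ (L - A.card))) := by
  rw [← mul_one (Gam α ^ _)]
  refine tendsto_sum_of_eq_zero hα hw (C := C) (fun N η hη => ?_) ?_ fun ζ hζ => ?_
  · exact ⟨(mem_condensed.1 hη).1.1, (mem_condensed.1 hη).2⟩
  · filter_upwards [hr] with N hN η hη
    obtain ⟨⟨hconf, hwell⟩, -⟩ := mem_condensed.1 hη
    exact hN _ hwell (mem_confs.1 hconf ▸
      Finset.single_le_sum (f := η) (fun _ _ => Nat.zero_le _) (Finset.mem_univ w))
  · refine (hlim (size ζ)).congr' ?_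
    filter_upwards [hℓ.eventually_ge_atTop (size ζ : ℝ), eventually_ge_atTop (size ζ)] with N hl hN
    rw [if_pos (add_single_mem_condensed hw hζ hN hl)]

end OneSite

section TwoSites

variable {L : ℕ} [NeZero L] {x w : ZMod L}

theorem eq_of_clear_pair_eq {n : ℕ} (hxw : x ≠ w) {ξ ξ' : Config L} (h : ξ ∈ confs L n)
    (h' : ξ' ∈ confs L n) (hclear : clear {x, w} ξ = clear {x, w} ξ')
    (heq : ξ x = ξ' x ∨ ξ w = ξ' w) : ξ = ξ' := by
  have hsize := size_clear_add {x, w} ξ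
  have hsize' := size_clear_add {x, w} ξ'
  rw [mem_confs.1 h, Finset.sum_pair hxw] at hsize
  rw [mem_confs.1 h', Finset.sum_pair hxw, ← hclear] at hsize'
  have hx : ξ x = ξ' x := by omega
  have hw : ξ w = ξ' w := by omega
  funext v
  by_cases hvx : v = x
  · rw [hvx, hx]
  · by_cases hvw : v = w
    · rw [hvw, hw]
    · simpa [clear, hvx, hvw] using congrFun hclear v

theorem card_le_of_clear_pair_eq {n : ℕ} (hxw : x ≠ w) {ζ : Config L} {T : Finset (Config L)}
    (hT : ∀ ξ ∈ T, ξ ∈ confs L n ∧ clear {x, w} ξ = ζ) {y : ZMod L} (hy : y = x ∨ y = w) {m : ℕ}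
    (hm : ∀ ξ ∈ T, ξ y < m) : T.card ≤ m := by
  rw [← Finset.card_range m]
  refine Finset.card_le_card_of_injOn (fun ξ => ξ y)
    (fun ξ hξ => Finset.mem_coe.2 (Finset.mem_range.2 (hm ξ hξ))) fun ξ hξ ξ' hξ' heq => ?_
  refine eq_of_clear_pair_eq hxw (hT ξ hξ).1 (hT ξ' hξ').1
    ((hT ξ hξ).2.trans (hT ξ' hξ').2.symm) ?_
  rcases hy with rfl | rfl
  exacts [Or.inl heq, Or.inr heq]

theorem card_filter_clear_pair_le {N : ℕ} (hN : 1 ≤ N) (hxw : x ≠ w) (ζ : Config L) :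
    ((confs L (N - 1)).filter fun ξ => clear {x, w} ξ = ζ).card ≤ N := by
  refine card_le_of_clear_pair_eq hxw (fun ξ => Finset.mem_filter.1) (Or.inl rfl) fun ξ hξ => ?_
  have hsum := mem_confs.1 (Finset.mem_filter.1 hξ).1
  have hle := Finset.single_le_sum (f := ξ) (fun _ _ => Nat.zero_le _) (Finset.mem_univ x)
  omega

theorem sum_filter_clear_pair_le {N : ℕ} (hN : 1 ≤ N) (hxw : x ≠ w) {e B : Config L → ℝ}
    (hB : ∀ ζ, 0 ≤ B ζ) (he : ∀ ξ ∈ confs L (N - 1), e ξ ≤ B (clear {x, w} ξ)) (ζ : Config L) :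
    ∑ ξ ∈ confs L (N - 1) with clear {x, w} ξ = ζ, e ξ ≤ N * B ζ := by
  have hcard : (((confs L (N - 1)).filter fun ξ => clear {x, w} ξ = ζ).card : ℝ) ≤ N := by
    exact_mod_cast card_filter_clear_pair_le hN hxw ζ
  refine (Finset.sum_le_card_nsmul _ _ (B ζ) fun ξ hξ => ?_).trans ?_
  · rw [Finset.mem_filter] at hξ
    exact hξ.2 ▸ he ξ hξ.1
  · rw [nsmul_eq_mul]
    exact mul_le_mul_of_nonneg_right hcard (hB ζ)

theorem sum_bgWeight_pair_le {α : ℝ} {N : ℕ} (hN : 1 ≤ N) (hxw : x ≠ w) {e B : Config L → ℝ}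
    (hsum : Summable fun ζ => bgWeight α {x, w} ζ * B ζ) (hB : ∀ ζ, 0 ≤ B ζ)
    (he : ∀ ξ ∈ confs L (N - 1), e ξ ≤ B (clear {x, w} ξ)) :
    ∑ ξ ∈ confs L (N - 1), bgWeight α {x, w} (clear {x, w} ξ) * e ξ ≤
      N * ∑' ζ : Config L, bgWeight α {x, w} ζ * B ζ := by
  calc ∑ ξ ∈ confs L (N - 1), bgWeight α {x, w} (clear {x, w} ξ) * e ξ
      ≤ ∑ ξ ∈ confs L (N - 1), bgWeight α {x, w} (clear {x, w} ξ) * B (clear {x, w} ξ) :=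
        Finset.sum_le_sum fun ξ hξ => mul_le_mul_of_nonneg_left (he ξ hξ) (bgWeight_nonneg α _ _)
    _ = ∑' ζ, bgWeight α {x, w} ζ *
          ∑ ξ ∈ confs L (N - 1) with clear {x, w} ξ = ζ, B (clear {x, w} ξ) :=
        sum_bgWeight_eq_tsum α _ _ _
    _ ≤ ∑' ζ, N * (bgWeight α {x, w} ζ * B ζ) := by
        have hle : ∀ ζ, bgWeight α {x, w} ζ *
            ∑ ξ ∈ confs L (N - 1) with clear {x, w} ξ = ζ, B (clear {x, w} ξ) ≤
              N * (bgWeight α {x, w} ζ * B ζ) := fun ζ => by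
          rw [mul_left_comm]
          exact mul_le_mul_of_nonneg_left
            (sum_filter_clear_pair_le hN hxw hB (fun _ _ => le_rfl) ζ) (bgWeight_nonneg α _ ζ)
        refine Summable.tsum_le_tsum hle (Summable.of_nonneg_of_le (fun ζ => ?_) hle
          (hsum.mul_left _)) (hsum.mul_left _)
        exact mul_nonneg (bgWeight_nonneg α _ ζ) (Finset.sum_nonneg fun ξ _ => hB _)
    _ = N * ∑' ζ, bgWeight α {x, w} ζ * B ζ := tsum_mul_left

/-- A fibre of `clear {x, w}` meets `{ξ | ξ x < ε N} ∪ {ξ | ξ w < ε N}` in at most `2 (ε N + 1)`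
points. -/
theorem sum_filter_clear_pair_le_of_le {N : ℕ} (hN : 1 ≤ N) (hxw : x ≠ w) {ζ : Config L}
    {e : Config L → ℝ} {b ε : ℝ} (hb : 0 ≤ b) (hε : 0 ≤ ε)
    (heb : ∀ ξ ∈ confs L (N - 1), clear {x, w} ξ = ζ → e ξ ≤ b)
    (heε : ∀ ξ ∈ confs L (N - 1), clear {x, w} ξ = ζ → ε * N ≤ ξ x → ε * N ≤ ξ w → e ξ ≤ ε) :
    ∑ ξ ∈ confs L (N - 1) with clear {x, w} ξ = ζ, e ξ ≤ N * ε + 2 * ((ε * N + 1) * b) := by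
  set T := (confs L (N - 1)).filter fun ξ => clear {x, w} ξ = ζ
  have hT : ∀ ξ ∈ T, ξ ∈ confs L (N - 1) ∧ clear {x, w} ξ = ζ := fun ξ => Finset.mem_filter.1
  have hpoint : ∀ ξ ∈ T, e ξ ≤ ε + (if (ξ x : ℝ) < ε * N then b else 0) +
      (if (ξ w : ℝ) < ε * N then b else 0) := by
    intro ξ hξ
    have hle := heb ξ (hT ξ hξ).1 (hT ξ hξ).2
    split_ifs with hx hw hw
    · linarith
    · linarith
    · linarith
    · linarith [heε ξ (hT ξ hξ).1 (hT ξ hξ).2 (not_lt.1 hx) (not_lt.1 hw)]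
  have hcard : ∀ y, y = x ∨ y = w →
      ((T.filter fun ξ => (ξ y : ℝ) < ε * N).card : ℝ) ≤ ε * N + 1 := by
    intro y hy
    have hceil : (T.filter fun ξ => (ξ y : ℝ) < ε * N).card ≤ ⌈ε * N⌉₊ :=
      card_le_of_clear_pair_eq hxw (fun ξ hξ => hT ξ (Finset.mem_filter.1 hξ).1) hy
        fun ξ hξ => Nat.lt_ceil.2 (Finset.mem_filter.1 hξ).2
    exact (Nat.cast_le.2 hceil).trans (Nat.ceil_lt_add_one (by positivity)).le
  have hcardT : (T.card : ℝ) ≤ N := by exact_mod_cast card_filter_clear_pair_le hN hxw ζ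
  refine (Finset.sum_le_sum hpoint).trans ?_
  rw [Finset.sum_add_distrib, Finset.sum_add_distrib, ← Finset.sum_filter, ← Finset.sum_filter]
  simp only [Finset.sum_const, nsmul_eq_mul]
  linarith [mul_le_mul_of_nonneg_right (hcard x (Or.inl rfl)) hb,
    mul_le_mul_of_nonneg_right (hcard w (Or.inr rfl)) hb, mul_le_mul_of_nonneg_right hcardT hε]

theorem tendsto_sum_filter_clear_pair_zero (hxw : x ≠ w) {ζ : Config L} {e : ℕ → Config L → ℝ}
    {b : ℝ} (he : ∀ N ξ, 0 ≤ e N ξ) (hb : 0 ≤ b)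
    (heb : ∀ᶠ N : ℕ in atTop, ∀ ξ ∈ confs L (N - 1), clear {x, w} ξ = ζ → e N ξ ≤ b)
    (hlim : ∀ ε : ℝ, 0 < ε → ∀ᶠ N : ℕ in atTop, ∀ ξ ∈ confs L (N - 1),
      clear {x, w} ξ = ζ → ε * N ≤ ξ x → ε * N ≤ ξ w → e N ξ ≤ ε) :
    Tendsto (fun N : ℕ => ∑ ξ ∈ confs L (N - 1) with clear {x, w} ξ = ζ, 1 / (N : ℝ) * e N ξ)
      atTop (𝓝 0) := by
  simp only [← Finset.mul_sum]
  have hnonneg (N : ℕ) :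
      0 ≤ 1 / (N : ℝ) * ∑ ξ ∈ confs L (N - 1) with clear {x, w} ξ = ζ, e N ξ :=
    mul_nonneg (by positivity) (Finset.sum_nonneg fun ξ _ => he N ξ)
  rw [tendsto_order]
  refine ⟨fun δ hδ => .of_forall fun N => hδ.trans_le (hnonneg N), fun δ hδ => ?_⟩
  set ε := δ / (2 * (1 + 2 * b)) with hεdef
  have hε : 0 < ε := by positivity
  have hεδ : ε * (1 + 2 * b) = δ / 2 := by rw [hεdef]; field_simp
  filter_upwards [heb, hlim ε hε, eventually_ge_atTop 1,
    (tendsto_const_div_atTop_nhds_zero_nat (2 * b)).eventually_lt_const (half_pos hδ)]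
    with N hNb hNε hN hNδ
  have hNpos : (0 : ℝ) < N := by exact_mod_cast hN
  calc 1 / (N : ℝ) * ∑ ξ ∈ confs L (N - 1) with clear {x, w} ξ = ζ, e N ξ
      ≤ 1 / (N : ℝ) * (N * ε + 2 * ((ε * N + 1) * b)) :=
        mul_le_mul_of_nonneg_left (sum_filter_clear_pair_le_of_le hN hxw hb hε.le hNb hNε)
          (by positivity)
    _ = ε * (1 + 2 * b) + 2 * b / N := by field_simp [hNpos.ne']; ring
    _ < δ := by linarith

theorem tendsto_sum_bgWeight_pair_zero {α : ℝ} (hxw : x ≠ w) {e : ℕ → Config L → ℝ}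
    {B : Config L → ℝ} (hsum : Summable fun ζ => bgWeight α {x, w} ζ * B ζ) (hB : ∀ ζ, 0 ≤ B ζ)
    (he : ∀ N ξ, 0 ≤ e N ξ)
    (heB : ∀ᶠ N : ℕ in atTop, ∀ ξ ∈ confs L (N - 1), e N ξ ≤ B (clear {x, w} ξ))
    (hlim : ∀ (ζ : Config L) (ε : ℝ), 0 < ε → ∀ᶠ N : ℕ in atTop, ∀ ξ ∈ confs L (N - 1),
      clear {x, w} ξ = ζ → ε * N ≤ ξ x → ε * N ≤ ξ w → e N ξ ≤ ε) :
    Tendsto (fun N : ℕ => 1 / (N : ℝ) *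
      ∑ ξ ∈ confs L (N - 1), bgWeight α {x, w} (clear {x, w} ξ) * e N ξ) atTop (𝓝 0) := by
  have key : Tendsto (fun N : ℕ => ∑ ξ ∈ confs L (N - 1),
      bgWeight α {x, w} (clear {x, w} ξ) * (1 / (N : ℝ) * e N ξ)) atTop
      (𝓝 (∑' ζ : Config L, bgWeight α {x, w} ζ * 0)) := by
    refine tendsto_sum_bgWeight hsum ?_ fun ζ _ => tendsto_sum_filter_clear_pair_zero hxw he (hB ζ)
      (heB.mono fun N hN ξ hξ h => h ▸ hN ξ hξ) (hlim ζ)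
    filter_upwards [heB, eventually_ge_atTop 1] with N hN hN1 ζ _
    have hNpos : (0 : ℝ) < N := by exact_mod_cast hN1
    rw [← Finset.mul_sum, abs_of_nonneg (mul_nonneg (by positivity)
      (Finset.sum_nonneg fun ξ _ => he N ξ)), one_div, inv_mul_le_iff₀ hNpos]
    exact sum_filter_clear_pair_le hN1 hxw hB hN ζ
  simp only [mul_zero, tsum_zero] at key
  refine key.congr fun N => ?_
  rw [Finset.mul_sum]
  exact Finset.sum_congr rfl fun ξ _ => mul_left_comm _ _ _

end TwoSites

/-! ### The partition function and the measure of the wells -/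

theorem tendsto_rpow_div_a (α : ℝ) (k : ℕ) :
    Tendsto (fun N : ℕ => (N : ℝ) ^ α / a α (N - k)) atTop (𝓝 1) := by
  have hratio : Tendsto (fun N : ℕ => (N : ℝ) / ((N - k : ℕ) : ℝ)) atTop (𝓝 1) := by
    rw [← tendsto_add_atTop_iff_nat k, ← add_zero (1 : ℝ)]
    refine (tendsto_const_nhds.add (tendsto_const_div_atTop_nhds_zero_nat (k : ℝ))).congr' ?_
    filter_upwards [eventually_ne_atTop 0] with N hN
    rw [Nat.add_sub_cancel, Nat.cast_add, add_div, div_self (Nat.cast_ne_zero.2 hN)]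
  have hrpow := hratio.rpow_const (p := α) (Or.inl one_ne_zero)
  rw [Real.one_rpow] at hrpow
  refine hrpow.congr' ?_
  filter_upwards [eventually_gt_atTop k] with N hN
  rw [a_of_pos α (by omega), Real.div_rpow (by positivity) (by positivity)]

theorem rpow_div_a_le {α : ℝ} (hα : 0 ≤ α) {N m : ℕ} {c : ℝ} (hc : 0 ≤ c) (hN : 0 < N)
    (h : (N : ℝ) ≤ c * m) : (N : ℝ) ^ α / a α m ≤ c ^ α := by
  have hm : 0 < m := by
    rcases m.eq_zero_or_pos with rfl | hm
    · simp [hN.ne'] at h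
    · exact hm
  rw [div_le_iff₀ (a_pos α m), a_of_pos α hm, ← Real.mul_rpow hc m.cast_nonneg]
  exact Real.rpow_le_rpow N.cast_nonneg h hα

theorem eventually_mul_lt {ℓ : ℕ → ℝ} (hℓN : Tendsto (fun N : ℕ => ℓ N / (N : ℝ)) atTop (𝓝 0))
    (c : ℝ) : ∀ᶠ N : ℕ in atTop, c * ℓ N < N := by
  have hlim := hℓN.const_mul c
  rw [mul_zero] at hlim
  filter_upwards [hlim.eventually_lt_const one_pos, eventually_gt_atTop 0] with N hlt hN
  rwa [← mul_div_assoc, div_lt_one (Nat.cast_pos.2 hN)] at hlt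

theorem sum_le_sum_filter_cover {ι κ : Type*} {W : Finset κ} {S : Finset ι} {f : ι → ℝ}
    (hf : ∀ i ∈ S, 0 ≤ f i) (P : κ → ι → Prop) [∀ k, DecidablePred (P k)]
    (hP : ∀ i ∈ S, ∃ k ∈ W, P k i) :
    ∑ i ∈ S, f i ≤ ∑ k ∈ W, ∑ i ∈ S with P k i, f i := by
  simp only [Finset.sum_filter]
  rw [Finset.sum_comm]
  refine Finset.sum_le_sum fun i hi => ?_
  obtain ⟨k, hk, hPk⟩ := hP i hi
  refine (if_pos hPk).ge.trans
    (Finset.single_le_sum (f := fun k => if P k i then f i else 0) (fun k _ => ?_) hk)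
  split_ifs
  exacts [hf i hi, le_rfl]

section Wells

variable {L : ℕ} [NeZero L] {α : ℝ} {ℓ : ℕ → ℝ}

theorem rpow_mul_sum_weight (α : ℝ) (N : ℕ) (S : Finset (Config L)) (w : ZMod L) :
    (N : ℝ) ^ α * ∑ η ∈ S, weight α η =
      ∑ η ∈ S, bgWeight α {w} (clear {w} η) * ((N : ℝ) ^ α / a α (η w)) := by
  rw [Finset.mul_sum]
  refine Finset.sum_congr rfl fun η _ => ?_
  rw [weight_eq_mul_bgWeight α {w}, Finset.prod_singleton]
  ring

theorem condensed_singleton (N : ℕ) (l : ℝ) (w : ZMod L) : condensed N l {w} w = well N l w :=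
  Finset.filter_true_of_mem fun _ _ _ hv hne => absurd (Finset.mem_singleton.1 hv) hne

theorem tendsto_weight_well (hα : 1 < α) (hℓ : Tendsto ℓ atTop atTop)
    (hℓN : Tendsto (fun N : ℕ => ℓ N / (N : ℝ)) atTop (𝓝 0)) (w : ZMod L) :
    Tendsto (fun N : ℕ => (N : ℝ) ^ α * ∑ η ∈ well N (ℓ N) w, weight α η) atTop
      (𝓝 (Gam α ^ (L - 1))) := by
  simp only [rpow_mul_sum_weight α _ _ w, ← condensed_singleton]
  rw [← Finset.card_singleton w]
  refine tendsto_sum_condensed hα hℓ (Finset.mem_singleton_self w)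
    (r := fun N m => (N : ℝ) ^ α / a α m) (C := 2 ^ α) ?_ fun k => tendsto_rpow_div_a α k
  filter_upwards [eventually_mul_lt hℓN 2, eventually_gt_atTop 0] with N hlt hN m hm _
  rw [abs_of_nonneg (div_nonneg (by positivity) (a_pos α m).le)]
  exact rpow_div_a_le (by linarith) zero_le_two hN (by linarith)

/-- The configurations of `E_N` outside the wells whose fullest site is `w`. -/
def offWells (N : ℕ) (l : ℝ) (w : ZMod L) : Finset (Config L) :=
  (confs L N).filter fun η => η ∉ wells N l Finset.univ ∧ ∀ v, η v ≤ η w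

theorem rpow_div_a_le_of_mem_offWells (hα : 0 ≤ α) {N : ℕ} {l : ℝ} {w : ZMod L} {η : Config L}
    (hN : 0 < N) (hη : η ∈ offWells N l w) : (N : ℝ) ^ α / a α (η w) ≤ (L : ℝ) ^ α := by
  obtain ⟨hconf, -, hmax⟩ := Finset.mem_filter.1 hη
  refine rpow_div_a_le hα L.cast_nonneg hN ?_
  have hsum : ∑ v, η v ≤ ∑ _v : ZMod L, η w := Finset.sum_le_sum fun v _ => hmax v
  rw [mem_confs.1 hconf, Finset.sum_const, Finset.card_univ, ZMod.card, smul_eq_mul] at hsum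
  exact_mod_cast hsum

theorem add_single_notMem_offWells {N : ℕ} {l : ℝ} {w : ZMod L} {ζ : Config L}
    (hζ : ζ w = 0) (hl : (size ζ : ℝ) ≤ l) (hN : size ζ ≤ N) :
    ζ + Pi.single w (N - size ζ) ∉ offWells N l w := by
  intro hη
  obtain ⟨-, hoff, -⟩ := Finset.mem_filter.1 hη
  refine hoff (well_subset_wells (z := w) ?_)
  rw [← condensed_singleton]
  exact add_single_mem_condensed (Finset.mem_singleton_self w) (by simpa using hζ) hN hl

theorem tendsto_weight_offWells (hα : 1 < α) (hℓ : Tendsto ℓ atTop atTop) (w : ZMod L) :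
    Tendsto (fun N : ℕ => (N : ℝ) ^ α * ∑ η ∈ offWells N (ℓ N) w, weight α η) atTop (𝓝 0) := by
  simp only [rpow_mul_sum_weight α _ _ w]
  rw [← mul_zero (Gam α ^ (L - ({w} : Finset (ZMod L)).card))]
  refine tendsto_sum_of_eq_zero hα (Finset.mem_singleton_self w)
    (r := fun N m => (N : ℝ) ^ α / a α m) (C := (L : ℝ) ^ α)
    (fun N η hη => ⟨(Finset.mem_filter.1 hη).1,
      fun v hv hne => absurd (Finset.mem_singleton.1 hv) hne⟩) ?_ fun ζ hζ => ?_
  · filter_upwards [eventually_gt_atTop 0] with N hN η hη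
    rw [abs_of_nonneg (div_nonneg (by positivity) (a_pos α _).le)]
    exact rpow_div_a_le_of_mem_offWells (by linarith) hN hη
  · refine tendsto_const_nhds.congr' ?_
    filter_upwards [hℓ.eventually_ge_atTop (size ζ : ℝ), eventually_ge_atTop (size ζ)] with N hl hN
    rw [if_neg (add_single_notMem_offWells (hζ w (Finset.mem_singleton_self w)) hl hN)]

theorem tendsto_weight_off_wells (hα : 1 < α) (hℓ : Tendsto ℓ atTop atTop) :
    Tendsto (fun N : ℕ => (N : ℝ) ^ α *
      ∑ η ∈ confs L N with η ∉ wells N (ℓ N) Finset.univ, weight α η) atTop (𝓝 0) := by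
  have hsum := tendsto_finsetSum Finset.univ
    fun w (_ : w ∈ Finset.univ) => tendsto_weight_offWells (L := L) hα hℓ w
  rw [Finset.sum_const_zero] at hsum
  refine squeeze_zero (fun N => mul_nonneg (by positivity)
    (Finset.sum_nonneg fun η _ => (weight_pos α η).le)) (fun N => ?_) hsum
  rw [← Finset.mul_sum]
  refine mul_le_mul_of_nonneg_left ((sum_le_sum_filter_cover (W := Finset.univ)
    (fun η _ => (weight_pos α η).le) (fun (w : ZMod L) η => ∀ v, η v ≤ η w) fun η _ => ?_).trans_eq
      (Finset.sum_congr rfl fun w _ => by rw [Finset.filter_filter, offWells])) (by positivity)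
  obtain ⟨w, hw⟩ := Finite.exists_max η
  exact ⟨w, Finset.mem_univ w, hw⟩

theorem sum_wells {N : ℕ} {l : ℝ} (hl : 2 * l < N) (W : Finset (ZMod L)) (f : Config L → ℝ) :
    ∑ η ∈ wells N l W, f η = ∑ w ∈ W, ∑ η ∈ well N l w, f η :=
  Finset.sum_biUnion fun _ _ _ _ hzw => Finset.disjoint_left.2 fun _ hη =>
    notMem_well_of_mem_well hl hzw hη

theorem tendsto_Z (hα : 1 < α) (hℓ : Tendsto ℓ atTop atTop)
    (hℓN : Tendsto (fun N : ℕ => ℓ N / (N : ℝ)) atTop (𝓝 0)) :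
    Tendsto (fun N : ℕ => Z L α N) atTop (𝓝 (L * Gam α ^ (L - 1))) := by
  have hwells := tendsto_finsetSum Finset.univ
    fun w (_ : w ∈ Finset.univ) => tendsto_weight_well (L := L) hα hℓ hℓN w
  rw [Finset.sum_const, Finset.card_univ, ZMod.card, nsmul_eq_mul] at hwells
  have hsum := hwells.add (tendsto_weight_off_wells (L := L) hα hℓ)
  rw [add_zero] at hsum
  refine hsum.congr' ?_
  filter_upwards [eventually_mul_lt hℓN 2] with N hN
  rw [Z, ← Finset.sum_filter_add_sum_filter_not (confs L N) (· ∈ wells N (ℓ N) Finset.univ),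
    mul_add, ← Finset.mul_sum, ← sum_wells hN]
  congr 3
  ext η
  rw [Finset.mem_filter, and_iff_right_of_imp]
  exact fun hη => (mem_well.1 (mem_wells.1 hη).choose_spec.2).1

theorem tendsto_mu_well (hα : 1 < α) (hℓ : Tendsto ℓ atTop atTop)
    (hℓN : Tendsto (fun N : ℕ => ℓ N / (N : ℝ)) atTop (𝓝 0)) (w : ZMod L) :
    Tendsto (fun N : ℕ => ∑ η ∈ well N (ℓ N) w, mu α N η) atTop (𝓝 (1 / L)) := by
  have hGam : Gam α ^ (L - 1) ≠ 0 := (pow_pos (Gam_pos hα) _).ne'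
  have hL : (L : ℝ) ≠ 0 := Nat.cast_ne_zero.2 (NeZero.ne L)
  have hdiv := (tendsto_weight_well (L := L) hα hℓ hℓN w).div (tendsto_Z (L := L) hα hℓ hℓN)
    (mul_ne_zero hL hGam)
  rw [div_mul_cancel_right₀ hGam, ← one_div] at hdiv
  refine hdiv.congr fun N => ?_
  rw [Pi.div_apply, Finset.mul_sum, Finset.sum_div]
  exact Finset.sum_congr rfl fun η _ => by rw [mu]; ring

end Wells

/-! ### The one-dimensional profile -/

section Profile

/-- The density `s ^ α (1 - s) ^ α` on `[0, 1]`: the inverse of the weight of a configuration all of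
whose particles are on two sites, in the proportions `s` and `1 - s`. -/
def kern (α s : ℝ) : ℝ := s ^ α * (1 - s) ^ α

/-- The primitive of `kern α` which vanishes at `0`. -/
def prim (α t : ℝ) : ℝ := ∫ s in (0 : ℝ)..t, kern α s

/-- The projection of the line to `[d, 1 - d]`, for `d ≤ 1 / 2`. -/
def clip (d t : ℝ) : ℝ := max d (min t (1 - d))

/-- The increment of `prim α` over `[d, 1 - d]`. -/
def primGap (α d : ℝ) : ℝ := prim α (1 - d) - prim α d

variable {α : ℝ}

theorem continuous_kern (hα : 0 < α) : Continuous (kern α) :=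
  (continuous_id.rpow_const fun _ => Or.inr hα.le).mul
    ((continuous_const.sub continuous_id).rpow_const fun _ => Or.inr hα.le)

theorem integral_kern_pos (hα : 0 < α) {s t : ℝ} (hs : 0 ≤ s) (ht : t ≤ 1) (hst : s < t) :
    0 < ∫ r in s..t, kern α r :=
  intervalIntegral.intervalIntegral_pos_of_pos_on ((continuous_kern hα).intervalIntegrable s t)
    (fun _ hr => mul_pos (Real.rpow_pos_of_pos (hs.trans_lt hr.1) α)
      (Real.rpow_pos_of_pos (sub_pos.2 (hr.2.trans_le ht)) α)) hst

theorem I_pos (hα : 0 < α) : 0 < I α := integral_kern_pos hα le_rfl le_rfl one_pos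

theorem prim_sub (hα : 0 < α) (s t : ℝ) : prim α t - prim α s = ∫ r in s..t, kern α r :=
  intervalIntegral.integral_interval_sub_left ((continuous_kern hα).intervalIntegrable _ _)
    ((continuous_kern hα).intervalIntegrable _ _)

theorem continuous_prim (hα : 0 < α) : Continuous (prim α) :=
  intervalIntegral.continuous_primitive
    (fun _ _ => (continuous_kern hα).intervalIntegrable _ _) 0

theorem primGap_pos (hα : 0 < α) {d : ℝ} (hd : 0 < d) (hd' : d < 1 / 2) : 0 < primGap α d := by
  rw [primGap, prim_sub hα]
  exact integral_kern_pos hα hd.le (by linarith) (by linarith)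

theorem tendsto_primGap (hα : 0 < α) {d : ℕ → ℝ} (hd : Tendsto d atTop (𝓝 0)) :
    Tendsto (fun N => primGap α (d N)) atTop (𝓝 (I α)) := by
  have hcont : Continuous (primGap α) :=
    ((continuous_prim hα).comp (continuous_const.sub continuous_id)).sub (continuous_prim hα)
  have hgap : primGap α 0 = I α := by rw [primGap, sub_zero, prim_sub hα]; rfl
  exact hgap ▸ (hcont.tendsto 0).comp hd

theorem abs_clip_sub_le (d s t : ℝ) : |clip d t - clip d s| ≤ |t - s| := by
  rw [clip, clip, max_comm d, max_comm d]
  refine (abs_max_sub_max_le_abs _ _ _).trans ((abs_min_sub_min_le_max _ _ _ _).trans ?_)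
  simp

theorem uIoc_clip_subset (d s t : ℝ) :
    Set.uIoc (clip d s) (clip d t) ⊆ Set.uIoc s t := by
  have hIoc : ∀ s t : ℝ, Set.Ioc (clip d s) (clip d t) ⊆ Set.Ioc s t := by
    rintro s t r ⟨hs, ht⟩
    simp only [clip, max_lt_iff, min_lt_iff, le_max_iff, le_min_iff] at hs ht
    have hrt := ht.resolve_left hs.1.not_ge
    exact ⟨hs.2.resolve_right hrt.2.not_gt, hrt.1⟩
  rw [Set.uIoc_eq_union, Set.uIoc_eq_union]
  exact Set.union_subset_union (hIoc s t) (hIoc t s)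

theorem abs_kern_le (hα : 0 ≤ α) {r T Q : ℝ} (hr : 0 ≤ r) (hr1 : r ≤ 1) (hT : r ≤ T)
    (hQ : 1 - r ≤ Q) : |kern α r| ≤ T ^ α * Q ^ α := by
  have hr' : 0 ≤ 1 - r := sub_nonneg.2 hr1
  rw [kern, abs_of_nonneg (mul_nonneg (Real.rpow_nonneg hr α) (Real.rpow_nonneg hr' α))]
  exact mul_le_mul (Real.rpow_le_rpow hr hT hα) (Real.rpow_le_rpow hr' hQ hα)
    (Real.rpow_nonneg hr' α) (Real.rpow_nonneg (hr.trans hT) α)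

theorem abs_prim_clip_sub_le (hα : 0 < α) (d : ℝ) {s t T Q : ℝ}
    (hs : s ∈ Set.Icc 0 1) (ht : t ∈ Set.Icc 0 1) (hT : max s t ≤ T) (hQ : 1 - min s t ≤ Q) :
    |prim α (clip d t) - prim α (clip d s)| ≤ |t - s| * (T ^ α * Q ^ α) := by
  have hkern : ∀ r ∈ Set.uIoc (clip d s) (clip d t), ‖kern α r‖ ≤ T ^ α * Q ^ α := by
    intro r hr
    obtain ⟨hlo, hhi⟩ := uIoc_clip_subset d s t hr
    exact abs_kern_le hα.le ((le_min hs.1 ht.1).trans hlo.le) (hhi.trans (max_le hs.2 ht.2))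
      (hhi.trans hT) (by linarith)
  have hTQ : 0 ≤ T ^ α * Q ^ α :=
    mul_nonneg (Real.rpow_nonneg (hs.1.trans ((le_max_left s t).trans hT)) α)
      (Real.rpow_nonneg (by linarith [min_le_left s t, hs.2]) α)
  rw [prim_sub hα, mul_comm]
  exact (intervalIntegral.norm_integral_le_of_norm_le_const hkern).trans
    (mul_le_mul_of_nonneg_left (abs_clip_sub_le d s t) hTQ)

theorem abs_rpow_sub_le (hα : 1 ≤ α) {s p : ℝ} (hs : s ∈ Set.Icc (0 : ℝ) 1)
    (hp : p ∈ Set.Icc (0 : ℝ) 1) : |s ^ α - p ^ α| ≤ α * |s - p| := by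
  refine (convex_Icc (0 : ℝ) 1).norm_image_sub_le_of_norm_hasDerivWithin_le
    (f := fun r : ℝ => r ^ α)
    (fun r _ => (Real.hasDerivAt_rpow_const (Or.inr hα)).hasDerivWithinAt) (fun r hr => ?_) hp hs
  rw [Real.norm_eq_abs, abs_of_nonneg (mul_nonneg (by linarith) (Real.rpow_nonneg hr.1 _))]
  exact mul_le_of_le_one_right (by linarith) (Real.rpow_le_one hr.1 hr.2 (by linarith))

theorem abs_rpow_mul_rpow_sub_le (hα : 1 ≤ α) {s t p q : ℝ} (hs : s ∈ Set.Icc (0 : ℝ) 1)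
    (ht : t ∈ Set.Icc (0 : ℝ) 1) (hp : p ∈ Set.Icc (0 : ℝ) 1) (hq : q ∈ Set.Icc (0 : ℝ) 1) :
    |s ^ α * t ^ α - p ^ α * q ^ α| ≤ α * (|s - p| + |t - q|) := by
  have hle : ∀ r ∈ Set.Icc (0 : ℝ) 1, |r ^ α| ≤ 1 := fun r hr => by
    rw [abs_of_nonneg (Real.rpow_nonneg hr.1 _)]
    exact Real.rpow_le_one hr.1 hr.2 (by linarith)
  calc |s ^ α * t ^ α - p ^ α * q ^ α|
      = |(s ^ α - p ^ α) * t ^ α + p ^ α * (t ^ α - q ^ α)| := by congr 1; ring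
    _ ≤ |s ^ α - p ^ α| * |t ^ α| + |p ^ α| * |t ^ α - q ^ α| := by
        rw [← abs_mul, ← abs_mul]; exact abs_add_le _ _
    _ ≤ |s ^ α - p ^ α| + |t ^ α - q ^ α| := add_le_add
        (mul_le_of_le_one_right (abs_nonneg _) (hle t ht))
        (mul_le_of_le_one_left (abs_nonneg _) (hle p hp))
    _ ≤ α * (|s - p| + |t - q|) := by
        rw [mul_add]; exact add_le_add (abs_rpow_sub_le hα hs hp) (abs_rpow_sub_le hα ht hq)

end Profile

/-! ### The test functions -/

section TestFunction

variable {L : ℕ} [NeZero L] {x w : ZMod L}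

/-- The sites `x, x + 1, …, w - 1`. -/
def arc (x w : ZMod L) : Finset (ZMod L) :=
  Finset.univ.filter fun z => (z - x).val < (w - x).val

theorem mem_arc {z : ZMod L} : z ∈ arc x w ↔ (z - x).val < (w - x).val := by simp [arc]

theorem left_mem_arc (h : w ≠ x) : x ∈ arc x w := by
  rw [mem_arc, sub_self, ZMod.val_zero]
  exact Nat.pos_of_ne_zero fun hval => h (sub_eq_zero.1 ((ZMod.val_eq_zero _).1 hval))

theorem right_notMem_arc (x w : ZMod L) : w ∉ arc x w := by simp [mem_arc]

theorem left_sub_one_notMem_arc (x w : ZMod L) : x - 1 ∉ arc x w := by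
  obtain ⟨n, rfl⟩ := Nat.exists_eq_succ_of_ne_zero (NeZero.ne L)
  rw [mem_arc, sub_sub_cancel_left, ZMod.val_neg_one, not_lt]
  exact Nat.lt_succ_iff.1 (ZMod.val_lt _)

theorem sum_arc_sub (x w : ZMod L) (F : ZMod L → ℝ) :
    ∑ z ∈ arc x w, (F (z + 1) - F z) = F w - F x := by
  have hval : ∀ j ∈ Finset.range (w - x).val, (x + (j : ZMod L) - x).val = j := fun j hj => by
    rw [add_sub_cancel_left, ZMod.val_natCast_of_lt ((Finset.mem_range.1 hj).trans (ZMod.val_lt _))]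
  have hreindex : ∑ z ∈ arc x w, (F (z + 1) - F z) =
      ∑ j ∈ Finset.range (w - x).val, (F (x + (j + 1 : ℕ)) - F (x + (j : ℕ))) := by
    refine Finset.sum_bij' (fun z _ => (z - x).val) (fun j _ => x + (j : ℕ))
      (fun z hz => Finset.mem_range.2 (mem_arc.1 hz))
      (fun j hj => mem_arc.2 ((hval j hj).symm ▸ Finset.mem_range.1 hj))
      (fun z _ => by simp) hval (fun z _ => ?_)
    rw [Nat.cast_add, ← add_assoc, ZMod.natCast_zmod_val, add_sub_cancel, Nat.cast_one]
  rw [hreindex, Finset.sum_range_sub (fun j : ℕ => F (x + (j : ZMod L)))]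
  simp

/-- `w` carries the most particles among the sites other than `x`. -/
def IsDominant (x : ZMod L) (η : Config L) (w : ZMod L) : Prop :=
  w ≠ x ∧ ∀ v, v ≠ x → η v ≤ η w

theorem exists_isDominant (hL : 2 ≤ L) (x : ZMod L) (η : Config L) : ∃ w, IsDominant x η w := by
  have hne : ((Finset.univ : Finset (ZMod L)).erase x).Nonempty :=
    ⟨x + 1, Finset.mem_erase.2
      ⟨fun h => one_ne_zero_of_two_le hL (add_eq_left.1 h), Finset.mem_univ _⟩⟩
  obtain ⟨w, hw, hmax⟩ := Finset.exists_max_image _ η hne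
  exact ⟨w, Finset.ne_of_mem_erase hw,
    fun v hv => hmax v (Finset.mem_erase.2 ⟨hv, Finset.mem_univ v⟩)⟩

open Classical in
/-- A dominant site. It exists as soon as `2 ≤ L`; the value `x` for `L = 1` is junk. -/
def domSite (x : ZMod L) (η : Config L) : ZMod L :=
  if h : ∃ w, IsDominant x η w then h.choose else x

theorem isDominant_domSite (hL : 2 ≤ L) (x : ZMod L) (η : Config L) :
    IsDominant x η (domSite x η) := by
  rw [domSite, dif_pos (exists_isDominant hL x η)]
  exact (exists_isDominant hL x η).choose_spec

/-- The position of `η` in the tube between `x` and its dominant site `w`: the number of particles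
on the sites `x, …, w - 1`, where those beyond `x` count for at most `η x`. Thus only the jumps from
`w - 1` and `x - 1` change the position inside the tube, while `η x = 0` forces position `0`. -/
def coord (x : ZMod L) (η : Config L) : ℕ :=
  η x + min (η x) (∑ v ∈ (arc x (domSite x η)).erase x, η v)

/-- The test function centred at `x`. Up to the factor `primGap α d` it approximates the potential
of the well at `x`: it is `prim α` as a function of the proportion of particles counted by `coord`,
flattened near the end points. -/
def testFn (α : ℝ) (N : ℕ) (d : ℝ) (x : ZMod L) (η : Config L) : ℝ :=
  prim α (clip d ((coord x η : ℝ) / N)) - prim α d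

theorem le_coord (x : ZMod L) (η : Config L) : η x ≤ coord x η := Nat.le_add_right _ _

theorem coord_le_two_mul (x : ZMod L) (η : Config L) : coord x η ≤ 2 * η x := by
  rw [coord, two_mul]
  exact Nat.add_le_add_left (min_le_left _ _) _

theorem coord_add_domSite_le (hL : 2 ≤ L) (x : ZMod L) (η : Config L) :
    coord x η + η (domSite x η) ≤ ∑ v, η v :=
  calc coord x η + η (domSite x η)
      ≤ ∑ v ∈ arc x (domSite x η), η v + η (domSite x η) := by
        rw [← Finset.add_sum_erase _ η (left_mem_arc (isDominant_domSite hL x η).1), coord]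
        gcongr
        exact min_le_right _ _
    _ = ∑ v ∈ insert (domSite x η) (arc x (domSite x η)), η v := by
        rw [Finset.sum_insert (right_notMem_arc x (domSite x η)), add_comm]
    _ ≤ ∑ v, η v := Finset.sum_le_sum_of_subset (Finset.subset_univ _)

variable {α : ℝ} {N : ℕ} {l d : ℝ} {η : Config L}

theorem testFn_of_mem_well (hN : 0 < N) (hd : d ≤ 1 / 2) (hld : l ≤ d * N) (hη : η ∈ well N l x) :
    testFn α N d x η = primGap α d := by
  have hcoord : 1 - d ≤ (coord x η : ℝ) / N := by
    rw [le_div_iff₀ (Nat.cast_pos.2 hN)]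
    have hx : (η x : ℝ) ≤ coord x η := Nat.cast_le.2 (le_coord x η)
    linarith [(mem_well.1 hη).2]
  rw [testFn, clip, min_eq_right hcoord, max_eq_right (by linarith), primGap]

theorem testFn_of_mem_well_of_ne (hN : 0 < N) (hld : 2 * l ≤ d * N) {z : ZMod L} (hzx : z ≠ x)
    (hη : η ∈ well N l z) : testFn α N d x η = 0 := by
  obtain ⟨hconf, hz⟩ := mem_well.1 hη
  have hpair : (η z : ℝ) + η x ≤ N := by
    rw [← mem_confs.1 hconf, ← Nat.cast_add, ← Finset.sum_pair hzx, Nat.cast_le]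
    exact Finset.sum_le_sum_of_subset (Finset.subset_univ _)
  have hcoord : (coord x η : ℝ) / N ≤ d := by
    rw [div_le_iff₀ (Nat.cast_pos.2 hN)]
    have htwo : (coord x η : ℝ) ≤ 2 * η x := by exact_mod_cast coord_le_two_mul x η
    linarith
  rw [testFn, clip, max_eq_left ((min_le_left _ _).trans hcoord), sub_self]

end TestFunction

/-! ### The gradients of the test functions -/

section Gradient

variable {L : ℕ} [NeZero L] {α : ℝ} {N : ℕ} {l d : ℝ} {x w : ZMod L} {ξ : Config L}

theorem rpow_add_one_le_two_rpow_mul_a (hα : 0 ≤ α) (n : ℕ) :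
    ((n : ℝ) + 1) ^ α ≤ 2 ^ α * a α n := by
  rcases Nat.eq_zero_or_pos n with rfl | hn
  · simpa [a] using Real.one_le_rpow one_le_two hα
  · rw [a_of_pos α hn, ← Real.mul_rpow two_pos.le n.cast_nonneg, two_mul]
    have : (1 : ℝ) ≤ n := Nat.one_le_cast.2 hn
    gcongr

theorem a_le_rpow (hα : 0 ≤ α) {n : ℕ} (hN : 1 ≤ N) (h : n ≤ N) : a α n ≤ (N : ℝ) ^ α := by
  unfold a
  split_ifs
  · exact Real.one_le_rpow (Nat.one_le_cast.2 hN) hα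
  · gcongr

theorem a_mono (hα : 0 ≤ α) : Monotone (a α) := by
  intro n m h
  rcases Nat.eq_zero_or_pos m with rfl | hm
  · rw [Nat.le_zero.1 h]
  · rw [a_of_pos α hm]
    exact a_le_rpow hα hm h

/-- The slope, along the direction of the jumps, of the profile `prim α (· / N)` in the tube between
`x` and `w`, written with `a` in place of the powers: `kern α (ξ x / N) / N` if all the particles
are on these two sites. -/
def slope (α : ℝ) (N : ℕ) (x w : ZMod L) (ξ : Config L) : ℝ :=
  a α (ξ x) * a α (ξ w) / (N * ((N : ℝ) ^ α) ^ 2)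

omit [NeZero L] in
theorem slope_nonneg (α : ℝ) (N : ℕ) (x w : ZMod L) (ξ : Config L) : 0 ≤ slope α N x w ξ :=
  div_nonneg (mul_nonneg (a_pos α _).le (a_pos α _).le) (by positivity)

theorem mul_slope_le_one (hα : 0 ≤ α) (hN : 1 ≤ N) (hξ : ξ ∈ confs L (N - 1)) :
    N * slope α N x w ξ ≤ 1 := by
  have hle : ∀ v, a α (ξ v) ≤ (N : ℝ) ^ α := fun v => a_le_rpow hα hN <|
    (Finset.single_le_sum (f := ξ) (fun _ _ => Nat.zero_le _) (Finset.mem_univ v)).trans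
      ((mem_confs.1 hξ).trans_le (Nat.sub_le N 1))
  have hNpos : (0 : ℝ) < N := Nat.cast_pos.2 hN
  rw [slope, ← mul_div_assoc, mul_div_mul_left _ _ hNpos.ne', div_le_one (by positivity), sq]
  exact mul_le_mul (hle x) (hle w) (a_pos α _).le (by positivity)

theorem div_slope_mul_sq_le (hα : 0 ≤ α) (hN : 1 ≤ N) (hξ : ξ ∈ confs L (N - 1)) {b c : ℝ}
    (h : |b| ≤ c * slope α N x w ξ) : N / slope α N x w ξ * b ^ 2 ≤ c ^ 2 := by
  have hNpos : (0 : ℝ) < N := Nat.cast_pos.2 hN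
  have hslope : 0 < slope α N x w ξ := div_pos (mul_pos (a_pos α _) (a_pos α _))
    (mul_pos hNpos (pow_pos (Real.rpow_pos_of_pos hNpos α) 2))
  calc N / slope α N x w ξ * b ^ 2 ≤ N / slope α N x w ξ * (c * slope α N x w ξ) ^ 2 := by
        rw [← sq_abs b]; gcongr
    _ = c ^ 2 * (N * slope α N x w ξ) := by field_simp
    _ ≤ c ^ 2 := mul_le_of_le_one_right (sq_nonneg c) (mul_slope_le_one hα hN hξ)

theorem size_clear_pair {n : ℕ} (hxw : x ≠ w) (hξ : ξ ∈ confs L n) :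
    size (clear {x, w} ξ) + (ξ x + ξ w) = n := by
  rw [← mem_confs.1 hξ, ← size_clear_add {x, w} ξ, Finset.sum_pair hxw]

theorem IsDominant.le_add_mul {n : ℕ} (hw : IsDominant x ξ w) (hξ : ξ ∈ confs L n) :
    n ≤ ξ x + L * ξ w := by
  rw [← mem_confs.1 hξ, ← Finset.add_sum_erase _ ξ (Finset.mem_univ x)]
  refine Nat.add_le_add_left ((Finset.sum_le_card_nsmul _ _ (ξ w) fun v hv =>
    hw.2 v (Finset.ne_of_mem_erase hv)).trans (Nat.mul_le_mul_right _ ?_)) _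
  exact (Finset.card_erase_le).trans_eq (by rw [Finset.card_univ, ZMod.card])

theorem coord_addAt_le (hL : 2 ≤ L) (hw : IsDominant x ξ w) (z : ZMod L) :
    coord x (addAt ξ z) ≤ ξ x + size (clear {x, w} ξ) + 1 := by
  have hsum := coord_add_domSite_le hL x (addAt ξ z)
  have hdom := (isDominant_domSite hL x (addAt ξ z)).2 w hw.1
  have hle := le_addAt ξ z w
  have hclear := size_clear_add {x, w} ξ
  rw [sum_addAt, if_pos (Finset.mem_univ z)] at hsum
  rw [Finset.sum_pair hw.1.symm] at hclear
  omega

theorem coord_addAt_div_mem_Icc (hL : 2 ≤ L) (hN : 1 ≤ N) (hξ : ξ ∈ confs L (N - 1)) (z : ZMod L) :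
    (coord x (addAt ξ z) : ℝ) / N ∈ Set.Icc 0 1 := by
  refine ⟨by positivity, (div_le_one (Nat.cast_pos.2 hN)).2 (Nat.cast_le.2 ?_)⟩
  have hsum := coord_add_domSite_le hL x (addAt ξ z)
  rw [sum_addAt, if_pos (Finset.mem_univ z), mem_confs.1 hξ] at hsum
  omega

theorem coord_addAt_div_le (x : ZMod L) (ξ : Config L) (z : ZMod L) :
    (coord x (addAt ξ z) : ℝ) / N ≤ 2 * ((ξ x : ℝ) + 1) / N := by
  have hcoord := coord_le_two_mul x (addAt ξ z)
  have hadd := addAt_le ξ z x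
  gcongr
  exact_mod_cast (by omega : coord x (addAt ξ z) ≤ 2 * (ξ x + 1))

theorem one_sub_coord_addAt_div_le (hN : 1 ≤ N) (hξ : ξ ∈ confs L (N - 1)) (hw : IsDominant x ξ w)
    (z : ZMod L) : 1 - (coord x (addAt ξ z) : ℝ) / N ≤ L * ((ξ w : ℝ) + 1) / N := by
  have hL : 1 ≤ L := Nat.one_le_iff_ne_zero.2 (NeZero.ne L)
  have hle := hw.le_add_mul hξ
  have hcoord := (le_addAt ξ z x).trans (le_coord x (addAt ξ z))
  rw [sub_le_iff_le_add, ← add_div, le_div_iff₀ (Nat.cast_pos.2 hN), one_mul]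
  exact_mod_cast (by rw [mul_add]; omega : N ≤ L * (ξ w + 1) + coord x (addAt ξ z))

theorem abs_coord_addAt_sub_le (hL : 2 ≤ L) (hw : IsDominant x ξ w) (z z' : ZMod L) :
    |(coord x (addAt ξ z) : ℝ) - coord x (addAt ξ z')| ≤ size (clear {x, w} ξ) + 3 := by
  have hbounds : ∀ y, (ξ x : ℝ) ≤ coord x (addAt ξ y) ∧
      (coord x (addAt ξ y) : ℝ) ≤ ξ x + size (clear {x, w} ξ) + 1 := fun y =>
    ⟨Nat.cast_le.2 ((le_addAt ξ y x).trans (le_coord _ _)),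
      by exact_mod_cast coord_addAt_le hL hw y⟩
  rw [abs_le]
  constructor <;> linarith [hbounds z, hbounds z']

omit [NeZero L] in
theorem rpow_mul_rpow_le_mul_a (hα : 0 ≤ α) (m n : ℕ) :
    (2 * ((m : ℝ) + 1) / N) ^ α * (L * ((n : ℝ) + 1) / N) ^ α ≤
      (8 * L) ^ α * (a α m * a α n) / ((N : ℝ) ^ α) ^ 2 := by
  have hN := N.cast_nonneg (α := ℝ)
  have hL := L.cast_nonneg (α := ℝ)
  have hconst : ((8 : ℝ) * L) ^ α = 2 ^ α * L ^ α * (2 ^ α * 2 ^ α) := by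
    rw [← Real.mul_rpow two_pos.le hL, ← Real.mul_rpow two_pos.le two_pos.le,
      ← Real.mul_rpow (by positivity) (by positivity)]
    congr 1; ring
  rw [Real.div_rpow (by positivity) hN, Real.div_rpow (by positivity) hN, div_mul_div_comm, ← sq,
    Real.mul_rpow two_pos.le (by positivity), Real.mul_rpow hL (by positivity), hconst]
  refine div_le_div_of_nonneg_right ?_ (by positivity)
  calc 2 ^ α * ((m : ℝ) + 1) ^ α * (L ^ α * ((n : ℝ) + 1) ^ α)
      = 2 ^ α * L ^ α * (((m : ℝ) + 1) ^ α * ((n : ℝ) + 1) ^ α) := by ring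
    _ ≤ 2 ^ α * L ^ α * (2 ^ α * a α m * (2 ^ α * a α n)) := by
        have := (a_pos α m).le
        gcongr <;> exact rpow_add_one_le_two_rpow_mul_a hα _
    _ = 2 ^ α * L ^ α * (2 ^ α * 2 ^ α) * (a α m * a α n) := by ring

theorem abs_testFn_sub_le (hL : 2 ≤ L) (hα : 0 < α) (hN : 1 ≤ N) (hξ : ξ ∈ confs L (N - 1))
    (hw : IsDominant x ξ w) (d : ℝ) (z z' : ZMod L) :
    |testFn α N d x (addAt ξ z) - testFn α N d x (addAt ξ z')| ≤
      (8 * L) ^ α * (size (clear {x, w} ξ) + 3) * slope α N x w ξ := by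
  have hNpos : (0 : ℝ) < N := Nat.cast_pos.2 hN
  have hprim := abs_prim_clip_sub_le hα d (coord_addAt_div_mem_Icc hL hN hξ z')
    (coord_addAt_div_mem_Icc hL hN hξ z)
    (max_le (coord_addAt_div_le x ξ z') (coord_addAt_div_le x ξ z))
    (sub_le_comm.1 (le_min (sub_le_comm.1 (one_sub_coord_addAt_div_le hN hξ hw z'))
      (sub_le_comm.1 (one_sub_coord_addAt_div_le hN hξ hw z))))
  rw [testFn, testFn, sub_sub_sub_cancel_right]
  calc |prim α (clip d (coord x (addAt ξ z) / N)) - prim α (clip d (coord x (addAt ξ z') / N))|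
      ≤ |(coord x (addAt ξ z) : ℝ) / N - coord x (addAt ξ z') / N| *
        ((2 * ((ξ x : ℝ) + 1) / N) ^ α * (L * ((ξ w : ℝ) + 1) / N) ^ α) := hprim
    _ ≤ (size (clear {x, w} ξ) + 3) / N *
        ((8 * L) ^ α * (a α (ξ x) * a α (ξ w)) / ((N : ℝ) ^ α) ^ 2) := by
        rw [← sub_div, abs_div, abs_of_pos hNpos]
        gcongr
        · exact abs_coord_addAt_sub_le hL hw z z'
        · exact rpow_mul_rpow_le_mul_a hα.le _ _
    _ = (8 * L) ^ α * (size (clear {x, w} ξ) + 3) * slope α N x w ξ := by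
        rw [slope]; field_simp

/-- The flow from `x` to `w`: the slope inside the tube of the configurations with at most `l`
particles off `x` and `w`. -/
def tubeFlow (α : ℝ) (N : ℕ) (l : ℝ) (x w : ZMod L) (ξ : Config L) : ℝ :=
  if (size (clear {x, w} ξ) : ℝ) ≤ l then slope α N x w ξ else 0

/-- The approximate value of `testFn` at `addAt ξ z`, relatively to its value at
`addAt ξ (x - 1)`: the sum of the flows which pass through `z`. -/
def flow (α : ℝ) (N : ℕ) (l : ℝ) (x : ZMod L) (ξ : Config L) (z : ZMod L) : ℝ :=
  ∑ w ∈ Finset.univ.erase x, if z ∈ arc x w then tubeFlow α N l x w ξ else 0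

/-- The gradient of the test function, based at `x - 1`. -/
def testGrad (α : ℝ) (N : ℕ) (d : ℝ) (x : ZMod L) (ξ : Config L) (z : ZMod L) : ℝ :=
  testFn α N d x (addAt ξ z) - testFn α N d x (addAt ξ (x - 1))

theorem tubeFlow_nonneg (α : ℝ) (N : ℕ) (l : ℝ) (x w : ZMod L) (ξ : Config L) :
    0 ≤ tubeFlow α N l x w ξ := by
  unfold tubeFlow
  split_ifs
  exacts [slope_nonneg α N x w ξ, le_rfl]

theorem tubeFlow_le_slope (hα : 0 ≤ α) (hw : IsDominant x ξ w) {v : ZMod L} (hv : v ≠ x) :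
    tubeFlow α N l x v ξ ≤ slope α N x w ξ := by
  unfold tubeFlow
  split_ifs
  · have := a_mono hα (hw.2 v hv)
    have := (a_pos α (ξ x)).le
    unfold slope
    gcongr
  · exact slope_nonneg α N x w ξ

theorem abs_flow_le (hα : 0 ≤ α) (hw : IsDominant x ξ w) (N : ℕ) (l : ℝ) (z : ZMod L) :
    |flow α N l x ξ z| ≤ L * slope α N x w ξ := by
  have hterm : ∀ v ∈ Finset.univ.erase x,
      ‖if z ∈ arc x v then tubeFlow α N l x v ξ else 0‖ ≤ slope α N x w ξ := by
    intro v hv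
    split_ifs
    · rw [Real.norm_of_nonneg (tubeFlow_nonneg α N l x v ξ)]
      exact tubeFlow_le_slope hα hw (Finset.ne_of_mem_erase hv)
    · simpa using slope_nonneg α N x w ξ
  refine (norm_sum_le_of_le _ hterm).trans ?_
  rw [Finset.sum_const, nsmul_eq_mul]
  gcongr
  · exact slope_nonneg α N x w ξ
  · exact Finset.card_erase_le.trans_eq (by rw [Finset.card_univ, ZMod.card])

theorem div_slope_mul_testGrad_sq_le (hL : 2 ≤ L) (hα : 0 < α) (hN : 1 ≤ N)
    (hξ : ξ ∈ confs L (N - 1)) (hw : IsDominant x ξ w) (d : ℝ) (z : ZMod L) :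
    N / slope α N x w ξ * testGrad α N d x ξ z ^ 2 ≤
      9 * ((8 * L : ℝ) ^ α) ^ 2 * momentBound (clear {x, w} ξ) :=
  calc N / slope α N x w ξ * testGrad α N d x ξ z ^ 2
      ≤ ((8 * L : ℝ) ^ α * (size (clear {x, w} ξ) + 3)) ^ 2 :=
        div_slope_mul_sq_le hα.le hN hξ (abs_testFn_sub_le hL hα hN hξ hw d z (x - 1))
    _ = ((8 * L : ℝ) ^ α) ^ 2 * (size (clear {x, w} ξ) + 3) ^ 2 := mul_pow _ _ _
    _ ≤ ((8 * L : ℝ) ^ α) ^ 2 * (9 * momentBound (clear {x, w} ξ)) := by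
        gcongr; exact size_add_three_sq_le_momentBound _
    _ = 9 * ((8 * L : ℝ) ^ α) ^ 2 * momentBound (clear {x, w} ξ) := by ring

theorem div_slope_mul_testGrad_sub_flow_sq_le (hL : 2 ≤ L) (hα : 0 < α) (hN : 1 ≤ N)
    (hξ : ξ ∈ confs L (N - 1)) (hw : IsDominant x ξ w) (l d : ℝ) (z : ZMod L) :
    N / slope α N x w ξ * (testGrad α N d x ξ z - flow α N l x ξ z) ^ 2 ≤
      (18 * ((8 * L : ℝ) ^ α) ^ 2 + 2 * L ^ 2) * momentBound (clear {x, w} ξ) := by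
  have hgrad := div_slope_mul_testGrad_sq_le hL hα hN hξ hw d z
  have hflow := div_slope_mul_sq_le hα.le hN hξ (abs_flow_le hα.le hw N l z)
  have hmoment : (L : ℝ) ^ 2 ≤ L ^ 2 * momentBound (clear {x, w} ξ) :=
    le_mul_of_one_le_right (sq_nonneg _) (one_le_momentBound _)
  have hsplit : N / slope α N x w ξ * (testGrad α N d x ξ z - flow α N l x ξ z) ^ 2 ≤
      N / slope α N x w ξ * (2 * (testGrad α N d x ξ z ^ 2 + (-flow α N l x ξ z) ^ 2)) := by
    have := slope_nonneg α N x w ξ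
    rw [sub_eq_add_neg]
    gcongr
    exact add_sq_le
  rw [neg_sq] at hsplit
  linarith

end Gradient

/-! ### The error in the tubes -/

section Tube

variable {L : ℕ} [NeZero L] {α : ℝ} {N : ℕ} {l d : ℝ} {x w : ZMod L} {ξ : Config L}

theorem sum_le_size_clear {A S : Finset (ZMod L)} (h : Disjoint S A) (ξ : Config L) :
    ∑ v ∈ S, ξ v ≤ size (clear A ξ) :=
  calc ∑ v ∈ S, ξ v = ∑ v ∈ S, clear A ξ v := Finset.sum_congr rfl fun _ hv => by
        rw [clear, if_neg (Finset.disjoint_left.1 h hv)]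
    _ ≤ size (clear A ξ) := Finset.sum_le_sum_of_subset (Finset.subset_univ S)

theorem apply_le_size_clear {A : Finset (ZMod L)} {v : ZMod L} (hv : v ∉ A) (ξ : Config L) :
    ξ v ≤ size (clear A ξ) := by
  simpa only [Finset.sum_singleton] using
    sum_le_size_clear (Finset.disjoint_singleton_left.2 hv) ξ

theorem apply_le_sum_arc (hxw : x ≠ w) (ξ : Config L) : ξ x ≤ ∑ v ∈ arc x w, ξ v :=
  Finset.single_le_sum (f := ξ) (fun _ _ => Nat.zero_le _) (left_mem_arc hxw.symm)

theorem sum_arc_le (hxw : x ≠ w) (ξ : Config L) :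
    ∑ v ∈ arc x w, ξ v ≤ ξ x + size (clear {x, w} ξ) := by
  rw [← Finset.add_sum_erase _ ξ (left_mem_arc hxw.symm)]
  refine Nat.add_le_add_left (sum_le_size_clear ?_ ξ) _
  rw [Finset.disjoint_insert_right, Finset.disjoint_singleton_right]
  exact ⟨Finset.notMem_erase x _, fun h => right_notMem_arc x w (Finset.mem_of_mem_erase h)⟩

/-- `ξ` lies in the tube between `x` and `w`, away from its ends: at most `l` particles are off
these two sites, and each of the two sites carries much more than that. -/
structure InTube (l : ℝ) (x w : ZMod L) (ξ : Config L) : Prop where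
  ne : x ≠ w
  size_le : (size (clear {x, w} ξ) : ℝ) ≤ l
  left : 2 * l + 2 ≤ ξ x
  right : 2 * l + 2 ≤ ξ w

namespace InTube

theorem nonneg (h : InTube l x w ξ) : 0 ≤ l := (Nat.cast_nonneg _).trans h.size_le

theorem size_add_two_le_left (h : InTube l x w ξ) : size (clear {x, w} ξ) + 2 ≤ ξ x := by
  exact_mod_cast (by linarith [h.size_le, h.left, h.nonneg] :
    (size (clear {x, w} ξ) : ℝ) + 2 ≤ ξ x)

theorem size_add_two_le_right (h : InTube l x w ξ) : size (clear {x, w} ξ) + 2 ≤ ξ w := by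
  exact_mod_cast (by linarith [h.size_le, h.right, h.nonneg] :
    (size (clear {x, w} ξ) : ℝ) + 2 ≤ ξ w)

theorem domSite_addAt (hL : 2 ≤ L) (h : InTube l x w ξ) (z : ZMod L) :
    domSite x (addAt ξ z) = w := by
  by_contra hne
  obtain ⟨hx, hmax⟩ := isDominant_domSite hL x (addAt ξ z)
  have hle := hmax w h.ne.symm
  have hdom := addAt_le ξ z (domSite x (addAt ξ z))
  have hw := le_addAt ξ z w
  have hoff := apply_le_size_clear (A := {x, w}) (v := domSite x (addAt ξ z))
    (by simp [hx, hne]) ξ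
  have hsize := h.size_add_two_le_right
  omega

theorem coord_addAt (hL : 2 ≤ L) (h : InTube l x w ξ) (z : ZMod L) :
    coord x (addAt ξ z) = ∑ v ∈ arc x w, ξ v + if z ∈ arc x w then 1 else 0 := by
  have hcap : ∑ v ∈ (arc x w).erase x, addAt ξ z v ≤ addAt ξ z x := by
    have hsum := sum_addAt ξ z ((arc x w).erase x)
    have harc := sum_arc_le h.ne ξ
    rw [← Finset.add_sum_erase _ ξ (left_mem_arc h.ne.symm)] at harc
    have hx := le_addAt ξ z x
    have hsize := h.size_add_two_le_left
    split_ifs at hsum <;> omega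
  rw [coord, h.domSite_addAt hL, min_eq_right hcap,
    Finset.add_sum_erase _ (addAt ξ z) (left_mem_arc h.ne.symm), sum_addAt]

theorem clip_eq (h : InTube l x w ξ) (hN : 1 ≤ N) (hξ : ξ ∈ confs L (N - 1)) (hd : d * N ≤ 2 * l)
    {t : ℝ} (ht : ((∑ v ∈ arc x w, ξ v : ℕ) : ℝ) ≤ t) (ht' : t ≤ (∑ v ∈ arc x w, ξ v : ℕ) + 1) :
    clip d (t / N) = t / N := by
  have hN0 : (0 : ℝ) < N := Nat.cast_pos.2 hN
  have hsize := size_clear_pair h.ne hξ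
  have harc := sum_arc_le h.ne ξ
  have hlo : (ξ x : ℝ) ≤ (∑ v ∈ arc x w, ξ v : ℕ) := Nat.cast_le.2 (apply_le_sum_arc h.ne ξ)
  have hhi : ((∑ v ∈ arc x w, ξ v : ℕ) : ℝ) + ξ w + 1 ≤ N := by exact_mod_cast (by omega)
  have hright : t / N ≤ 1 - d := by
    rw [div_le_iff₀ hN0]
    linarith [h.right]
  have hleft : d ≤ t / N := by
    rw [le_div_iff₀ hN0]
    linarith [h.left]
  rw [clip, min_eq_left hright, max_eq_right hleft]

theorem testGrad_eq (hL : 2 ≤ L) (hα : 0 < α) (h : InTube l x w ξ) (hN : 1 ≤ N)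
    (hξ : ξ ∈ confs L (N - 1)) (hd : d * N ≤ 2 * l) (z : ZMod L) :
    testGrad α N d x ξ z =
      if z ∈ arc x w then
        ∫ r in ((∑ v ∈ arc x w, ξ v : ℕ) / N : ℝ)..(((∑ v ∈ arc x w, ξ v : ℕ) + 1) / N), kern α r
      else 0 := by
  have hbase := h.clip_eq hN hξ hd le_rfl (by linarith)
  rw [testGrad, testFn, testFn, sub_sub_sub_cancel_right, h.coord_addAt hL, h.coord_addAt hL,
    if_neg (left_sub_one_notMem_arc x w), add_zero, hbase]
  split_ifs
  · rw [Nat.cast_add, Nat.cast_one, h.clip_eq hN hξ hd (by linarith) le_rfl, prim_sub hα]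
  · rw [add_zero, hbase, sub_self]

theorem flow_eq (h : InTube l x w ξ) (α : ℝ) (N : ℕ) (z : ZMod L) :
    flow α N l x ξ z = if z ∈ arc x w then slope α N x w ξ else 0 := by
  rw [flow, Finset.sum_eq_single_of_mem w (Finset.mem_erase.2 ⟨h.ne.symm, Finset.mem_univ w⟩),
    tubeFlow, if_pos h.size_le]
  intro v _ hvw
  have hoff : (ξ w : ℝ) ≤ size (clear {x, v} ξ) :=
    Nat.cast_le.2 (apply_le_size_clear (by simp [h.ne.symm, hvw.symm]) ξ)
  have hl : ¬ (size (clear {x, v} ξ) : ℝ) ≤ l := by linarith [h.right, h.nonneg]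
  rw [tubeFlow, if_neg hl, ite_self]

theorem mul_slope_eq (h : InTube l x w ξ) (α : ℝ) (hN : 1 ≤ N) :
    N * slope α N x w ξ = ((ξ x : ℝ) / N) ^ α * ((ξ w : ℝ) / N) ^ α := by
  have hN0 : (0 : ℝ) < N := Nat.cast_pos.2 hN
  have hx := h.size_add_two_le_left
  have hw := h.size_add_two_le_right
  rw [slope, a_of_pos α (by omega), a_of_pos α (by omega),
    Real.div_rpow (Nat.cast_nonneg _) hN0.le, Real.div_rpow (Nat.cast_nonneg _) hN0.le,
    div_mul_div_comm, ← sq, ← mul_div_assoc, mul_div_mul_left _ _ hN0.ne']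

theorem abs_kern_sub_le (hα : 1 ≤ α) (h : InTube l x w ξ) (hN : 1 ≤ N)
    (hξ : ξ ∈ confs L (N - 1)) {r : ℝ} (hr : ((∑ v ∈ arc x w, ξ v : ℕ) / N : ℝ) ≤ r)
    (hr' : r ≤ ((∑ v ∈ arc x w, ξ v : ℕ) + 1) / N) :
    |kern α r - N * slope α N x w ξ| ≤ 2 * α * (size (clear {x, w} ξ) + 1) / N := by
  have hN0 : (0 : ℝ) < N := Nat.cast_pos.2 hN
  set p : ℝ := ξ x / N
  set q : ℝ := ξ w / N
  set δ : ℝ := (size (clear {x, w} ξ) + 1) / N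
  have hp : 0 ≤ p := by positivity
  have hq : 0 ≤ q := by positivity
  have hδ : 0 ≤ δ := by positivity
  have hsum : p + q + δ = 1 := by
    have hsize := size_clear_pair h.ne hξ
    have hcast : (ξ x : ℝ) + ξ w + (size (clear {x, w} ξ) + 1) = N := by
      exact_mod_cast (by omega)
    rw [← add_div, ← add_div, hcast, div_self hN0.ne']
  have hpr : p ≤ r :=
    (div_le_div_of_nonneg_right (Nat.cast_le.2 (apply_le_sum_arc h.ne ξ)) hN0.le).trans hr
  have hrp : r ≤ p + δ := by
    refine hr'.trans ?_
    rw [← add_div, ← add_assoc]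
    gcongr
    exact_mod_cast sum_arc_le h.ne ξ
  rw [h.mul_slope_eq α hN, kern]
  calc |r ^ α * (1 - r) ^ α - p ^ α * q ^ α| ≤ α * (|r - p| + |1 - r - q|) :=
        abs_rpow_mul_rpow_sub_le hα ⟨by linarith, by linarith⟩ ⟨by linarith, by linarith⟩
          ⟨hp, by linarith⟩ ⟨hq, by linarith⟩
    _ ≤ α * (δ + δ) := by
        gcongr <;> rw [abs_le] <;> constructor <;> linarith
    _ = 2 * α * (size (clear {x, w} ξ) + 1) / N := by ring

theorem abs_testGrad_sub_flow_le (hL : 2 ≤ L) (hα : 1 ≤ α) (h : InTube l x w ξ) (hN : 1 ≤ N)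
    (hξ : ξ ∈ confs L (N - 1)) (hd : d * N ≤ 2 * l) (z : ZMod L) :
    |testGrad α N d x ξ z - flow α N l x ξ z| ≤
      2 * α * (size (clear {x, w} ξ) + 1) / N ^ 2 := by
  have hα0 : 0 < α := by linarith
  have : (0 : ℝ) < N := Nat.cast_pos.2 hN
  rw [h.testGrad_eq hL hα0 hN hξ hd, h.flow_eq]
  split_ifs
  swap
  · rw [sub_self, abs_zero]
    positivity
  set m : ℝ := ((∑ v ∈ arc x w, ξ v : ℕ) : ℝ)
  have hlen : (m + 1) / N - m / N = 1 / N := by ring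
  have hle : m / N ≤ (m + 1) / N := by gcongr; linarith
  have hslope : slope α N x w ξ = ∫ _ in (m / N)..((m + 1) / N), N * slope α N x w ξ := by
    rw [intervalIntegral.integral_const, hlen, smul_eq_mul]
    field_simp
  rw [hslope, ← intervalIntegral.integral_sub ((continuous_kern hα0).intervalIntegrable _ _)
    (intervalIntegrable_const (c := N * slope α N x w ξ))]
  rw [← Real.norm_eq_abs]
  refine (intervalIntegral.norm_integral_le_of_norm_le_const
    (C := 2 * α * (size (clear {x, w} ξ) + 1) / N) fun r hr => ?_).trans_eq ?_
  · rw [Set.uIoc_of_le hle] at hr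
    exact h.abs_kern_sub_le hα hN hξ hr.1.le hr.2
  · rw [hlen, abs_of_nonneg (by positivity)]
    field_simp

theorem div_slope_mul_testGrad_sub_flow_sq_le (hL : 2 ≤ L) (hα : 1 ≤ α) (h : InTube l x w ξ)
    (hN : 1 ≤ N) (hξ : ξ ∈ confs L (N - 1)) (hd : d * N ≤ 2 * l) {ε : ℝ} (hε : 0 < ε)
    (hx : ε * N ≤ ξ x) (hw : ε * N ≤ ξ w) (z : ZMod L) :
    N / slope α N x w ξ * (testGrad α N d x ξ z - flow α N l x ξ z) ^ 2 ≤
      (2 * α * (size (clear {x, w} ξ) + 1) / ε ^ α) ^ 2 / N ^ 2 := by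
  have hN0 : (0 : ℝ) < N := Nat.cast_pos.2 hN
  have hslope : (ε ^ α) ^ 2 ≤ N * slope α N x w ξ := by
    rw [h.mul_slope_eq α hN, sq]
    gcongr <;> rwa [le_div_iff₀ hN0]
  calc N / slope α N x w ξ * (testGrad α N d x ξ z - flow α N l x ξ z) ^ 2
      = N ^ 2 / (N * slope α N x w ξ) * |testGrad α N d x ξ z - flow α N l x ξ z| ^ 2 := by
        rw [sq_abs, sq (N : ℝ), mul_div_mul_left _ _ hN0.ne']
    _ ≤ N ^ 2 / (ε ^ α) ^ 2 * (2 * α * (size (clear {x, w} ξ) + 1) / N ^ 2) ^ 2 := by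
        gcongr
        exact h.abs_testGrad_sub_flow_le hL hα hN hξ hd z
    _ = (2 * α * (size (clear {x, w} ξ) + 1) / ε ^ α) ^ 2 / N ^ 2 := by field_simp

end InTube

end Tube

/-! ### The norm of the gradients -/

section Norm

variable {L : ℕ} [NeZero L] {α : ℝ} {N : ℕ} {x w : ZMod L} {ξ : Config L}
  {φ : Config L → ZMod L → ℝ}

/-- The squared norm of a field `φ` on the pairs (configuration of `n` particles, site), with the
weights of the configurations. -/
def sqNorm (α : ℝ) (n : ℕ) (φ : Config L → ZMod L → ℝ) : ℝ :=
  ∑ ξ ∈ confs L n, weight α ξ * ∑ z, φ ξ z ^ 2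

theorem sqNorm_nonneg (α : ℝ) (n : ℕ) (φ : Config L → ZMod L → ℝ) : 0 ≤ sqNorm α n φ :=
  Finset.sum_nonneg fun ξ _ => mul_nonneg (weight_pos α ξ).le
    (Finset.sum_nonneg fun _ _ => sq_nonneg _)

open Classical in
/-- The contribution of `ξ` to the rescaled norm of `φ`, counted in the tube between `x` and `w` if
`w` is dominant. The factor trades the weights of `ξ x` and `ξ w` for `1 / N`. -/
def domSq (α : ℝ) (N : ℕ) (x w : ZMod L) (φ : Config L → ZMod L → ℝ) (ξ : Config L) : ℝ :=
  if IsDominant x ξ w then N / slope α N x w ξ * ∑ z, φ ξ z ^ 2 else 0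

theorem domSq_nonneg (α : ℝ) (N : ℕ) (x w : ZMod L) (φ : Config L → ZMod L → ℝ) (ξ : Config L) :
    0 ≤ domSq α N x w φ ξ := by
  unfold domSq
  split_ifs
  · exact mul_nonneg (div_nonneg N.cast_nonneg (slope_nonneg α N x w ξ))
      (Finset.sum_nonneg fun _ _ => sq_nonneg _)
  · exact le_rfl

theorem domSq_le {C : ℝ} (hC : 0 ≤ C)
    (h : IsDominant x ξ w → ∀ z, N / slope α N x w ξ * φ ξ z ^ 2 ≤ C) :
    domSq α N x w φ ξ ≤ L * C := by
  unfold domSq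
  split_ifs with hdom
  · rw [Finset.mul_sum]
    refine (Finset.sum_le_card_nsmul _ _ _ fun z _ => h hdom z).trans_eq ?_
    rw [Finset.card_univ, ZMod.card, nsmul_eq_mul]
  · positivity

theorem mul_sqNorm_le (hL : 2 ≤ L) (hN : 1 ≤ N) (α : ℝ) (x : ZMod L)
    (φ : Config L → ZMod L → ℝ) :
    N * ((N : ℝ) ^ α) ^ 2 * sqNorm α (N - 1) φ ≤
      ∑ w ∈ Finset.univ.erase x, 1 / (N : ℝ) * ∑ ξ ∈ confs L (N - 1),
        bgWeight α {x, w} (clear {x, w} ξ) * domSq α N x w φ ξ := by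
  classical
  have : (0 : ℝ) < N := Nat.cast_pos.2 hN
  have hcover := sum_le_sum_filter_cover (W := Finset.univ.erase x) (S := confs L (N - 1))
    (f := fun ξ => weight α ξ * ∑ z, φ ξ z ^ 2)
    (fun ξ _ => mul_nonneg (weight_pos α ξ).le (Finset.sum_nonneg fun _ _ => sq_nonneg _))
    (fun w ξ => IsDominant x ξ w) fun ξ _ =>
      (exists_isDominant hL x ξ).imp fun w hw => ⟨Finset.mem_erase.2 ⟨hw.1, Finset.mem_univ w⟩, hw⟩
  refine (mul_le_mul_of_nonneg_left hcover (by positivity)).trans_eq ?_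
  rw [Finset.mul_sum]
  refine Finset.sum_congr rfl fun w hw => ?_
  rw [Finset.sum_filter, Finset.mul_sum, Finset.mul_sum]
  refine Finset.sum_congr rfl fun ξ _ => ?_
  unfold domSq
  split_ifs
  · have hax := a_pos α (ξ x)
    have haw := a_pos α (ξ w)
    rw [weight_eq_mul_bgWeight α {x, w}, Finset.prod_pair (Finset.ne_of_mem_erase hw).symm, slope]
    field_simp
  · rw [mul_zero, mul_zero, mul_zero]

theorem exists_mul_sqNorm_testGrad_le (hL : 2 ≤ L) (hα : 3 < α) (x : ZMod L) :
    ∃ C : ℝ, ∀ (N : ℕ) (d : ℝ), 1 ≤ N →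
      N * ((N : ℝ) ^ α) ^ 2 * sqNorm α (N - 1) (testGrad α N d x) ≤ C := by
  refine ⟨∑ w ∈ Finset.univ.erase x, ∑' ζ : Config L, bgWeight α {x, w} ζ *
    (L * (9 * ((8 * L : ℝ) ^ α) ^ 2 * momentBound ζ)), fun N d hN => ?_⟩
  have hnonneg : ∀ ζ : Config L, 0 ≤ 9 * ((8 * L : ℝ) ^ α) ^ 2 * momentBound ζ := fun ζ =>
    mul_nonneg (by positivity) (zero_le_one.trans (one_le_momentBound ζ))
  refine (mul_sqNorm_le hL hN α x _).trans (Finset.sum_le_sum fun w hw => ?_)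
  rw [one_div, inv_mul_le_iff₀ (Nat.cast_pos.2 hN)]
  refine sum_bgWeight_pair_le hN (Finset.ne_of_mem_erase hw).symm ?_
    (fun ζ => mul_nonneg L.cast_nonneg (hnonneg ζ)) fun ξ hξ => domSq_le (hnonneg _) fun hdom z =>
      div_slope_mul_testGrad_sq_le hL (by linarith) hN hξ hdom d z
  refine ((summable_bgWeight_mul_momentBound hα {x, w}).mul_left
    (L * (9 * ((8 * L : ℝ) ^ α) ^ 2))).congr fun ζ => ?_
  ring

variable {ℓ : ℕ → ℝ}

theorem eventually_inTube (hℓ : Tendsto ℓ atTop atTop)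
    (hℓN : Tendsto (fun N : ℕ => ℓ N / (N : ℝ)) atTop (𝓝 0)) (hxw : x ≠ w) (ζ : Config L) {ε : ℝ}
    (hε : 0 < ε) : ∀ᶠ N : ℕ in atTop, ∀ ξ : Config L, clear {x, w} ξ = ζ → ε * N ≤ ξ x →
      ε * N ≤ ξ w → InTube (ℓ N) x w ξ := by
  filter_upwards [hℓ.eventually_ge_atTop (size ζ : ℝ), hℓ.eventually_ge_atTop 2,
    eventually_mul_lt hℓN (3 / ε)] with N hsize htwo hlt ξ hζ hx hw
  have hlow : 2 * ℓ N + 2 ≤ ε * N := by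
    rw [div_mul_eq_mul_div, div_lt_iff₀ hε] at hlt
    linarith
  exact ⟨hxw, by rwa [hζ], hlow.trans hx, hlow.trans hw⟩

theorem tendsto_sum_bgWeight_mul_domSq (hL : 2 ≤ L) (hα : 3 < α) (hℓ : Tendsto ℓ atTop atTop)
    (hℓN : Tendsto (fun N : ℕ => ℓ N / (N : ℝ)) atTop (𝓝 0)) (hxw : x ≠ w) :
    Tendsto (fun N : ℕ => 1 / (N : ℝ) * ∑ ξ ∈ confs L (N - 1),
      bgWeight α {x, w} (clear {x, w} ξ) * domSq α N x w
        (testGrad α N (2 * (ℓ N / N)) x - flow α N (ℓ N) x) ξ) atTop (𝓝 0) := by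
  set C : ℝ := 18 * ((8 * L : ℝ) ^ α) ^ 2 + 2 * L ^ 2
  have hnonneg : ∀ ζ : Config L, 0 ≤ C * momentBound ζ := fun ζ =>
    mul_nonneg (by positivity) (zero_le_one.trans (one_le_momentBound ζ))
  refine tendsto_sum_bgWeight_pair_zero hxw (B := fun ζ => L * (C * momentBound ζ)) ?_
    (fun ζ => mul_nonneg L.cast_nonneg (hnonneg ζ)) (fun N ξ => domSq_nonneg _ _ _ _ _ _) ?_ ?_
  · refine ((summable_bgWeight_mul_momentBound hα {x, w}).mul_left (L * C)).congr fun ζ => ?_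
    ring
  · filter_upwards [eventually_ge_atTop 1] with N hN ξ hξ
    exact domSq_le (hnonneg _) fun hdom z =>
      div_slope_mul_testGrad_sub_flow_sq_le hL (by linarith) hN hξ hdom _ _ z
  · intro ζ ε hε
    have hlim : Tendsto (fun N : ℕ => L * ((2 * α * (size ζ + 1) / ε ^ α) ^ 2 / (N : ℝ) ^ 2))
        atTop (𝓝 0) := by
      have hsq : Tendsto (fun N : ℕ => (N : ℝ) ^ 2) atTop atTop :=
        (tendsto_pow_atTop two_ne_zero).comp tendsto_natCast_atTop_atTop
      simpa only [mul_zero] using (tendsto_const_nhds.div_atTop hsq).const_mul (L : ℝ)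
    filter_upwards [hlim.eventually_lt_const hε, eventually_inTube hℓ hℓN hxw ζ hε,
      eventually_ge_atTop 1] with N hsmall htube hN ξ hξ hζ hx hw
    refine (domSq_le (by positivity) fun _ z => ?_).trans hsmall.le
    have hd : 2 * (ℓ N / N) * N ≤ 2 * ℓ N := by
      rw [mul_assoc, div_mul_cancel₀ _ (Nat.cast_ne_zero.2 (by omega))]
    rw [← hζ]
    exact (htube ξ hζ hx hw).div_slope_mul_testGrad_sub_flow_sq_le hL (by linarith) hN hξ hd hε
      hx hw z

theorem tendsto_mul_sqNorm_testGrad_sub_flow (hL : 2 ≤ L) (hα : 3 < α)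
    (hℓ : Tendsto ℓ atTop atTop) (hℓN : Tendsto (fun N : ℕ => ℓ N / (N : ℝ)) atTop (𝓝 0))
    (x : ZMod L) :
    Tendsto (fun N : ℕ => N * ((N : ℝ) ^ α) ^ 2 *
      sqNorm α (N - 1) (testGrad α N (2 * (ℓ N / N)) x - flow α N (ℓ N) x)) atTop (𝓝 0) := by
  have htubes := tendsto_finsetSum (Finset.univ.erase x) fun w hw =>
    tendsto_sum_bgWeight_mul_domSq hL hα hℓ hℓN (Finset.ne_of_mem_erase hw).symm
  rw [Finset.sum_const_zero] at htubes
  refine squeeze_zero' (Eventually.of_forall fun N =>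
    mul_nonneg (by positivity) (sqNorm_nonneg _ _ _)) ?_ htubes
  filter_upwards [eventually_ge_atTop 1] with N hN
  exact mul_sqNorm_le hL hN α x _

end Norm

/-! ### Functions which are constant on the wells -/

section WellValues

variable {L : ℕ} [NeZero L] {α : ℝ} {N : ℕ} {l d : ℝ} {x w : ZMod L} {c : ZMod L → ℝ}
  {u u' h : Config L → ℝ}

/-- The function `u` is equal to `c z` on the well at `z`, for each site `z`. -/
def HasWellValues (N : ℕ) (l : ℝ) (c : ZMod L → ℝ) (u : Config L → ℝ) : Prop :=
  ∀ z, ∀ η ∈ well N l z, u η = c z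

theorem HasWellValues.eq_on_wells (hu : HasWellValues N l c u) (hu' : HasWellValues N l c u') :
    ∀ η ∈ wells N l Finset.univ, u η = u' η := fun η hη => by
  obtain ⟨z, -, hz⟩ := mem_wells.1 hη
  rw [hu z η hz, hu' z η hz]

theorem IsPotential.hasWellValues (hh : IsPotential α N l w h) :
    HasWellValues N l (Pi.single w 1) h := fun z η hη => by
  by_cases hzw : z = w
  · subst hzw
    rw [hh.one η hη, Pi.single_eq_same]
  · rw [hh.zero z hzw η hη, Pi.single_eq_of_ne hzw]

theorem testFn_eq_smul_on_wells (hN : 0 < N) (hl : 0 ≤ l) (hd : d ≤ 1 / 2) (hld : 2 * l ≤ d * N)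
    (x : ZMod L) (hu : HasWellValues N l (Pi.single x 1) u) :
    ∀ η ∈ wells N l Finset.univ, testFn α N d x η = (primGap α d • u) η := fun η hη => by
  obtain ⟨z, -, hz⟩ := mem_wells.1 hη
  rw [Pi.smul_apply, smul_eq_mul, hu z η hz]
  by_cases hzx : z = x
  · subst hzx
    rw [testFn_of_mem_well hN hd (by linarith) hz, Pi.single_eq_same, mul_one]
  · rw [testFn_of_mem_well_of_ne hN hld hzx hz, Pi.single_eq_of_ne hzx, mul_zero]

theorem coefMu_pos (α : ℝ) (hN : 1 ≤ N) : 0 < coefMu L α N := by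
  have hpow : (0 : ℝ) < (N : ℝ) ^ α := Real.rpow_pos_of_pos (Nat.cast_pos.2 hN) α
  have hne : (confs L N).Nonempty := ⟨Pi.single 0 N, by simp [mem_confs]⟩
  exact div_pos hpow (mul_pos hpow (Finset.sum_pos (fun η _ => weight_pos α η) hne))

theorem IsPotential.genForm_congr (hL : 2 ≤ L) (hN : 1 ≤ N) (hh : IsPotential α N l w h)
    (huu : ∀ η ∈ wells N l Finset.univ, u η = u' η) :
    genForm α (N - 1) u h = genForm α (N - 1) u' h := by
  have hinner : inner α N u (gen α h) = inner α N u' (gen α h) := by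
    refine Finset.sum_congr rfl fun η hη => ?_
    by_cases hw : η ∈ wells N l Finset.univ
    · rw [huu η hw]
    · simp only [hh.harmonic η hη hw, mul_zero]
  obtain ⟨n, rfl⟩ := Nat.exists_eq_add_of_le' hN
  rw [inner_gen hL, inner_gen hL] at hinner
  exact mul_left_cancel₀ (coefMu_pos α hN).ne' hinner

theorem IsPotential.genForm_testFn (hL : 2 ≤ L) (hN : 1 ≤ N) (hl : 0 ≤ l) (hd : d ≤ 1 / 2)
    (hld : 2 * l ≤ d * N) (hh : IsPotential α N l w h)
    (hu : HasWellValues N l (Pi.single x 1) u) :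
    genForm α (N - 1) (testFn α N d x) h = primGap α d * genForm α (N - 1) u h := by
  rw [hh.genForm_congr hL hN (testFn_eq_smul_on_wells hN hl hd hld x hu), map_smul,
    LinearMap.smul_apply, smul_eq_mul]

end WellValues

/-! ### The flow of the gradient of the test function -/

section Flow

variable {L : ℕ} [NeZero L] {α : ℝ} {N : ℕ} {l d : ℝ} {x w : ZMod L} {c : ZMod L → ℝ}
  {h : Config L → ℝ}

/-- The pairing of a field `φ` with the gradient of `h` along the jumps. -/
def gradPairing (α : ℝ) (n : ℕ) (φ : Config L → ZMod L → ℝ) (h : Config L → ℝ) : ℝ :=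
  ∑ ξ ∈ confs L n, weight α ξ * ∑ z, φ ξ z * (h (addAt ξ (z + 1)) - h (addAt ξ z))

theorem gradPairing_add (α : ℝ) (n : ℕ) (φ ψ : Config L → ZMod L → ℝ) (h : Config L → ℝ) :
    gradPairing α n (φ + ψ) h = gradPairing α n φ h + gradPairing α n ψ h := by
  simp only [gradPairing, Pi.add_apply, add_mul, mul_add, Finset.sum_add_distrib]

theorem gradPairing_sq_le (α : ℝ) (n : ℕ) (φ : Config L → ZMod L → ℝ) (h : Config L → ℝ) :
    gradPairing α n φ h ^ 2 ≤ sqNorm α n φ * energy α n h := by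
  have hprod : ∀ F : Config L → ZMod L → ℝ, ∑ ξ ∈ confs L n, weight α ξ * ∑ z, F ξ z =
      ∑ p ∈ confs L n ×ˢ Finset.univ, weight α p.1 * F p.1 p.2 := fun F => by
    simp only [Finset.sum_product, Finset.mul_sum]
  rw [gradPairing, sqNorm, energy, hprod, hprod, hprod]
  refine Finset.sum_sq_le_sum_mul_sum_of_sq_le_mul _
    (fun p _ => mul_nonneg (weight_pos α p.1).le (sq_nonneg _))
    (fun p _ => mul_nonneg (weight_pos α p.1).le (sq_nonneg _)) fun p _ => le_of_eq ?_
  ring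

theorem genForm_eq_gradPairing (α : ℝ) (n : ℕ) (u h : Config L → ℝ) (b : ZMod L) :
    genForm α n u h = gradPairing α n (fun ξ z => u (addAt ξ z) - u (addAt ξ b)) h := by
  refine Finset.sum_congr rfl fun ξ _ => ?_
  have hcycle : ∑ z, u (addAt ξ b) * (h (addAt ξ (z + 1)) - h (addAt ξ z)) = 0 := by
    rw [← Finset.mul_sum, Finset.sum_sub_distrib, sum_add_one fun z => h (addAt ξ z), sub_self,
      mul_zero]
  simp only [sub_mul]
  rw [Finset.sum_sub_distrib, hcycle, sub_zero]

theorem IsPotential.energy_le (hL : 2 ≤ L) (hα : 0 < α) (hN : 1 ≤ N) (hl : 0 ≤ l) (hd0 : 0 < d)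
    (hd : d < 1 / 2) (hld : 2 * l ≤ d * N) (hh : IsPotential α N l x h) :
    energy α (N - 1) h ≤ 4 / primGap α d ^ 2 * sqNorm α (N - 1) (testGrad α N d x) := by
  have hgap := primGap_pos hα hd0 hd
  have hself : gradPairing α (N - 1) (testGrad α N d x) h =
      -(1 / 2) * (primGap α d * energy α (N - 1) h) := by
    rw [mul_left_comm, ← genForm_self, ← hh.genForm_testFn hL hN hl hd.le hld hh.hasWellValues]
    exact (genForm_eq_gradPairing _ _ _ _ (x - 1)).symm
  have hcs := gradPairing_sq_le α (N - 1) (testGrad α N d x) h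
  rw [hself] at hcs
  rw [div_mul_eq_mul_div, le_div_iff₀ (by positivity)]
  rcases (energy_nonneg α (N - 1) h).eq_or_lt with hzero | hpos
  · have := sqNorm_nonneg α (N - 1) (testGrad α N d x)
    rw [← hzero, zero_mul]
    positivity
  · refine le_of_mul_le_mul_right ?_ hpos
    linarith

theorem gradPairing_flow (α : ℝ) (n N : ℕ) (l : ℝ) (x : ZMod L) (h : Config L → ℝ) :
    gradPairing α n (flow α N l x) h = ∑ w ∈ Finset.univ.erase x,
      ∑ ξ ∈ confs L n, weight α ξ * (tubeFlow α N l x w ξ * (h (addAt ξ w) - h (addAt ξ x))) := by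
  rw [Finset.sum_comm, gradPairing]
  refine Finset.sum_congr rfl fun ξ _ => ?_
  rw [← Finset.mul_sum]
  simp only [flow, Finset.sum_mul]
  rw [Finset.sum_comm]
  congr 1
  refine Finset.sum_congr rfl fun w _ => ?_
  simp only [ite_mul, zero_mul]
  rw [Finset.sum_ite_mem, Finset.univ_inter, ← sum_arc_sub x w fun z => h (addAt ξ z),
    Finset.mul_sum]

omit [NeZero L] in
theorem clear_addAt {A : Finset (ZMod L)} {z : ZMod L} (hz : z ∈ A) (ξ : Config L) :
    clear A (addAt ξ z) = clear A ξ := by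
  funext v
  unfold clear
  split_ifs with hv
  · rfl
  · exact addAt_of_ne _ (ne_of_mem_of_not_mem hz hv).symm

/-- The weight of the sites off `A`, in the tube of the configurations with at most `l` particles on
these sites. -/
def tubeWeight (α : ℝ) (A : Finset (ZMod L)) (l : ℝ) (η : Config L) : ℝ :=
  if (size (clear A η) : ℝ) ≤ l then bgWeight α A (clear A η) else 0

/-- The mass of the end of the tube at `w`, where the sites of `A` other than `w` are empty. -/
def flowMass (α : ℝ) (N : ℕ) (l : ℝ) (A : Finset (ZMod L)) (w : ZMod L) : ℝ :=
  ∑ η ∈ condensed N l A w, bgWeight α A (clear A η)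

theorem tendsto_flowMass (hα : 1 < α) {ℓ : ℕ → ℝ} (hℓ : Tendsto ℓ atTop atTop) (hxw : x ≠ w) :
    Tendsto (fun N => flowMass α N (ℓ N) {x, w} w) atTop (𝓝 (Gam α ^ (L - 2))) := by
  have hlim := tendsto_sum_condensed (L := L) hα hℓ (A := {x, w}) (w := w) (by simp)
    (r := fun _ _ => 1) (C := 1) (Eventually.of_forall fun N m _ _ => by simp)
    fun _ => tendsto_const_nhds
  rw [Finset.card_pair hxw] at hlim
  simpa only [flowMass, mul_one] using hlim

theorem condensed_pair (hxw : x ≠ w) (N : ℕ) (l : ℝ) :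
    condensed N l {x, w} w =
      {η ∈ {η ∈ confs L N | η x = 0} | (size (clear {x, w} η) : ℝ) ≤ l} := by
  ext η
  rw [Finset.mem_filter, Finset.mem_filter, mem_condensed, and_right_comm, and_assoc, and_assoc]
  refine and_congr_right fun hconf => ?_
  have hempty : (∀ v ∈ ({x, w} : Finset (ZMod L)), v ≠ w → η v = 0) ↔ η x = 0 := by
    simp [hxw]
  rw [hempty]
  refine and_congr_right fun hx => ?_
  have hsize : (size (clear {x, w} η) : ℝ) + (η x + η w) = N := by
    exact_mod_cast size_clear_pair hxw hconf
  rw [hx, Nat.cast_zero, zero_add] at hsize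
  constructor <;> intro <;> linarith

theorem sum_tubeWeight_mul_addAt (hN : 1 ≤ N) (hxw : x ≠ w) (hh : HasWellValues N l c h) :
    ∑ ξ ∈ confs L (N - 1), tubeWeight α {x, w} l (addAt ξ x) * h (addAt ξ x) =
      ∑ η ∈ confs L N, tubeWeight α {x, w} l η * h η - c w * flowMass α N l {x, w} w := by
  have hempty : ∑ η ∈ confs L N with η x = 0, tubeWeight α {x, w} l η * h η =
      c w * flowMass α N l {x, w} w := by
    simp only [tubeWeight, ite_mul, zero_mul]
    rw [← Finset.sum_filter, ← condensed_pair hxw, flowMass, Finset.mul_sum]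
    refine Finset.sum_congr rfl fun η hη => ?_
    rw [hh w η (Finset.mem_filter.1 hη).1, mul_comm]
  rw [← hempty, eq_sub_iff_add_eq', ← sum_confs_filter_ne_zero (N - 1) x fun η =>
    tubeWeight α {x, w} l η * h η, Nat.sub_add_cancel hN]
  exact Finset.sum_filter_add_sum_filter_not _ _ _

theorem mul_sum_tubeFlow (hN : 1 ≤ N) (hxw : x ≠ w) (hh : HasWellValues N l c h) :
    N * ((N : ℝ) ^ α) ^ 2 * ∑ ξ ∈ confs L (N - 1), weight α ξ *
      (tubeFlow α N l x w ξ * (h (addAt ξ w) - h (addAt ξ x))) =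
      c w * flowMass α N l {x, w} w - c x * flowMass α N l {x, w} x := by
  have hterm : ∀ ξ : Config L, N * ((N : ℝ) ^ α) ^ 2 * (weight α ξ *
      (tubeFlow α N l x w ξ * (h (addAt ξ w) - h (addAt ξ x)))) =
      tubeWeight α {x, w} l (addAt ξ w) * h (addAt ξ w) -
        tubeWeight α {x, w} l (addAt ξ x) * h (addAt ξ x) := by
    intro ξ
    rw [tubeWeight, tubeWeight, clear_addAt (by simp), clear_addAt (by simp), tubeFlow]
    split_ifs
    · have : (0 : ℝ) < N := Nat.cast_pos.2 hN
      have hax := a_pos α (ξ x)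
      have haw := a_pos α (ξ w)
      rw [weight_eq_mul_bgWeight α {x, w}, Finset.prod_pair hxw, slope]
      field_simp
    · simp only [zero_mul, mul_zero, sub_zero]
  rw [Finset.mul_sum, Finset.sum_congr rfl fun ξ _ => hterm ξ, Finset.sum_sub_distrib,
    sum_tubeWeight_mul_addAt hN hxw hh, Finset.pair_comm x w,
    sum_tubeWeight_mul_addAt hN hxw.symm hh]
  ring

end Flow

/-! ### Asymptotics of the capacity matrix -/

section Capacity

variable {L : ℕ} [NeZero L] {α : ℝ} {ℓ : ℕ → ℝ} {x y : ZMod L}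

theorem eventually_cutoff (hℓ : Tendsto ℓ atTop atTop)
    (hℓN : Tendsto (fun N : ℕ => ℓ N / (N : ℝ)) atTop (𝓝 0)) :
    ∀ᶠ N : ℕ in atTop, 1 ≤ N ∧ 0 ≤ ℓ N ∧ 0 < 2 * (ℓ N / (N : ℝ)) ∧ 2 * (ℓ N / (N : ℝ)) < 1 / 2 ∧
      2 * ℓ N ≤ 2 * (ℓ N / N) * N := by
  filter_upwards [eventually_ge_atTop 1, hℓ.eventually_gt_atTop 0,
    hℓN.eventually_lt_const (show (0 : ℝ) < 1 / 4 by norm_num)] with N hN hpos hlt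
  have hN0 : (0 : ℝ) < N := Nat.cast_pos.2 hN
  exact ⟨hN, hpos.le, by positivity, by linarith,
    by rw [mul_assoc, div_mul_cancel₀ _ hN0.ne']⟩

theorem tendsto_primGap_cutoff (hα : 0 < α)
    (hℓN : Tendsto (fun N : ℕ => ℓ N / (N : ℝ)) atTop (𝓝 0)) :
    Tendsto (fun N : ℕ => primGap α (2 * (ℓ N / N))) atTop (𝓝 (I α)) :=
  tendsto_primGap hα (by simpa only [mul_zero] using hℓN.const_mul 2)

theorem exists_mul_energy_potential_le (hL : 2 ≤ L) (hα : 3 < α) (hℓ : Tendsto ℓ atTop atTop)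
    (hℓN : Tendsto (fun N : ℕ => ℓ N / (N : ℝ)) atTop (𝓝 0)) (y : ZMod L) :
    ∃ C : ℝ, ∀ᶠ N : ℕ in atTop,
      N * ((N : ℝ) ^ α) ^ 2 * energy α (N - 1) (potential α N (ℓ N) y) ≤ C := by
  have hα0 : 0 < α := by linarith
  obtain ⟨C, hC⟩ := exists_mul_sqNorm_testGrad_le hL hα y
  have hlim : Tendsto (fun N : ℕ => 4 / primGap α (2 * (ℓ N / N)) ^ 2 * C) atTop
      (𝓝 (4 / I α ^ 2 * C)) :=
    (tendsto_const_nhds.div ((tendsto_primGap_cutoff hα0 hℓN).pow 2)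
      (pow_pos (I_pos hα0) 2).ne').mul_const C
  refine ⟨4 / I α ^ 2 * C + 1, ?_⟩
  filter_upwards [eventually_cutoff hℓ hℓN, eventually_mul_lt hℓN 2,
    hlim.eventually_le_const (lt_add_one _)] with N ⟨hN, hl, hd0, hd, hld⟩ h2l hle
  calc N * ((N : ℝ) ^ α) ^ 2 * energy α (N - 1) (potential α N (ℓ N) y)
      ≤ N * ((N : ℝ) ^ α) ^ 2 * (4 / primGap α (2 * (ℓ N / N)) ^ 2 *
          sqNorm α (N - 1) (testGrad α N (2 * (ℓ N / N)) y)) := by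
        gcongr
        exact (isPotential_potential α h2l y).energy_le hL hα0 hN hl hd0 hd hld
    _ = 4 / primGap α (2 * (ℓ N / N)) ^ 2 * (N * ((N : ℝ) ^ α) ^ 2 *
          sqNorm α (N - 1) (testGrad α N (2 * (ℓ N / N)) y)) := by ring
    _ ≤ 4 / primGap α (2 * (ℓ N / N)) ^ 2 * C := by
        gcongr
        exact hC N _ hN
    _ ≤ 4 / I α ^ 2 * C + 1 := hle

theorem tendsto_gradPairing_testGrad_sub_flow (hL : 2 ≤ L) (hα : 3 < α)
    (hℓ : Tendsto ℓ atTop atTop) (hℓN : Tendsto (fun N : ℕ => ℓ N / (N : ℝ)) atTop (𝓝 0))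
    (x y : ZMod L) :
    Tendsto (fun N : ℕ => N * ((N : ℝ) ^ α) ^ 2 * gradPairing α (N - 1)
      (testGrad α N (2 * (ℓ N / N)) x - flow α N (ℓ N) x) (potential α N (ℓ N) y))
      atTop (𝓝 0) := by
  obtain ⟨C, hC⟩ := exists_mul_energy_potential_le hL hα hℓ hℓN y
  have hlim := ((tendsto_mul_sqNorm_testGrad_sub_flow hL hα hℓ hℓN x).mul_const C).sqrt
  rw [zero_mul, Real.sqrt_zero] at hlim
  refine squeeze_zero_norm' ?_ hlim
  filter_upwards [hC] with N hN
  set K : ℝ := N * ((N : ℝ) ^ α) ^ 2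
  set φ := testGrad α N (2 * (ℓ N / N)) x - flow α N (ℓ N) x
  set h : Config L → ℝ := potential α N (ℓ N) y
  have hK : 0 ≤ K := by positivity
  refine Real.abs_le_sqrt ?_
  calc (K * gradPairing α (N - 1) φ h) ^ 2 = K ^ 2 * gradPairing α (N - 1) φ h ^ 2 := by ring
    _ ≤ K ^ 2 * (sqNorm α (N - 1) φ * energy α (N - 1) h) := by
        gcongr
        exact gradPairing_sq_le ..
    _ = K * sqNorm α (N - 1) φ * (K * energy α (N - 1) h) := by ring
    _ ≤ K * sqNorm α (N - 1) φ * C :=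
        mul_le_mul_of_nonneg_left hN (mul_nonneg hK (sqNorm_nonneg ..))

theorem tendsto_mul_genForm_testFn (hL : 2 ≤ L) (hα : 3 < α) (hℓ : Tendsto ℓ atTop atTop)
    (hℓN : Tendsto (fun N : ℕ => ℓ N / (N : ℝ)) atTop (𝓝 0)) (hxy : x ≠ y) :
    Tendsto (fun N : ℕ => N * ((N : ℝ) ^ α) ^ 2 *
      genForm α (N - 1) (testFn α N (2 * (ℓ N / N)) x) (potential α N (ℓ N) y)) atTop
      (𝓝 (Gam α ^ (L - 2))) := by
  have hsum := (tendsto_flowMass (L := L) (by linarith) hℓ hxy).add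
    (tendsto_gradPairing_testGrad_sub_flow hL hα hℓ hℓN x y)
  rw [add_zero] at hsum
  refine hsum.congr' ?_
  filter_upwards [eventually_mul_lt hℓN 2, eventually_ge_atTop 1] with N h2l hN
  have hvalues := (isPotential_potential α h2l y).hasWellValues
  have hflow : N * ((N : ℝ) ^ α) ^ 2 *
      gradPairing α (N - 1) (flow α N (ℓ N) x) (potential α N (ℓ N) y) =
      flowMass α N (ℓ N) {x, y} y := by
    rw [gradPairing_flow, Finset.mul_sum, Finset.sum_eq_single_of_mem y
      (Finset.mem_erase.2 ⟨hxy.symm, Finset.mem_univ y⟩) fun w hw hwy => ?_,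
      mul_sum_tubeFlow hN hxy hvalues, Pi.single_eq_same, Pi.single_eq_of_ne hxy, one_mul,
      zero_mul, sub_zero]
    rw [mul_sum_tubeFlow hN (Finset.ne_of_mem_erase hw).symm hvalues, Pi.single_eq_of_ne hxy,
      Pi.single_eq_of_ne hwy, zero_mul, zero_mul, sub_zero]
  rw [genForm_eq_gradPairing _ _ _ _ (x - 1), ← hflow, ← mul_add, ← gradPairing_add,
    add_sub_cancel]
  rfl

/-- The indicator function of a well. -/
def wellInd (N : ℕ) (l : ℝ) (z : ZMod L) (η : Config L) : ℝ := if η ∈ well N l z then 1 else 0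

theorem hasWellValues_wellInd {N : ℕ} {l : ℝ} (hl : 2 * l < N) (z : ZMod L) :
    HasWellValues N l (Pi.single z 1) (wellInd N l z) := fun w η hη => by
  by_cases hwz : w = z
  · subst hwz
    rw [wellInd, if_pos hη, Pi.single_eq_same]
  · rw [wellInd, if_neg (notMem_well_of_mem_well hl hwz hη), Pi.single_eq_of_ne hwz]

/-- The capacity matrix `⟨1_{𝓔^z}, 𝓛 h_w⟩`, where `h_w` is the potential of the well at `w`, up to
the factor `coefMu L α N`. -/
def capEntry (α : ℝ) (N : ℕ) (l : ℝ) (z w : ZMod L) : ℝ :=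
  genForm α (N - 1) (wellInd N l z) (potential α N l w)

theorem tendsto_capEntry (hL : 2 ≤ L) (hα : 3 < α) (hℓ : Tendsto ℓ atTop atTop)
    (hℓN : Tendsto (fun N : ℕ => ℓ N / (N : ℝ)) atTop (𝓝 0)) (hxy : x ≠ y) :
    Tendsto (fun N : ℕ => (N : ℝ) ^ (1 + α) *
      (coefMu L α N * capEntry α N (ℓ N) x y)) atTop (𝓝 (1 / (L * (Gam α * I α)))) := by
  have hα0 : 0 < α := by linarith
  have hα1 : 1 < α := by linarith
  have hG := Gam_pos hα1
  have hI := I_pos hα0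
  have : (0 : ℝ) < L := Nat.cast_pos.2 (by omega)
  have hlim := (tendsto_mul_genForm_testFn hL hα hℓ hℓN hxy).div
    ((tendsto_Z (L := L) hα1 hℓ hℓN).mul (tendsto_primGap_cutoff hα0 hℓN))
    (by positivity)
  have hvalue : Gam α ^ (L - 2) / (L * Gam α ^ (L - 1) * I α) = 1 / (L * (Gam α * I α)) := by
    rw [show L - 1 = L - 2 + 1 by omega, pow_succ]
    field_simp
  rw [hvalue] at hlim
  refine hlim.congr' ?_
  filter_upwards [eventually_cutoff hℓ hℓN, eventually_mul_lt hℓN 2]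
    with N ⟨hN, hl, hd0, hd, hld⟩ h2l
  have hN0 : (0 : ℝ) < N := Nat.cast_pos.2 hN
  have hgap := (primGap_pos hα0 hd0 hd).ne'
  rw [Pi.div_apply, (isPotential_potential α h2l y).genForm_testFn hL hN hl hd.le hld
    (hasWellValues_wellInd h2l x), capEntry, coefMu, Real.rpow_add hN0, Real.rpow_one]
  generalize primGap α (2 * (ℓ N / N)) = γ at hgap ⊢
  field_simp

end Capacity

/-! ### Time reversal by reflection -/

section Reflection

variable {L : ℕ} [NeZero L]

/-- The reflection of the torus, acting on configurations. It conjugates the process to its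
time reversal. -/
def reflect (η : Config L) : Config L := fun z => η (-z)

omit [NeZero L] in
theorem reflect_involutive : Function.Involutive (reflect (L := L)) := fun η =>
  funext fun z => congrArg η (neg_neg z)

theorem reflect_mem_confs {N : ℕ} {η : Config L} (hη : η ∈ confs L N) : reflect η ∈ confs L N := by
  rw [mem_confs] at hη ⊢
  rw [← hη]
  exact Fintype.sum_equiv (Equiv.neg _) _ _ fun _ => rfl

theorem weight_reflect (α : ℝ) (η : Config L) : weight α (reflect η) = weight α η :=
  Fintype.prod_equiv (Equiv.neg _) _ _ fun _ => rfl

omit [NeZero L] in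
theorem reflect_addAt (ξ : Config L) (z : ZMod L) :
    reflect (addAt ξ z) = addAt (reflect ξ) (-z) := by
  funext v
  simp [reflect, addAt_apply, neg_eq_iff_eq_neg]

theorem reflect_mem_well {N : ℕ} {l : ℝ} {z : ZMod L} {η : Config L} (hη : η ∈ well N l z) :
    reflect η ∈ well N l (-z) := by
  rw [mem_well] at hη ⊢
  exact ⟨reflect_mem_confs hη.1, by simpa only [reflect, neg_neg] using hη.2⟩

theorem genForm_reflect (α : ℝ) (n : ℕ) (u h : Config L → ℝ) :
    genForm α n (u ∘ reflect) (h ∘ reflect) = genForm α n h u := by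
  simp only [genForm_apply]
  refine Finset.sum_nbij' reflect reflect (fun ξ => reflect_mem_confs) (fun ξ => reflect_mem_confs)
    (fun ξ _ => reflect_involutive ξ) (fun ξ _ => reflect_involutive ξ) fun ξ _ => ?_
  rw [weight_reflect]
  congr 1
  simp only [Function.comp_apply, reflect_addAt]
  generalize reflect ξ = ζ
  have hneg : ∑ z : ZMod L, u (addAt ζ (-z)) * (h (addAt ζ (-(z + 1))) - h (addAt ζ (-z))) =
      ∑ z : ZMod L, u (addAt ζ z) * (h (addAt ζ (z - 1)) - h (addAt ζ z)) :=
    Fintype.sum_equiv (Equiv.neg _) _ _ fun z => by rw [Equiv.neg_apply, neg_add']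
  have hshift := sum_add_one fun z => u (addAt ζ z) * h (addAt ζ (z - 1))
  simp only [add_sub_cancel_right] at hshift
  rw [hneg]
  simp only [mul_sub, Finset.sum_sub_distrib]
  rw [← hshift]
  simp only [mul_comm]

end Reflection

/-! ### The variational formula -/

section BilinForm

variable {V : Type*} [AddCommGroup V] [Module ℝ V] {B : LinearMap.BilinForm ℝ V} {p q u f : V}

theorem two_mul_apply_add_apply_self_le (hB : ∀ v, B v v ≤ 0) (hpq : B q u = B u p) :
    2 * B ((1 / 2 : ℝ) • (p + q)) u + B u u ≤ -B p p := by
  have hnonpos := hB (p + u)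
  simp only [map_add, map_smul, LinearMap.add_apply, LinearMap.smul_apply, smul_eq_mul]
    at hnonpos ⊢
  linarith

theorem two_mul_apply_neg_add_apply_neg_self (hfp : B f p = B p p) :
    2 * B f (-p) + B (-p) (-p) = -B p p := by
  simp only [map_neg, LinearMap.neg_apply, hfp]
  ring

end BilinForm

section PairPotential

variable {L : ℕ} [NeZero L] {α : ℝ} {N : ℕ} {l : ℝ} {x y w : ZMod L} {c c' : ZMod L → ℝ}
  {u v : Config L → ℝ} {r s r' s' : ℝ}

theorem HasWellValues.genForm_potential (hL : 2 ≤ L) (hN : 1 ≤ N) (hl : 2 * l < N)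
    (hu : HasWellValues N l c u) (w : ZMod L) :
    genForm α (N - 1) u (potential α N l w) = ∑ z, c z * capEntry α N l z w := by
  have hsum : HasWellValues N l c (∑ z, c z • wellInd N l z) := fun z η hη => by
    rw [Finset.sum_apply, Finset.sum_eq_single_of_mem z (Finset.mem_univ z) fun t _ htz => ?_,
      Pi.smul_apply, hasWellValues_wellInd hl z z η hη, Pi.single_eq_same, smul_eq_mul, mul_one]
    rw [Pi.smul_apply, hasWellValues_wellInd hl t z η hη, Pi.single_eq_of_ne htz.symm, smul_zero]
  rw [(isPotential_potential α hl w).genForm_congr hL hN (hu.eq_on_wells hsum)]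
  simp only [map_sum, map_smul, LinearMap.sum_apply, LinearMap.smul_apply, smul_eq_mul, capEntry]

theorem capEntry_self (hL : 2 ≤ L) (hN : 1 ≤ N) (hl : 2 * l < N) (y : ZMod L) :
    capEntry α N l y y = -∑ z ∈ Finset.univ.erase y, capEntry α N l z y := by
  have hone : HasWellValues N l (fun _ : ZMod L => 1) (fun _ => 1) := fun _ _ _ => rfl
  have hzero := hone.genForm_potential (α := α) hL hN hl y
  simp only [one_mul] at hzero
  rw [genForm_const_left, ← Finset.add_sum_erase _ _ (Finset.mem_univ y)] at hzero
  linarith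

/-- The function `u` is equal to `r` on the well at `x`, to `s` on the well at `y` and to `0` on
the other wells. -/
def HasPairValues (N : ℕ) (l : ℝ) (x y : ZMod L) (r s : ℝ) (u : Config L → ℝ) : Prop :=
  HasWellValues N l (Pi.single x r + Pi.single y s) u

theorem hasPairValues_iff (hxy : x ≠ y) :
    HasPairValues N l x y r s u ↔ (∀ η ∈ well N l x, u η = r) ∧ (∀ η ∈ well N l y, u η = s) ∧
      ∀ η ∈ wells N l (Finset.univ.filter fun z => z ≠ x ∧ z ≠ y), u η = 0 := by
  constructor
  · refine fun hu => ⟨fun η hη => ?_, fun η hη => ?_, fun η hη => ?_⟩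
    · simpa [hxy] using hu x η hη
    · simpa [hxy.symm] using hu y η hη
    · obtain ⟨z, hz, hzη⟩ := mem_wells.1 hη
      obtain ⟨hzx, hzy⟩ := (Finset.mem_filter.1 hz).2
      simpa [hzx, hzy] using hu z η hzη
  · rintro ⟨hux, huy, hu0⟩ z η hη
    by_cases hzx : z = x
    · subst hzx
      simpa [hxy] using hux η hη
    by_cases hzy : z = y
    · subst hzy
      simpa [hxy.symm] using huy η hη
    simpa [hzx, hzy] using hu0 η (mem_wells.2 ⟨z, by simp [hzx, hzy], hη⟩)

theorem HasPairValues.add (hu : HasPairValues N l x y r s u)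
    (hv : HasPairValues N l x y r' s' v) : HasPairValues N l x y (r + r') (s + s') (u + v) :=
  fun z η hη => by
    rw [Pi.add_apply, hu z η hη, hv z η hη, Pi.single_add, Pi.single_add]
    simp only [Pi.add_apply]
    ring

theorem HasPairValues.smul (k : ℝ) (hu : HasPairValues N l x y r s u) :
    HasPairValues N l x y (k * r) (k * s) (k • u) := fun z η hη => by
  rw [Pi.smul_apply, hu z η hη, ← smul_eq_mul, ← smul_eq_mul, Pi.single_smul, Pi.single_smul,
    ← smul_add, Pi.smul_apply]

theorem HasPairValues.comp_reflect (hu : HasPairValues N l (-x) (-y) r s u) :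
    HasPairValues N l x y r s (u ∘ reflect) := fun z η hη => by
  rw [Function.comp_apply, hu _ _ (reflect_mem_well hη)]
  simp only [Pi.add_apply, Pi.single_apply, neg_inj]

/-- The function equal to `1` on the well at `x` and to `0` on the wells other than those at `x`
and `y`, which is harmonic off the wells and orthogonal in `genForm` to the indicator function of
the well at `y`: the equilibrium potential of the process in which that well is collapsed to a
point. -/
def pairPotential (α : ℝ) (N : ℕ) (l : ℝ) (x y : ZMod L) : Config L → ℝ :=
  potential α N l x - (capEntry α N l y x / capEntry α N l y y) • potential α N l y

/-- The counterpart of `pairPotential` for the time-reversed process. -/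
def pairPotentialAdj (α : ℝ) (N : ℕ) (l : ℝ) (x y : ZMod L) : Config L → ℝ :=
  pairPotential α N l (-x) (-y) ∘ reflect

/-- The capacity, up to the factor `coefMu L α N`, between the well at `x` and the wells other than
those at `x` and `y`, when the well at `y` is collapsed to a point. -/
def pairCap (α : ℝ) (N : ℕ) (l : ℝ) (x y : ZMod L) : ℝ :=
  -(capEntry α N l x x - capEntry α N l y x * capEntry α N l x y / capEntry α N l y y)

theorem exists_hasPairValues_pairPotential (α : ℝ) (hl : 2 * l < N) (x y : ZMod L) :
    ∃ s, HasPairValues N l x y 1 s (pairPotential α N l x y) := by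
  refine ⟨-(capEntry α N l y x / capEntry α N l y y), fun z η hη => ?_⟩
  rw [pairPotential, Pi.sub_apply, Pi.smul_apply,
    (isPotential_potential α hl x).hasWellValues z η hη,
    (isPotential_potential α hl y).hasWellValues z η hη]
  by_cases hzy : z = y <;> simp [hzy, sub_eq_add_neg]

theorem exists_hasPairValues_pairPotentialAdj (α : ℝ) (hl : 2 * l < N) (x y : ZMod L) :
    ∃ s, HasPairValues N l x y 1 s (pairPotentialAdj α N l x y) :=
  (exists_hasPairValues_pairPotential α hl (-x) (-y)).imp fun _ hs => hs.comp_reflect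

theorem HasPairValues.genForm_potential (hL : 2 ≤ L) (hN : 1 ≤ N) (hl : 2 * l < N)
    (hu : HasPairValues N l x y r s u) (w : ZMod L) :
    genForm α (N - 1) u (potential α N l w) =
      r * capEntry α N l x w + s * capEntry α N l y w := by
  rw [HasWellValues.genForm_potential hL hN hl hu]
  simp [add_mul, Finset.sum_add_distrib, Pi.single_apply]

theorem HasPairValues.genForm_pairPotential (hL : 2 ≤ L) (hN : 1 ≤ N) (hl : 2 * l < N)
    (hne : capEntry α N l y y ≠ 0) (hu : HasPairValues N l x y r s u) :
    genForm α (N - 1) u (pairPotential α N l x y) = -(r * pairCap α N l x y) := by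
  rw [pairPotential, map_sub, map_smul, hu.genForm_potential hL hN hl,
    hu.genForm_potential hL hN hl, pairCap, smul_eq_mul]
  field_simp
  ring

theorem HasPairValues.genForm_pairPotentialAdj (hL : 2 ≤ L) (hN : 1 ≤ N) (hl : 2 * l < N)
    (hne : capEntry α N l (-y) (-y) ≠ 0) (hu : HasPairValues N l x y r s u) :
    genForm α (N - 1) (pairPotentialAdj α N l x y) u = -(r * pairCap α N l (-x) (-y)) := by
  have hu' : HasPairValues N l (-x) (-y) r s (u ∘ reflect) :=
    HasPairValues.comp_reflect (by rwa [neg_neg, neg_neg])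
  rw [← hu'.genForm_pairPotential hL hN hl hne, ← genForm_reflect, pairPotentialAdj,
    Function.comp_assoc, reflect_involutive.comp_self, Function.comp_id]

theorem pairCap_neg (hL : 2 ≤ L) (hN : 1 ≤ N) (hl : 2 * l < N) (hne : capEntry α N l y y ≠ 0)
    (hne' : capEntry α N l (-y) (-y) ≠ 0) :
    pairCap α N l (-x) (-y) = pairCap α N l x y := by
  obtain ⟨s, hp⟩ := exists_hasPairValues_pairPotential α hl x y
  obtain ⟨t, hq⟩ := exists_hasPairValues_pairPotentialAdj α hl x y
  have hpair := hq.genForm_pairPotential hL hN hl hne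
  rw [hp.genForm_pairPotentialAdj hL hN hl hne'] at hpair
  linarith

theorem two_mul_inner_gen_sub_inner_neg_genSym (hL : 2 ≤ L) (hN : 1 ≤ N) (f h : Config L → ℝ) :
    2 * inner α N f (gen α h) - inner α N h (fun η => -genSym α h η) =
      coefMu L α N * (2 * genForm α (N - 1) f h + genForm α (N - 1) h h) := by
  obtain ⟨n, rfl⟩ := Nat.exists_eq_add_of_le' hN
  rw [inner_gen hL, inner_neg_genSym_self hL, Nat.add_sub_cancel]
  ring

theorem infG_le (hL : 2 ≤ L) (hN : 1 ≤ N) (hl : 2 * l < N) (hxy : x ≠ y)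
    (hne : capEntry α N l y y ≠ 0) (hne' : capEntry α N l (-y) (-y) ≠ 0) :
    infG α N l x y ≤ ((coefMu L α N * pairCap α N l x y : ℝ) : EReal) := by
  obtain ⟨s, hp⟩ := exists_hasPairValues_pairPotential α hl x y
  obtain ⟨t, hq⟩ := exists_hasPairValues_pairPotentialAdj α hl x y
  have hf := (hp.add hq).smul (1 / 2)
  norm_num only at hf
  obtain ⟨hfx, hfy, hf0⟩ := (hasPairValues_iff hxy).1 hf
  refine iInf₂_le_of_le _ ⟨hfx, hf0, _, hfy⟩ (iSup₂_le ?_)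
  rintro h ⟨⟨r, hhx⟩, ⟨s', hhy⟩, hh0⟩
  have hh : HasPairValues N l x y r s' h := (hasPairValues_iff hxy).2 ⟨hhx, hhy, hh0⟩
  have hpq : genForm α (N - 1) (pairPotentialAdj α N l x y) h =
      genForm α (N - 1) h (pairPotential α N l x y) := by
    rw [hh.genForm_pairPotentialAdj hL hN hl hne', hh.genForm_pairPotential hL hN hl hne,
      pairCap_neg hL hN hl hne hne']
  have hpp := hp.genForm_pairPotential hL hN hl hne
  rw [EReal.coe_le_coe_iff, two_mul_inner_gen_sub_inner_neg_genSym hL hN]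
  refine mul_le_mul_of_nonneg_left ?_ (coefMu_pos α hN).le
  refine (two_mul_apply_add_apply_self_le (genForm_self_nonpos α (N - 1)) hpq).trans_eq ?_
  rw [hpp, one_mul, neg_neg]

theorem le_infG (hL : 2 ≤ L) (hN : 1 ≤ N) (hl : 2 * l < N) (hxy : x ≠ y)
    (hne : capEntry α N l y y ≠ 0) :
    ((coefMu L α N * pairCap α N l x y : ℝ) : EReal) ≤ infG α N l x y := by
  obtain ⟨s, hp⟩ := exists_hasPairValues_pairPotential α hl x y
  have hneg := hp.smul (-1)
  rw [neg_one_smul] at hneg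
  obtain ⟨hnegx, hnegy, hneg0⟩ := (hasPairValues_iff hxy).1 hneg
  refine le_iInf₂ fun f ⟨hfx, hf0, t, hfy⟩ =>
    le_iSup₂_of_le _ ⟨⟨_, hnegx⟩, ⟨_, hnegy⟩, hneg0⟩ ?_
  have hf : HasPairValues N l x y 1 t f := (hasPairValues_iff hxy).2 ⟨hfx, hfy, hf0⟩
  have hpp := hp.genForm_pairPotential hL hN hl hne
  have hfp := (hf.genForm_pairPotential hL hN hl hne).trans hpp.symm
  rw [two_mul_inner_gen_sub_inner_neg_genSym hL hN, two_mul_apply_neg_add_apply_neg_self hfp, hpp,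
    one_mul, neg_neg]

end PairPotential

/-! ### The limits -/

section Limits

variable {L : ℕ} [NeZero L] {α : ℝ} {ℓ : ℕ → ℝ} {x y : ZMod L}

theorem tendsto_capEntry_self (hL : 2 ≤ L) (hα : 3 < α) (hℓ : Tendsto ℓ atTop atTop)
    (hℓN : Tendsto (fun N : ℕ => ℓ N / (N : ℝ)) atTop (𝓝 0)) (y : ZMod L) :
    Tendsto (fun N : ℕ => (N : ℝ) ^ (1 + α) * (coefMu L α N * capEntry α N (ℓ N) y y)) atTop
      (𝓝 (-((L - 1) * (1 / (L * (Gam α * I α)))))) := by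
  have hsum := (tendsto_finsetSum (Finset.univ.erase y) fun z hz =>
    tendsto_capEntry hL hα hℓ hℓN (Finset.ne_of_mem_erase hz)).neg
  rw [Finset.sum_const, Finset.card_erase_of_mem (Finset.mem_univ y), Finset.card_univ,
    ZMod.card, nsmul_eq_mul, Nat.cast_sub (by omega), Nat.cast_one] at hsum
  refine hsum.congr' ?_
  filter_upwards [eventually_ge_atTop 1, eventually_mul_lt hℓN 2] with N hN hl
  rw [capEntry_self hL hN hl y, mul_neg, mul_neg, Finset.mul_sum, Finset.mul_sum]

omit [NeZero L] in
theorem capEntry_self_limit_ne_zero (hL : 2 ≤ L) (hα : 1 < α) :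
    -(((L : ℝ) - 1) * (1 / (L * (Gam α * I α)))) ≠ 0 := by
  have hL1 : (0 : ℝ) < (L : ℝ) - 1 := sub_pos.2 (Nat.one_lt_cast.2 hL)
  have hL0 : (0 : ℝ) < L := by linarith
  exact neg_ne_zero.2 (mul_pos hL1 (one_div_pos.2
    (mul_pos hL0 (mul_pos (Gam_pos hα) (I_pos (by linarith)))))).ne'

theorem eventually_capEntry_self_ne_zero (hL : 2 ≤ L) (hα : 3 < α) (hℓ : Tendsto ℓ atTop atTop)
    (hℓN : Tendsto (fun N : ℕ => ℓ N / (N : ℝ)) atTop (𝓝 0)) (y : ZMod L) :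
    ∀ᶠ N : ℕ in atTop, capEntry α N (ℓ N) y y ≠ 0 := by
  filter_upwards [(tendsto_capEntry_self hL hα hℓ hℓN y).eventually_ne
    (capEntry_self_limit_ne_zero hL (by linarith))] with N hN
  exact right_ne_zero_of_mul (right_ne_zero_of_mul hN)

theorem tendsto_pairCap (hL : 2 ≤ L) (hα : 3 < α) (hℓ : Tendsto ℓ atTop atTop)
    (hℓN : Tendsto (fun N : ℕ => ℓ N / (N : ℝ)) atTop (𝓝 0)) (hxy : x ≠ y) :
    Tendsto (fun N : ℕ => (N : ℝ) ^ (1 + α) * (coefMu L α N * pairCap α N (ℓ N) x y)) atTop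
      (𝓝 (1 / (Gam α * I α) * (((L : ℝ) - 2) / ((L : ℝ) - 1)))) := by
  have hα1 : 1 < α := by linarith
  have hG := (Gam_pos hα1).ne'
  have hI := (I_pos (zero_lt_one.trans hα1)).ne'
  have hL1 : (L : ℝ) - 1 ≠ 0 := (sub_pos.2 (Nat.one_lt_cast.2 hL)).ne'
  have hL0 : (L : ℝ) ≠ 0 := Nat.cast_ne_zero.2 (NeZero.ne L)
  have hlim := ((tendsto_capEntry_self hL hα hℓ hℓN x).sub
    (((tendsto_capEntry hL hα hℓ hℓN hxy.symm).mul (tendsto_capEntry hL hα hℓ hℓN hxy)).div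
      (tendsto_capEntry_self hL hα hℓ hℓN y) (capEntry_self_limit_ne_zero hL hα1))).neg
  have hvalue : -(-(((L : ℝ) - 1) * (1 / (L * (Gam α * I α)))) -
      1 / (L * (Gam α * I α)) * (1 / (L * (Gam α * I α))) /
        -(((L : ℝ) - 1) * (1 / (L * (Gam α * I α))))) =
      1 / (Gam α * I α) * (((L : ℝ) - 2) / ((L : ℝ) - 1)) := by
    field_simp
    ring
  rw [hvalue] at hlim
  refine hlim.congr' ?_
  filter_upwards [eventually_ge_atTop 1, eventually_capEntry_self_ne_zero hL hα hℓ hℓN y]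
    with N hN hne
  have hpow := (Real.rpow_pos_of_pos (Nat.cast_pos.2 hN) (1 + α)).ne'
  have hcoef := (coefMu_pos (L := L) α hN).ne'
  rw [pairCap, Pi.div_apply]
  generalize (N : ℝ) ^ (1 + α) = K at hpow ⊢
  field_simp

theorem tendsto_infG (hL : 2 ≤ L) (hα : 3 < α) (hℓ : Tendsto ℓ atTop atTop)
    (hℓN : Tendsto (fun N : ℕ => ℓ N / (N : ℝ)) atTop (𝓝 0)) (hxy : x ≠ y) :
    Tendsto (fun N : ℕ => (((N : ℝ) ^ (1 + α) : ℝ) : EReal) * infG α N (ℓ N) x y) atTop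
      (𝓝 ((1 / (Gam α * I α) * (((L : ℝ) - 2) / ((L : ℝ) - 1)) : ℝ) : EReal)) := by
  refine (EReal.tendsto_coe.2 (tendsto_pairCap hL hα hℓ hℓN hxy)).congr' ?_
  filter_upwards [eventually_ge_atTop 1, eventually_mul_lt hℓN 2,
    eventually_capEntry_self_ne_zero hL hα hℓ hℓN y,
    eventually_capEntry_self_ne_zero hL hα hℓ hℓN (-y)] with N hN hl hne hne'
  rw [(infG_le hL hN hl hxy hne hne').antisymm (le_infG hL hN hl hxy hne), ← EReal.coe_mul]

theorem meanRate_eq_capEntry (hL : 2 ≤ L) {N : ℕ} (hN : 1 ≤ N) {l : ℝ} (hl : 2 * l < N)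
    (hxy : x ≠ y) :
    meanRate α N l y x = coefMu L α N * capEntry α N l y x / ∑ η ∈ well N l y, mu α N η := by
  have hinner : inner α N (wellInd N l y) (gen α (potential α N l x)) =
      ∑ η ∈ well N l y, mu α N η * gen α (potential α N l x) η := by
    have hsub : well N l y ⊆ confs L N := Finset.filter_subset ..
    rw [inner, ← Finset.sum_subset hsub fun η _ hη => by
      rw [wellInd, if_neg hη, zero_mul, mul_zero]]
    exact Finset.sum_congr rfl fun η hη => by rw [wellInd, if_pos hη, one_mul]
  obtain ⟨n, rfl⟩ := Nat.exists_eq_add_of_le' hN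
  rw [meanRate_eq α hl hxy.symm, ← hinner, inner_gen hL, capEntry, Nat.add_sub_cancel,
    one_div_mul_eq_div]

theorem tendsto_meanRate (hL : 2 ≤ L) (hα : 3 < α) (hℓ : Tendsto ℓ atTop atTop)
    (hℓN : Tendsto (fun N : ℕ => ℓ N / (N : ℝ)) atTop (𝓝 0)) (hxy : x ≠ y) :
    Tendsto (fun N : ℕ => (N : ℝ) ^ (1 + α) * meanRate α N (ℓ N) y x) atTop
      (𝓝 (1 / (Gam α * I α))) := by
  have hL0 : (L : ℝ) ≠ 0 := Nat.cast_ne_zero.2 (NeZero.ne L)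
  have hlim := (tendsto_capEntry hL hα hℓ hℓN hxy.symm).div
    (tendsto_mu_well (by linarith) hℓ hℓN y) (one_div_ne_zero hL0)
  rw [← div_div 1, div_right_comm, div_self (one_div_ne_zero hL0)] at hlim
  refine hlim.congr' ?_
  filter_upwards [eventually_ge_atTop 1, eventually_mul_lt hℓN 2] with N hN hl
  rw [meanRate_eq_capEntry hL hN hl hxy, Pi.div_apply, mul_div_assoc]

end Limits

end ZeroRange

end

theorem proposition5p2 (L : ℕ) [NeZero L] (α : ℝ) (hα : 3 < α) (ℓ : ℕ → ℝ)
    (hℓ : Filter.Tendsto ℓ Filter.atTop Filter.atTop)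
    (hℓN : Filter.Tendsto (fun N : ℕ => ℓ N / (N : ℝ)) Filter.atTop (nhds 0))
    (x y : ZMod L) (hxy : x ≠ y) :
    Filter.Tendsto
        (fun N : ℕ => (((N : ℝ) ^ (1 + α) : ℝ) : EReal) * ZeroRange.infG α N (ℓ N) x y)
        Filter.atTop
        (nhds ((1 / (ZeroRange.Gam α * ZeroRange.I α) * (((L : ℝ) - 2) / ((L : ℝ) - 1)) : ℝ) :
          EReal)) ∧
      Filter.Tendsto
        (fun N : ℕ => (N : ℝ) ^ (1 + α) * ZeroRange.meanRate α N (ℓ N) y x)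
        Filter.atTop
        (nhds (1 / (ZeroRange.Gam α * ZeroRange.I α))) := by
  open ZeroRange in
  have hL : 2 ≤ L := by
    by_contra hlt
    obtain rfl : L = 1 := by have := NeZero.ne L; omega
    exact hxy (Subsingleton.elim x y)
  exact ⟨tendsto_infG hL hα hℓ hℓN hxy, tendsto_meanRate hL hα hℓ hℓN hxy⟩
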